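/- Let $\mathfrak g$ be a finite-dimensional complex semisimple Lie algebra with triangular decomposition $\mathfrak g=\mathfrak n_-\oplus\mathfrak h\oplus\mathfrak n_+$, root system $R$, corresponding base $B$, Weyl group $W$, half-sum of positive roots $\rho$, and dot action $w\cdot\mu=w(\mu+\rho)-\rho$. For a root $\alpha$ let $X_\alpha$ be a root vector, $H_\alpha$ the coroot and $s_\alpha$ the reflection. Let $\lambda\in\mathfrak h^*$ be integral (that is, $\lambda(H_\alpha)\in\mathbb Z$ for all $\alpha\in R$), dominant (no $(\lambda+\rho)(H_\alpha)$, $\alpha>0$, is a negative integer) and regular (the stabilizer of $\lambda$ in $W$ for the dot action is trivial). Let $L(\mu)$ be the simple highest weight module with highest weight $\mu$ and put $L(w)=L(w\cdot\lambda)$. Let $\mathcal O$ be the BGG category $\mathcal O$ of $\mathfrak g$ and $\mathcal O_\lambda$ its block whose simple modules are the $L(w)$, $w\in W$. Let $S\subset B$, let $W^S$ be the subgroup of $W$ generated by the $s_\alpha$, $\alpha\in S$, let $w^S$ and $w^B$ be the longest elements of $W^S$ and $W$, and put $\overline{\mathbf w}=w^Sw^B$ and $\nu=\overline{\mathbf w}\cdot\lambda$.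 Let $\mathfrak a$ be the semisimple subalgebra of $\mathfrak g$ generated by the $X_{\pm\alpha}$, $\alpha\in S$; let $\mathfrak h^\perp$ be the orthogonal complement of $\mathfrak a\cap\mathfrak h$ in $\mathfrak h$ for the Killing form; let $\xi$ and $\zeta$ be the restrictions of $\nu$ to $\mathfrak h^\perp$ and to $\mathfrak a\cap\mathfrak h$. Let $\mathcal O^{\mathfrak a}_\zeta$ be the block of the category $\mathcal O$ of $\mathfrak a$ (with respect to $\mathfrak a\cap\mathfrak h$ and $\mathfrak a\cap\mathfrak n_+$) whose simple modules are the simple highest weight $\mathfrak a$-modules with highest weights $x\cdot\zeta$, where $x$ runs through the Weyl group of $\mathfrak a$ (with the dot action for $\mathfrak a$). Let $\mathcal C$ be the full subcategory of $\mathcal O_\lambda$ of all modules whose composition factors all have the form $L(y)$ with $y\in W^Sw^B$. For an $\mathfrak a$-module $M$ put $\mathrm{Ind}(M)=U(\mathfrak g)\otimes_{U(\mathfrak p)}M$, where $\mathfrak p=\mathfrak a+\mathfrak h+\mathfrak n_+$ acts on $M$ by extending the action of $\mathfrak a$ so that $\mathfrak h^\perp$ acts via $\xi$ and $X_\alpha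 M=0$ for all positive roots $\alpha$ with $X_\alpha\notin\mathfrak a$. For a $\mathfrak g$-module $M$ let $\mathtt R^\nu(M)$ be the $\mathfrak a$-submodule $\bigoplus_{\mu\in\nu+\mathbb ZS}M_\mu$, where $M_\mu$ is the weight space of weight $\mu$. Proposition. $\mathrm{Ind}$ maps $\mathcal O^{\mathfrak a}_\zeta$ to $\mathcal C$, $\mathtt R^{\nu}$ maps $\mathcal C$ to $\mathcal O^{\mathfrak a}_\zeta$, and the two functors obtained in this way are mutually inverse equivalences of categories between $\mathcal O^{\mathfrak a}_\zeta$ and $\mathcal C$. -/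

import Mathlib

open CategoryTheory LieAlgebra LieAlgebra.IsKilling
open scoped TensorProduct

universe u

noncomputable section

namespace CategoryO

/-! ### Modules over a Lie algebra, weights, category `𝒪`

The definitions of this part are made for a complex Lie algebra `L` with a subalgebra `h` and a
subspace `n`; they are used both for a semisimple `g` with its Cartan subalgebra and its `n₊`, and
for a subalgebra `a` of `g` with `a ∩ h` and `a ∩ n₊`.  A module over `L` is a module over the
universal enveloping algebra `U L`. -/

section General

attribute [local instance] LieRing.ofAssociativeRing

/-- The universal enveloping algebra of a complex Lie algebra. -/
abbrev U (L : Type u) [LieRing L] [LieAlgebra ℂ L] : Type u := UniversalEnvelopingAlgebra ℂ L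

variable {L : Type u} [LieRing L] [LieAlgebra ℂ L]

/-- The canonical map of `L` to `U L`. -/
abbrev toU (x : L) : U L := UniversalEnvelopingAlgebra.ι ℂ x

theorem toU_lie (x y : L) : toU ⁅x, y⁆ = toU x * toU y - toU y * toU x := by
  rw [← LieRing.of_associative_ring_bracket]
  exact LieHom.map_lie (UniversalEnvelopingAlgebra.ι ℂ) x y

theorem toU_add (x y : L) : toU (x + y) = toU x + toU y :=
  map_add (UniversalEnvelopingAlgebra.ι ℂ) x y

theorem toU_smul (c : ℂ) (x : L) : toU (c • x) = c • toU x :=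
  map_smul (UniversalEnvelopingAlgebra.ι ℂ) c x

variable (h : LieSubalgebra ℂ L) (n : Submodule ℂ L)

/-- The weight space `M_μ = {m | x m = μ(x) m for all x ∈ h}`. -/
def weightSpace (μ : Module.Dual ℂ h) (M : Type u) [AddCommGroup M] [Module ℂ M] [Module (U L) M]
    [IsScalarTower ℂ (U L) M] : Submodule ℂ M where
  carrier := {m | ∀ x : h, toU (x : L) • m = μ x • m}
  add_mem' := fun {m m'} hm hm' x => by rw [smul_add, smul_add, hm x, hm' x]
  zero_mem' := fun x => by rw [smul_zero, smul_zero]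
  smul_mem' := fun c m hm x => by
    rw [smul_algebra_smul_comm, hm x, smul_comm]

/-- `M` belongs to category `𝒪` with respect to `h` and `n`: it is finitely generated, it is the
sum of its weight spaces, and every vector lies in a finite-dimensional subspace that is stable
under `n`. -/
def IsCategoryO (M : Type u) [AddCommGroup M] [Module ℂ M] [Module (U L) M]
    [IsScalarTower ℂ (U L) M] : Prop :=
  Module.Finite (U L) M ∧
  (⨆ μ : Module.Dual ℂ h, weightSpace h μ M) = ⊤ ∧
  ∀ m : M, ∃ F : Submodule ℂ M, FiniteDimensional ℂ F ∧ m ∈ F ∧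
    ∀ x ∈ n, ∀ v ∈ F, toU x • v ∈ F

/-- The left ideal of `U L` generated by `n` and by `x - μ(x)`, `x ∈ h`. -/
def vermaIdeal (μ : Module.Dual ℂ h) : Submodule (U L) (U L) :=
  Submodule.span (U L)
    ({y | ∃ x ∈ n, y = toU x} ∪ {y | ∃ x : h, y = toU (x : L) - algebraMap ℂ (U L) (μ x)})

/-- The Verma module with highest weight `μ`. -/
abbrev Verma (μ : Module.Dual ℂ h) : Type u := U L ⧸ vermaIdeal h n μ

/-- The simple module `L(μ)` with highest weight `μ`: the quotient of the Verma module by the sum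
of all its proper submodules. -/
abbrev SimpleHW (μ : Module.Dual ℂ h) : Type u :=
  Verma h n μ ⧸ sSup {N : Submodule (U L) (Verma h n μ) | N ≠ ⊤}

/-- Every composition factor of `M`, that is, every simple subquotient `N / K` with
`K ⊆ N ⊆ M`, is isomorphic to `L(μ)` for some `μ ∈ X`. -/
def CompositionFactorsIn (X : Set (Module.Dual ℂ h)) (M : Type u) [AddCommGroup M]
    [Module (U L) M] : Prop :=
  ∀ (N : Submodule (U L) M) (K : Submodule (U L) N), IsSimpleModule (U L) (N ⧸ K) →
    ∃ μ ∈ X, Nonempty ((N ⧸ K) ≃ₗ[U L] SimpleHW h n μ)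

/-- The full subcategory of `𝒪` of the modules with all composition factors among the `L(μ)`,
`μ ∈ X`. -/
def categoryOWithFactors (X : Set (Module.Dual ℂ h)) : ObjectProperty (ModuleCat.{u} (U L)) :=
  fun M =>
    letI : Module ℂ M := ModuleCat.moduleOfAlgebraModule M
    haveI : IsScalarTower ℂ (U L) M := ModuleCat.isScalarTower_of_algebra_moduleCat M
    IsCategoryO h n M ∧ CompositionFactorsIn h n X M

end General

/-! ### Semisimple Lie algebras

`g` is a semisimple complex Lie algebra with Cartan subalgebra `H`; the triangular decomposition is
given by a base `b` of the root system. -/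

section Semisimple

attribute [local instance] LieRing.ofAssociativeRing

variable {g : Type u} [LieRing g] [LieAlgebra ℂ g] [FiniteDimensional ℂ g] [IsKilling ℂ g]
  {H : LieSubalgebra ℂ g} [H.IsCartanSubalgebra]

/-- `n₊`, the sum of the positive root spaces. -/
def nPos (b : (rootSystem H).Base) : Submodule ℂ g :=
  ⨆ (α : H.root) (_ : b.IsPos α), (rootSpace H (α.1 : H → ℂ)).toSubmodule

open scoped Classical in
/-- Half of the sum of the positive roots. -/
def rho (b : (rootSystem H).Base) : Module.Dual ℂ H :=
  (1 / 2 : ℂ) • ∑ α : H.root with b.IsPos α, (rootSystem H).root α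

/-- The dot action `w · μ = w(μ + ρ) - ρ` of the Weyl group. -/
def dot (b : (rootSystem H).Base) (w : (rootSystem H).weylGroup) (μ : Module.Dual ℂ H) :
    Module.Dual ℂ H :=
  w • (μ + rho b) - rho b

/-- `μ(H_α) ∈ ℤ` for all roots `α`. -/
def IsIntegral (μ : Module.Dual ℂ H) : Prop :=
  ∀ α : H.root, ∃ k : ℤ, μ ((rootSystem H).coroot α) = k

/-- `μ` is dominant for the dot action: `(μ + ρ)(H_α)` is not a negative integer for any positive
root `α`. -/
def IsDominant (b : (rootSystem H).Base) (μ : Module.Dual ℂ H) : Prop :=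
  ∀ α : H.root, b.IsPos α → ∀ k : ℤ, (μ + rho b) ((rootSystem H).coroot α) = k → 0 ≤ k

/-- The stabilizer of `μ` for the dot action is trivial. -/
def IsRegular (b : (rootSystem H).Base) (μ : Module.Dual ℂ H) : Prop :=
  ∀ w : (rootSystem H).weylGroup, dot b w μ = μ → w = 1

/-- The subgroup `W^S` of the Weyl group generated by the reflections `s_α`, `α ∈ S`. -/
def parabolicSubgroup (S : Set H.root) : Subgroup (rootSystem H).weylGroup :=
  Subgroup.closure (RootPairing.weylGroup.ofIdx (rootSystem H) '' S)

/-- The length of `w`: the least number of simple reflections with product `w`. -/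
def length (b : (rootSystem H).Base) (w : (rootSystem H).weylGroup) : ℕ :=
  sInf {k | ∃ l : List H.root, (∀ α ∈ l, α ∈ b.support) ∧
    (l.map (RootPairing.weylGroup.ofIdx (rootSystem H))).prod = w ∧ l.length = k}

/-- `w` is the longest element of `W^S`. -/
def IsLongestElement (b : (rootSystem H).Base) (S : Set H.root)
    (w : (rootSystem H).weylGroup) : Prop :=
  w ∈ parabolicSubgroup S ∧ ∀ v ∈ parabolicSubgroup S, length b v ≤ length b w

/-- `𝒞`: the modules `M` of the block `𝒪_λ` (the modules in `𝒪` with all composition factors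
of the form `L(w · λ)`, `w ∈ W`) such that all composition factors of `M` are of the form
`L(y · λ)` with `y ∈ Y`. -/
def blockWithFactors (b : (rootSystem H).Base) (lam : Module.Dual ℂ H)
    (Y : Set (rootSystem H).weylGroup) : ObjectProperty (ModuleCat.{u} (U g)) :=
  fun M =>
    categoryOWithFactors H (nPos b) (Set.range fun w => dot b w lam) M ∧
    CompositionFactorsIn H (nPos b) ((fun y => dot b y lam) '' Y) M

/-! ### The subalgebra `a(S)` and its category `𝒪` -/

/-- The Lie subalgebra `a(S)` generated by the root vectors `X_α`, `X_{-α}`, `α ∈ S`. -/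
def levi (S : Set H.root) : LieSubalgebra ℂ g :=
  LieSubalgebra.lieSpan ℂ g
    {x | ∃ α ∈ S, x ∈ rootSpace H (α.1 : H → ℂ) ∨ x ∈ rootSpace H (-(α.1 : H → ℂ))}

/-- The root space of `α` is contained in `a(S)`. -/
def IsLeviRoot (S : Set H.root) (α : H.root) : Prop :=
  (rootSpace H (α.1 : H → ℂ)).toSubmodule ≤ (levi S).toSubmodule

/-- The intersection `a ∩ h`, as a subalgebra of `a`. -/
def leviCartan (S : Set H.root) : LieSubalgebra ℂ (levi S) := H.comap (levi S).incl

/-- The intersection `a ∩ n₊`, as a subspace of `a`. -/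
def leviNPos (b : (rootSystem H).Base) (S : Set H.root) : Submodule ℂ (levi S) :=
  (nPos b).comap (levi S).toSubmodule.subtype

/-- The restriction of a weight from `h` to `a ∩ h`. -/
def restrictWeight (S : Set H.root) : Module.Dual ℂ H →ₗ[ℂ] Module.Dual ℂ (leviCartan S) :=
  LinearMap.lcomp ℂ ℂ
    { toFun := fun x => (⟨((x : levi S) : g), x.2⟩ : H)
      map_add' := fun _ _ => rfl
      map_smul' := fun _ _ => rfl }

/-- The Weyl group of `a` acting on the dual of `a ∩ h`: the group generated by the reflections
`μ ↦ μ - μ(H_α) α` for the roots `α` of `a` (it is enough to take products, as a reflection is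
its own inverse). -/
def leviWeylGroup (S : Set H.root) : Submonoid (Module.End ℂ (Module.Dual ℂ (leviCartan S))) :=
  Submonoid.closure
    {r | ∃ (α : H.root) (t : leviCartan S), IsLeviRoot S α ∧
      ((t : levi S) : g) = ((rootSystem H).coroot α : g) ∧
      r = Module.preReflection (restrictWeight S ((rootSystem H).root α))
        (Module.Dual.eval ℂ (leviCartan S) t)}

open scoped Classical in
/-- Half of the sum of the positive roots of `a`. -/
def leviRho (b : (rootSystem H).Base) (S : Set H.root) : Module.Dual ℂ (leviCartan S) :=
  (1 / 2 : ℂ) • ∑ α : H.root with b.IsPos α ∧ IsLeviRoot S α,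
    restrictWeight S ((rootSystem H).root α)

/-- The block `𝒪^a_ζ` of the category `𝒪` for `a`, whose simple modules are the `L(x · ζ)` with
`x` in the Weyl group of `a`. -/
def leviBlock (b : (rootSystem H).Base) (S : Set H.root) (zeta : Module.Dual ℂ (leviCartan S)) :
    ObjectProperty (ModuleCat.{u} (U (levi S))) :=
  categoryOWithFactors (leviCartan S) (leviNPos b S)
    {μ | ∃ x ∈ leviWeylGroup S, μ = x (zeta + leviRho b S) - leviRho b S}

/-- The homomorphism `U(a) → U(g)` induced by the inclusion. -/
def leviToU (S : Set H.root) : U (levi S) →ₐ[ℂ] U g :=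
  UniversalEnvelopingAlgebra.lift ℂ ((UniversalEnvelopingAlgebra.ι ℂ).comp (levi S).incl)

/-! ### Truncation -/

/-- The subspace `⨁_{μ ∈ ν + ℤS} M_μ` of a `g`-module `M`. -/
def truncSubspace (S : Set H.root) (ν : Module.Dual ℂ H) (M : Type u) [AddCommGroup M]
    [Module ℂ M] [Module (U g) M] [IsScalarTower ℂ (U g) M] : Submodule ℂ M :=
  ⨆ (μ : Module.Dual ℂ H) (_ : μ - ν ∈ AddSubgroup.closure ((rootSystem H).root '' S)),
    weightSpace H μ M

/-- Root vectors shift weights. -/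
theorem rootVector_smul_mem_weightSpace {α : H → ℂ} {μ μ' : Module.Dual ℂ H}
    (hμ : ∀ t, μ' t = α t + μ t) {x : g} (hx : x ∈ rootSpace H α)
    {M : Type u} [AddCommGroup M] [Module ℂ M] [Module (U g) M] [IsScalarTower ℂ (U g) M]
    {m : M} (hm : m ∈ weightSpace H μ M) : toU x • m ∈ weightSpace H μ' M := by
  intro t
  have h1 : ⁅(t : g), x⁆ = α t • x := lie_eq_smul_of_mem_rootSpace hx t
  have h2 : toU (t : g) * toU x - toU x * toU (t : g) = α t • toU x := by
    rw [← toU_lie, h1, toU_smul]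
  have h4 : toU (t : g) * toU x = toU x * toU (t : g) + α t • toU x := by
    rw [← h2]; abel
  rw [← mul_smul, h4, add_smul, mul_smul, hm t, smul_assoc, hμ, add_smul, add_comm]
  congr 1
  exact smul_algebra_smul_comm _ _ _

/-- The elements of `U(g)` that preserve a given subspace of a module. -/
def stabilizingSubalgebra {M : Type u} [AddCommGroup M] [Module ℂ M] [Module (U g) M]
    [IsScalarTower ℂ (U g) M] (T : Submodule ℂ M) : Subalgebra ℂ (U g) where
  carrier := {y | ∀ m ∈ T, y • m ∈ T}
  mul_mem' := fun {y z} hy hz m hm => by rw [mul_smul]; exact hy _ (hz m hm)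
  add_mem' := fun {y z} hy hz m hm => by rw [add_smul]; exact T.add_mem (hy m hm) (hz m hm)
  algebraMap_mem' := fun c m hm => by rw [algebraMap_smul]; exact T.smul_mem c hm

/-- The subspace `⨁_{μ ∈ ν + ℤS} M_μ` is stable under `a(S)`. -/
theorem levi_smul_mem_truncSubspace (S : Set H.root) (ν : Module.Dual ℂ H)
    {M : Type u} [AddCommGroup M] [Module ℂ M] [Module (U g) M] [IsScalarTower ℂ (U g) M]
    {x : g} (hx : x ∈ levi S) : toU x ∈ stabilizingSubalgebra (truncSubspace S ν M) := by
  let K : LieSubalgebra ℂ g :=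
    { carrier := {x | toU x ∈ stabilizingSubalgebra (truncSubspace S ν M)}
      add_mem' := fun {x y} hx hy => by
        change toU (x + y) ∈ stabilizingSubalgebra (truncSubspace S ν M)
        rw [toU_add]
        exact add_mem hx hy
      zero_mem' := by
        change toU 0 ∈ stabilizingSubalgebra (truncSubspace S ν M)
        rw [← zero_smul ℂ (0 : g), toU_smul, zero_smul]
        exact zero_mem _
      smul_mem' := fun c x hx => by
        change toU (c • x) ∈ stabilizingSubalgebra (truncSubspace S ν M)
        rw [toU_smul]
        exact Subalgebra.smul_mem _ hx c
      lie_mem' := fun {x y} hx hy => by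
        change toU ⁅x, y⁆ ∈ stabilizingSubalgebra (truncSubspace S ν M)
        rw [toU_lie]
        exact sub_mem (mul_mem hx hy) (mul_mem hy hx) }
  suffices h : levi S ≤ K from h hx
  refine LieSubalgebra.lieSpan_le.mpr ?_
  have key : ∀ (α : H → ℂ) (α' : Module.Dual ℂ H), (∀ t, α' t = α t) →
      α' ∈ AddSubgroup.closure ((rootSystem H).root '' S) → ∀ x ∈ rootSpace H α, x ∈ K := by
    intro α α' hα hmem x hx m hm
    refine Submodule.iSup_induction _ (motive := fun m => toU x • m ∈ truncSubspace S ν M) hm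
      (fun μ m hm => ?_) (by rw [smul_zero]; exact zero_mem _)
      (fun m m' h h' => by rw [smul_add]; exact add_mem h h')
    by_cases hμ : μ - ν ∈ AddSubgroup.closure ((rootSystem H).root '' S)
    · rw [iSup_pos hμ] at hm
      have h1 : toU x • m ∈ weightSpace H (α' + μ) M :=
        rootVector_smul_mem_weightSpace (fun t => by rw [LinearMap.add_apply, hα]) hx hm
      refine Submodule.mem_iSup_of_mem (α' + μ) (Submodule.mem_iSup_of_mem ?_ h1)
      rw [add_sub_assoc]
      exact add_mem hmem hμ
    · rw [iSup_neg hμ, Submodule.mem_bot] at hm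
      rw [hm, smul_zero]
      exact zero_mem _
  rintro x ⟨α, hα, hx | hx⟩
  · exact key _ ((rootSystem H).root α) (fun t => rfl)
      (AddSubgroup.subset_closure ⟨α, hα, rfl⟩) x hx
  · exact key _ (-(rootSystem H).root α) (fun t => rfl)
      (neg_mem (AddSubgroup.subset_closure ⟨α, hα, rfl⟩)) x hx

theorem leviToU_smul_mem_truncSubspace (S : Set H.root) (ν : Module.Dual ℂ H)
    {M : Type u} [AddCommGroup M] [Module ℂ M] [Module (U g) M] [IsScalarTower ℂ (U g) M]
    (y : U (levi S)) {m : M} (hm : m ∈ truncSubspace S ν M) :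
    leviToU S y • m ∈ truncSubspace S ν M := by
  let A : Subalgebra ℂ (U g) := stabilizingSubalgebra (truncSubspace S ν M)
  let f : levi S →ₗ⁅ℂ⁆ A :=
    { toFun := fun x => ⟨toU (x : g), levi_smul_mem_truncSubspace (M := M) S ν x.2⟩
      map_add' := fun x y => Subtype.ext (toU_add (x : g) (y : g))
      map_smul' := fun c x => Subtype.ext (toU_smul c (x : g))
      map_lie' := fun {x y} => Subtype.ext (toU_lie (x : g) (y : g)) }
  have h : A.val.comp (UniversalEnvelopingAlgebra.lift ℂ f) = leviToU S := by
    apply UniversalEnvelopingAlgebra.hom_ext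
    ext x
    simp [leviToU, f, toU]
  rw [← h]
  exact (UniversalEnvelopingAlgebra.lift ℂ f y).2 m hm

open scoped ModuleCat in
/-- `R^ν M = ⨁_{μ ∈ ν + ℤS} M_μ`, as an `a`-submodule of `M`. -/
def truncSubmodule (S : Set H.root) (ν : Module.Dual ℂ H) (M : ModuleCat.{u} (U g)) :
    Submodule (U (levi S)) ((ModuleCat.restrictScalars (leviToU S).toRingHom).obj M) where
  carrier := (truncSubspace S ν M).carrier
  add_mem' := fun hm hm' => (truncSubspace S ν M).add_mem hm hm'
  zero_mem' := (truncSubspace S ν M).zero_mem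
  smul_mem' := fun y _ hm => leviToU_smul_mem_truncSubspace S ν (M := M) y hm

open scoped ModuleCat in
/-- A homomorphism maps `⨁_{μ ∈ ν + ℤS} M_μ` to `⨁_{μ ∈ ν + ℤS} N_μ`. -/
theorem map_mem_truncSubspace (S : Set H.root) (ν : Module.Dual ℂ H) {M N : ModuleCat.{u} (U g)}
    (f : M ⟶ N) {m : M} (hm : m ∈ truncSubspace S ν M) : f.hom m ∈ truncSubspace S ν N := by
  refine Submodule.iSup_induction _ (motive := fun m => f.hom m ∈ truncSubspace S ν N) hm
    (fun μ m hm => ?_) (by rw [map_zero]; exact zero_mem _)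
    (fun m m' h h' => by rw [map_add]; exact add_mem h h')
  by_cases hμ : μ - ν ∈ AddSubgroup.closure ((rootSystem H).root '' S)
  · rw [iSup_pos hμ] at hm
    refine Submodule.mem_iSup_of_mem μ (Submodule.mem_iSup_of_mem hμ fun t => ?_)
    rw [← map_smul, hm t]
    exact LinearMap.map_smul_of_tower f.hom (μ t) m
  · rw [iSup_neg hμ, Submodule.mem_bot] at hm
    rw [hm, map_zero]
    exact zero_mem _

/-- The functor `R^ν`, `M ↦ ⨁_{μ ∈ ν + ℤS} M_μ`, from `g`-modules to `a`-modules. -/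
def trunc (S : Set H.root) (ν : Module.Dual ℂ H) :
    ModuleCat.{u} (U g) ⥤ ModuleCat.{u} (U (levi S)) where
  obj M := ModuleCat.of (U (levi S)) (truncSubmodule S ν M)
  map {M N} f := ModuleCat.ofHom
    (((ModuleCat.restrictScalars (leviToU S).toRingHom).map f).hom.restrict
      (p := truncSubmodule S ν M) (q := truncSubmodule S ν N)
      fun m hm => map_mem_truncSubspace S ν f (m := m) hm)
  map_id _ := rfl
  map_comp _ _ := rfl

/-! ### Parabolic induction -/

/-- `h^⊥`, the orthogonal complement of `a ∩ h` in `h` with respect to the Killing form. -/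
def leviPerp (S : Set H.root) : Submodule ℂ H where
  carrier := {z | ∀ y : H, (y : g) ∈ levi S → killingForm ℂ g (y : g) (z : g) = 0}
  add_mem' := fun {x z} hx hz y hy => by
    rw [show ((x + z : H) : g) = (x : g) + (z : g) from rfl, map_add, hx y hy, hz y hy, add_zero]
  zero_mem' := fun y _ => map_zero _
  smul_mem' := fun c z hz y hy => by
    rw [show ((c • z : H) : g) = c • (z : g) from rfl, map_smul, hz y hy, smul_zero]

/-- The span of the `X_α` for the positive roots `α` with `X_α ∉ a`. -/
def leviNilradical (b : (rootSystem H).Base) (S : Set H.root) : Submodule ℂ g :=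
  ⨆ (α : H.root) (_ : b.IsPos α ∧ ¬ IsLeviRoot S α), (rootSpace H (α.1 : H → ℂ)).toSubmodule

/-- The relations that turn `U(g) ⊗_ℂ M` into `U(g) ⊗_{U(p)} M` for an `a`-module `M` and the
parabolic subalgebra `p = a + h + n₊`.  An element of `p` is a sum `y + z + x` with `y ∈ a`,
`z ∈ h^⊥` and `x` in the span of the `X_α`, `α > 0`, `X_α ∉ a`; it acts on `M` by
`(y + z + x) m = y m + ν(z) m`, that is, `h^⊥` acts by the restriction of `ν` to `h^⊥` and the
`X_α` as above act by zero. -/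
def inductionRelations (b : (rootSystem H).Base) (S : Set H.root) (ν : Module.Dual ℂ H)
    (M : Type u) [AddCommGroup M] [Module ℂ M] [Module (U (levi S)) M] :
    Submodule (U g) (U g ⊗[ℂ] M) :=
  Submodule.span (U g)
    {r | ∃ (y : levi S) (z : leviPerp S) (x : leviNilradical b S) (m : M),
      r = toU ((y : g) + ((z : H) : g) + (x : g)) ⊗ₜ[ℂ] m -
        (1 : U g) ⊗ₜ[ℂ] (toU y • m + ν (z : H) • m)}

open scoped ModuleCat in
theorem inductionRelations_le_comap (b : (rootSystem H).Base) (S : Set H.root)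
    (ν : Module.Dual ℂ H) {M N : ModuleCat.{u} (U (levi S))} (f : M ⟶ N) :
    inductionRelations b S ν M ≤ (inductionRelations b S ν N).comap
      (TensorProduct.AlgebraTensorModule.lTensor (U g) (U g) (f.hom.restrictScalars ℂ)) := by
  refine Submodule.span_le.mpr ?_
  rintro _ ⟨y, z, x, m, rfl⟩
  refine Submodule.subset_span ⟨y, z, x, f.hom m, ?_⟩
  have h1 : f.hom (toU y • m + ν (z : H) • m) = toU y • f.hom m + ν (z : H) • f.hom m := by
    rw [map_add, map_smul, LinearMap.map_smul_of_tower]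
  rw [← h1, map_sub]
  rfl

open scoped ModuleCat in
/-- The parabolic induction functor, `M ↦ U(g) ⊗_{U(p)} M`, where `p = a + h + n₊` acts on `M`
through `a`, through the restriction of `ν` to `h^⊥` and by zero, as in `inductionRelations`. -/
def parabolicInd (b : (rootSystem H).Base) (S : Set H.root) (ν : Module.Dual ℂ H) :
    ModuleCat.{u} (U (levi S)) ⥤ ModuleCat.{u} (U g) where
  obj M := ModuleCat.of (U g) ((U g ⊗[ℂ] M) ⧸ inductionRelations b S ν M)
  map f := ModuleCat.ofHom (Submodule.mapQ _ _
    (TensorProduct.AlgebraTensorModule.lTensor (U g) (U g) (f.hom.restrictScalars ℂ))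
    (inductionRelations_le_comap b S ν f))
  map_id _ := ModuleCat.hom_ext (Submodule.linearMap_qext _
    (TensorProduct.AlgebraTensorModule.ext fun _ _ => rfl))
  map_comp _ _ := ModuleCat.hom_ext (Submodule.linearMap_qext _
    (TensorProduct.AlgebraTensorModule.ext fun _ _ => rfl))

end Semisimple

end CategoryO

end

noncomputable section

namespace CategoryO

attribute [local instance] LieRing.ofAssociativeRing

/-! ### Generalities on modules over an enveloping algebra -/

section Generalities

variable {L : Type u} [LieRing L] [LieAlgebra ℂ L]
variable {M : Type u} [AddCommGroup M] [Module ℂ M] [Module (U L) M] [IsScalarTower ℂ (U L) M]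
variable {Q : Type u} [AddCommGroup Q] [Module ℂ Q] [Module (U L) Q] [IsScalarTower ℂ (U L) Q]

/-! Put `η = -w^B(λ + ρ)`. As `λ + ρ` is integral, dominant and regular and `w^B` turns positive
roots into negative ones, `η` takes positive integral values on all positive coroots
(`exists_pos_coroot'`). The highest weights allowed in `𝒞` are the weights `-(x η) - ρ` with `x ∈
W^S` (`blockWeights`). They all lie in `ν + ℤS`, and since `ρ` restricts to the half sum of the
positive roots of `a`, their restrictions to `a ∩ h` are exactly the highest weights of the block
for `a` (`restrictWeight_blockWeights`).

Both functors are studied through `p`-linear maps `f : M → V` of an `a`-module to a `g`-module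
(`IsParabolicMap`): the map `M → Ind M` and the inclusion of `R^ν(N)` in `N`. There is `z ∈ h^⊥` on
which the roots in `ℤS` vanish and the roots of the nilradical are positive integers
(`exists_grading`). The image of `f` has degree `ν(z)` and the opposite nilradical lowers degrees,
so for a submodule `M'` of `M` the part of degree `ν(z)` of `U(g) f(M')` is just `f(M')`
(`mem_of_degSpace`). Hence `M` is the truncation of `Ind M` as soon as `M → Ind M` is injective, and
this is the Poincaré–Birkhoff–Witt theorem in the form that `U(g)` retracts onto `U(p)` as a right
`U(p)`-module (`exists_right_retraction`).

The heart of the proof is that `Ind M` has no composition factors outside `𝒞`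
(`IsParabolicMap.mem_blockWeights`). Take a highest weight vector of weight `μ` in a subquotient. In
degree `ν(z)` it comes from `M`. In other degrees two Casimir elements are compared. The one of `g`
has on `Ind M` the only generalized eigenvalue `(η, η) - (ρ, ρ)`. The one of `a + h` is normalized
so that it acts on highest weight vectors by the same scalar `(μ + ρ, μ + ρ) - (ρ, ρ)`; its
generalized eigenvalues on the lower part have the form `(x η + γ, x η + γ) - (ρ, ρ)` with `x ∈ W^S`
and `γ` a nonempty sum of roots of the nilradical. As `x` permutes these roots, `(x η, γ) > 0`, so
`(x η + γ, x η + γ)` differs from `(η, η)` by the positive number `2 (x η, γ) + (γ, γ)`: a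
contradiction (`casimirScalar_ne`).

For `N` in `𝒞`, all highest weights have degree `ν(z)`, so the nilradical kills `R^ν(N)`; and
`R^ν(N)` generates `N`, because a nonzero quotient would have a highest weight vector coming from
the truncation. A nonzero kernel of `Ind R^ν(N) → N` would contain a highest weight vector in the
truncation, where the map is injective. -/

theorem adjoin_range_toU : Algebra.adjoin ℂ (Set.range (toU : L → U L)) = ⊤ := by
  let A : Subalgebra ℂ (U L) := Algebra.adjoin ℂ (Set.range (toU : L → U L))
  let f : L →ₗ⁅ℂ⁆ A :=
    { toFun := fun x => ⟨toU x, Algebra.subset_adjoin ⟨x, rfl⟩⟩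
      map_add' := fun x y => Subtype.ext (toU_add x y)
      map_smul' := fun c x => Subtype.ext (toU_smul c x)
      map_lie' := fun {x y} => Subtype.ext (toU_lie x y) }
  -- The lift into the subalgebra followed by the inclusion agrees with the identity on `L`, so it
  -- is the identity by the universal property.
  have h : A.val.comp (UniversalEnvelopingAlgebra.lift ℂ f) = AlgHom.id ℂ (U L) := by
    apply UniversalEnvelopingAlgebra.hom_ext
    ext x
    simp [f, toU]
  refine eq_top_iff.mpr fun y _ => ?_
  have h2 := congrArg (fun φ => φ y) h
  simp only [AlgHom.coe_comp, Function.comp_apply, AlgHom.coe_id, id] at h2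
  rw [← h2]
  exact (UniversalEnvelopingAlgebra.lift ℂ f y).2

@[elab_as_elim]
theorem U_induction {p : U L → Prop} (hι : ∀ x, p (toU x)) (hc : ∀ c : ℂ, p (algebraMap ℂ (U L) c))
    (hadd : ∀ y z, p y → p z → p (y + z)) (hmul : ∀ y z, p y → p z → p (y * z)) (y : U L) : p y := by
  have hy : y ∈ Algebra.adjoin ℂ (Set.range (toU : L → U L)) := by
    rw [adjoin_range_toU]; trivial
  induction hy using Algebra.adjoin_induction with
  | mem x hx => obtain ⟨x, rfl⟩ := hx; exact hι x
  | algebraMap r => exact hc r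
  | add x y _ _ hx hy => exact hadd _ _ hx hy
  | mul x y _ _ hx hy => exact hmul _ _ hx hy

theorem U_smul_mem (X : Submodule ℂ M) (hX : ∀ x : L, ∀ m ∈ X, toU x • m ∈ X) (y : U L) :
    ∀ m ∈ X, y • m ∈ X := by
  induction y using U_induction with
  | hι x => exact hX x
  | hc c => intro m hm; rw [algebraMap_smul]; exact X.smul_mem c hm
  | hadd y z hy hz => intro m hm; rw [add_smul]; exact X.add_mem (hy m hm) (hz m hm)
  | hmul y z hy hz => intro m hm; rw [mul_smul]; exact hy _ (hz m hm)

/-- A subspace that is stable under `L`, as a `U L`-submodule. -/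
def stableSubmodule (X : Submodule ℂ M) (hX : ∀ x : L, ∀ m ∈ X, toU x • m ∈ X) :
    Submodule (U L) M where
  carrier := X
  add_mem' := X.add_mem
  zero_mem' := X.zero_mem
  smul_mem' y m hm := U_smul_mem X hX y m hm

theorem toU_swap {M : Type u} [AddCommGroup M] [Module (U L) M] (x y : L) (m : M) :
    toU x • toU y • m = toU y • toU x • m + toU ⁅x, y⁆ • m := by
  rw [toU_lie, sub_smul, mul_smul, mul_smul]; abel

theorem toU_smul_smul (x : L) (c : ℂ) (m : M) : toU x • c • m = c • toU x • m :=
  smul_algebra_smul_comm _ _ _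

theorem toU_zero : toU (0 : L) = 0 := map_zero (UniversalEnvelopingAlgebra.ι ℂ)

theorem map_smul_complex (f : M →ₗ[U L] Q) (c : ℂ) (m : M) : f (c • m) = c • f m :=
  LinearMap.map_smul_of_tower f c m

/-- If `L = q + r`, then a `q`-stable subspace that contains an `r`-stable subspace `F` contains
the submodule generated by `F`. -/
theorem U_smul_mem_of_stable (q r : Submodule ℂ L) (hqr : q ⊔ r = ⊤) (F X : Submodule ℂ M)
    (hF : ∀ x ∈ r, ∀ m ∈ F, toU x • m ∈ F) (hFX : F ≤ X)
    (hX : ∀ x ∈ q, ∀ m ∈ X, toU x • m ∈ X) (y : U L) : ∀ m ∈ F, y • m ∈ X := by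
  -- `Y k` is spanned by the vectors obtained from `F` by applying at most `k` elements of `q`.
  let Y : ℕ → Submodule ℂ M := fun k => Nat.rec F
    (fun _ Y => Y ⊔ Submodule.span ℂ {w | ∃ x ∈ q, ∃ m ∈ Y, w = toU x • m}) k
  have hYs : ∀ k, Y (k + 1) = Y k ⊔ Submodule.span ℂ {w | ∃ x ∈ q, ∃ m ∈ Y k, w = toU x • m} :=
    fun k => rfl
  have hmono : ∀ k, Y k ≤ Y (k + 1) := fun k => by rw [hYs]; exact le_sup_left
  have hq : ∀ k, ∀ x ∈ q, ∀ m ∈ Y k, toU x • m ∈ Y (k + 1) := fun k x hx m hm => by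
    rw [hYs]; exact Submodule.mem_sup_right (Submodule.subset_span ⟨x, hx, m, hm, rfl⟩)
  have hr : ∀ k, ∀ x ∈ r, ∀ m ∈ Y k, toU x • m ∈ Y k := by
    intro k
    induction k with
    | zero => exact hF
    | succ k ih =>
      intro x hx m hm
      rw [hYs] at hm
      obtain ⟨m₁, hm₁, m₂, hm₂, rfl⟩ := Submodule.mem_sup.mp hm
      rw [smul_add]
      refine add_mem (hmono k (ih x hx _ hm₁)) ?_
      clear hm
      induction hm₂ using Submodule.span_induction with
      | zero => rw [smul_zero]; exact zero_mem _
      | add a b _ _ ha hb =>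
        rw [smul_add]
        exact add_mem ha hb
      | smul c a _ ha => rw [toU_smul_smul]; exact Submodule.smul_mem _ _ ha
      | mem w hw =>
        obtain ⟨z, hz, w, hw, rfl⟩ := hw
        -- In `x z w = z x w + [x, z] w` the commutator is split into its parts in `q` and `r`; both
        -- then stay in `Y (k + 1)`.
        rw [toU_swap]
        refine add_mem (hq k z hz _ (ih x hx _ hw)) ?_
        have : ⁅x, z⁆ ∈ q ⊔ r := by rw [hqr]; trivial
        obtain ⟨a, ha, b, hb, hab⟩ := Submodule.mem_sup.mp this
        rw [← hab, toU_add, add_smul]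
        exact add_mem (hq k a ha _ hw) (hmono k (ih b hb _ hw))
  have hYX : ∀ k, Y k ≤ X := by
    intro k
    induction k with
    | zero => exact hFX
    | succ k ih =>
      rw [hYs]
      refine sup_le ih (Submodule.span_le.mpr ?_)
      rintro _ ⟨x, hx, m, hm, rfl⟩
      exact hX x hx m (ih hm)
  have hdir : Monotone Y := monotone_nat_of_le_succ hmono
  have hstab : ∀ x : L, ∀ m ∈ ⨆ k, Y k, toU x • m ∈ ⨆ k, Y k := by
    intro x m hm
    rw [Submodule.mem_iSup_of_directed _ hdir.directed_le] at hm
    obtain ⟨k, hk⟩ := hm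
    have : x ∈ q ⊔ r := by rw [hqr]; trivial
    obtain ⟨a, ha, b, hb, rfl⟩ := Submodule.mem_sup.mp this
    rw [toU_add, add_smul]
    exact Submodule.mem_iSup_of_mem (k + 1) (add_mem (hq k a ha _ hk) (hmono k (hr k b hb _ hk)))
  intro m hm
  exact (iSup_le hYX) (U_smul_mem _ hstab y m (Submodule.mem_iSup_of_mem 0 hm))

end Generalities

/-! ### Weight spaces -/

section Weights

variable {L : Type u} [LieRing L] [LieAlgebra ℂ L] (h : LieSubalgebra ℂ L) (n : Submodule ℂ L)
variable {M : Type u} [AddCommGroup M] [Module ℂ M] [Module (U L) M] [IsScalarTower ℂ (U L) M]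
variable {Q : Type u} [AddCommGroup Q] [Module ℂ Q] [Module (U L) Q] [IsScalarTower ℂ (U L) Q]

variable {h} in
theorem map_mem_weightSpace (f : M →ₗ[U L] Q) {μ : Module.Dual ℂ h} {m : M}
    (hm : m ∈ weightSpace h μ M) : f m ∈ weightSpace h μ Q := fun x => by
  rw [← map_smul, hm x, map_smul_complex]

/-- Choose `x` with `μ x ≠ μ₀ x`. Applying `x - μ₀(x)` to the relation removes the term of `μ₀` and
multiplies that of `μ` by a nonzero scalar, so that the induction hypothesis applies. -/
theorem weightSpace_sum_eq_zero (s : Finset (Module.Dual ℂ h)) :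
    ∀ f : Module.Dual ℂ h → M, (∀ μ ∈ s, f μ ∈ weightSpace h μ M) → ∑ μ ∈ s, f μ = 0 →
      ∀ μ ∈ s, f μ = 0 := by
  classical
  induction s using Finset.induction_on with
  | empty => simp
  | insert μ₀ s hμ₀ ih =>
    intro f hf hsum
    rw [Finset.sum_insert hμ₀] at hsum
    have key : ∀ μ ∈ s, f μ = 0 := by
      intro μ hμ
      have hne : μ ≠ μ₀ := fun e => hμ₀ (e ▸ hμ)
      obtain ⟨x, hx⟩ : ∃ x, μ x ≠ μ₀ x := by
        by_contra! hc
        exact hne (LinearMap.ext hc)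
      have h1 : ∑ κ ∈ s, (κ x - μ₀ x) • f κ = 0 := by
        have h2 : toU (x : L) • (f μ₀ + ∑ κ ∈ s, f κ) - μ₀ x • (f μ₀ + ∑ κ ∈ s, f κ) = 0 := by
          rw [hsum, smul_zero, smul_zero, sub_zero]
        rw [smul_add, smul_add, hf μ₀ (Finset.mem_insert_self _ _) x, Finset.smul_sum,
          Finset.smul_sum, add_sub_add_left_eq_sub, ← Finset.sum_sub_distrib] at h2
        rw [← h2]
        refine Finset.sum_congr rfl fun κ hκ => ?_
        rw [hf κ (Finset.mem_insert_of_mem hκ) x, sub_smul]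
      have h3 := ih (fun κ => (κ x - μ₀ x) • f κ)
        (fun κ hκ => Submodule.smul_mem _ _ (hf κ (Finset.mem_insert_of_mem hκ))) h1 μ hμ
      exact (smul_eq_zero.mp h3).resolve_left (sub_ne_zero.mpr hx)
    intro μ hμ
    rcases Finset.mem_insert.mp hμ with rfl | hμ
    · rwa [Finset.sum_eq_zero key, add_zero] at hsum
    · exact key μ hμ

theorem iSupIndep_weightSpace : iSupIndep fun μ : Module.Dual ℂ h => weightSpace h μ M := by
  classical
  refine iSupIndep_of_dfinsupp_lsum_injective _ ?_
  rw [← LinearMap.ker_eq_bot, LinearMap.ker_eq_bot']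
  intro v hv
  rw [DFinsupp.lsum_apply_apply, DFinsupp.sumAddHom_apply, DFinsupp.sum] at hv
  ext μ
  by_cases hμ : μ ∈ v.support
  · have := weightSpace_sum_eq_zero h v.support (fun μ => ((v μ : weightSpace h μ M) : M))
      (fun μ _ => (v μ).2) hv μ hμ
    simpa using this
  · simp [DFinsupp.notMem_support_iff.mp hμ]

variable {h} in
theorem exists_weight_sum (hM : (⨆ μ : Module.Dual ℂ h, weightSpace h μ M) = ⊤) (m : M) :
    ∃ (s : Finset (Module.Dual ℂ h)) (f : Module.Dual ℂ h → M),
      (∀ μ, f μ ∈ weightSpace h μ M) ∧ (∀ μ ∉ s, f μ = 0) ∧ ∑ μ ∈ s, f μ = m := by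
  have hm : m ∈ ⨆ μ : Module.Dual ℂ h, weightSpace h μ M := by rw [hM]; trivial
  obtain ⟨f, hf, hs⟩ := (Submodule.mem_iSup_iff_exists_finsupp _ _).mp hm
  exact ⟨f.support, f, hf, fun μ hμ => Finsupp.notMem_support_iff.mp hμ, hs⟩

variable {h} in
/-- Weight vectors lift along surjections. -/
theorem exists_weight_lift (hM : (⨆ μ : Module.Dual ℂ h, weightSpace h μ M) = ⊤)
    (f : M →ₗ[U L] Q) (hf : Function.Surjective f) {μ : Module.Dual ℂ h} {q : Q}
    (hq : q ∈ weightSpace h μ Q) : ∃ m ∈ weightSpace h μ M, f m = q := by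
  classical
  obtain ⟨m, rfl⟩ := hf q
  obtain ⟨s, w, hw, hs, rfl⟩ := exists_weight_sum hM m
  refine ⟨w μ, hw μ, ?_⟩
  -- `μ` need not belong to `s`; then `w μ = 0`. The sum compares the weight components of the image
  -- with the image itself, placed in weight `μ`.
  have hsum : ∑ κ ∈ insert μ s, ((f (w κ)) - if κ = μ then f (∑ κ ∈ s, w κ) else 0) = 0 := by
    rw [Finset.sum_sub_distrib, Finset.sum_ite_eq' (insert μ s) μ,
      if_pos (Finset.mem_insert_self _ _), ← map_sum, sub_eq_zero]
    congr 1
    refine (Finset.sum_subset (Finset.subset_insert _ _) fun κ _ hκ => hs κ hκ).symm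
  have := weightSpace_sum_eq_zero h (insert μ s) _ (fun κ _ => ?_) hsum μ
    (Finset.mem_insert_self _ _)
  · simpa [sub_eq_zero] using this
  · split_ifs with e
    · subst e; exact sub_mem (map_mem_weightSpace f (hw _)) hq
    · rw [sub_zero]; exact map_mem_weightSpace f (hw κ)

variable {h} in
/-- The weight components of an element of a submodule lie in the submodule. -/
theorem weight_component_mem (N : Submodule (U L) M) (s : Finset (Module.Dual ℂ h))
    (w : Module.Dual ℂ h → M) (hw : ∀ μ ∈ s, w μ ∈ weightSpace h μ M) (hN : ∑ μ ∈ s, w μ ∈ N) :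
    ∀ μ ∈ s, w μ ∈ N := by
  intro μ hμ
  rw [← Submodule.Quotient.mk_eq_zero]
  refine weightSpace_sum_eq_zero h s (fun μ => N.mkQ (w μ))
    (fun μ hμ => map_mem_weightSpace N.mkQ (hw μ hμ)) ?_ μ hμ
  rw [← map_sum]
  exact (Submodule.Quotient.mk_eq_zero N).mpr hN

/-- `M` is the sum of its weight spaces and locally finite over `n`. -/
structure WeightLF (M : Type u) [AddCommGroup M] [Module ℂ M] [Module (U L) M]
    [IsScalarTower ℂ (U L) M] : Prop where
  iSup_eq_top : (⨆ μ : Module.Dual ℂ h, weightSpace h μ M) = ⊤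
  locallyFinite : ∀ m : M, ∃ F : Submodule ℂ M, FiniteDimensional ℂ F ∧ m ∈ F ∧
    ∀ x ∈ n, ∀ v ∈ F, toU x • v ∈ F

variable {h n}

theorem WeightLF.of_surjective (hM : WeightLF h n M) (f : M →ₗ[U L] Q)
    (hf : Function.Surjective f) : WeightLF h n Q where
  iSup_eq_top := by
    refine eq_top_iff.mpr fun q _ => ?_
    obtain ⟨m, rfl⟩ := hf q
    obtain ⟨s, w, hw, -, rfl⟩ := exists_weight_sum hM.iSup_eq_top m
    rw [map_sum]
    exact sum_mem fun μ _ => Submodule.mem_iSup_of_mem μ (map_mem_weightSpace f (hw μ))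
  locallyFinite q := by
    obtain ⟨m, rfl⟩ := hf q
    obtain ⟨F, hF, hm, hn⟩ := hM.locallyFinite m
    refine ⟨F.map (f.restrictScalars ℂ), inferInstance, ⟨m, hm, rfl⟩, ?_⟩
    rintro x hx _ ⟨v, hv, rfl⟩
    exact ⟨toU x • v, hn x hx v hv, by simp⟩

theorem WeightLF.of_injective (hM : WeightLF h n M) (f : Q →ₗ[U L] M)
    (hf : Function.Injective f) : WeightLF h n Q where
  iSup_eq_top := by
    refine eq_top_iff.mpr fun q _ => ?_
    obtain ⟨s, w, hw, -, hs⟩ := exists_weight_sum hM.iSup_eq_top (f q)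
    have hmem := weight_component_mem (LinearMap.range f) s w (fun μ _ => hw μ)
      (hs ▸ LinearMap.mem_range_self f q)
    choose! v hv using hmem
    have : q = ∑ μ ∈ s, v μ := hf (by
      rw [map_sum, ← hs]; exact Finset.sum_congr rfl fun μ hμ => (hv μ hμ).symm)
    rw [this]
    refine sum_mem fun μ hμ => Submodule.mem_iSup_of_mem μ fun x => hf ?_
    rw [map_smul, map_smul_complex, hv μ hμ]
    exact hw μ x
  locallyFinite q := by
    obtain ⟨F, hF, hm, hn⟩ := hM.locallyFinite (f q)
    refine ⟨F.comap (f.restrictScalars ℂ), ?_, hm, fun x hx v hv => ?_⟩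
    · let g : F.comap (f.restrictScalars ℂ) →ₗ[ℂ] F :=
        (f.restrictScalars ℂ).restrict fun _ hx => hx
      exact FiniteDimensional.of_injective g fun a b hab =>
        Subtype.ext (hf (congrArg Subtype.val hab))
    · change f (toU x • v) ∈ F
      rw [map_smul]
      exact hn x hx _ hv

variable (n) in
/-- `v` is a vector of weight `μ` that is killed by `n`. -/
def IsHW (μ : Module.Dual ℂ h) (v : M) : Prop :=
  v ∈ weightSpace h μ M ∧ ∀ x ∈ n, toU x • v = 0

theorem IsHW.map {μ : Module.Dual ℂ h} {v : M} (hv : IsHW n μ v) (f : M →ₗ[U L] Q) :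
    IsHW n μ (f v) :=
  ⟨map_mem_weightSpace f hv.1, fun x hx => by rw [← map_smul, hv.2 x hx, map_zero]⟩

theorem IsHW.of_injective {μ : Module.Dual ℂ h} {v : M} (f : M →ₗ[U L] Q)
    (hf : Function.Injective f) (hv : IsHW n μ (f v)) : IsHW n μ v :=
  ⟨fun x => hf (by rw [map_smul, hv.1 x, map_smul_complex]),
    fun x hx => hf (by rw [map_smul, hv.2 x hx, map_zero])⟩

/-- `L = nm + h + n`, where `n` and `nm` are spanned by weight vectors of positive and of negative
degree, for the grading given by `δ`. -/
structure IsTriangular (h : LieSubalgebra ℂ L) (n nm : Submodule ℂ L) (δ : h) : Prop where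
  sup_eq_top : nm ⊔ (h.toSubmodule ⊔ n) = ⊤
  pos : n ≤ Submodule.span ℂ {x | x ∈ n ∧ ∃ (α : Module.Dual ℂ h) (k : ℕ), 0 < k ∧ α δ = k ∧
    ∀ t : h, ⁅(t : L), x⁆ = α t • x}
  neg : nm ≤ Submodule.span ℂ {x | ∃ (α : Module.Dual ℂ h) (k : ℕ), 0 < k ∧ α δ = -k ∧
    ∀ t : h, ⁅(t : L), x⁆ = α t • x}

theorem weight_shift {α μ : Module.Dual ℂ h} {x : L} (hx : ∀ t : h, ⁅(t : L), x⁆ = α t • x) {m : M}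
    (hm : m ∈ weightSpace h μ M) : toU x • m ∈ weightSpace h (α + μ) M := by
  intro t
  rw [toU_swap, hm t, hx t, toU_smul, toU_smul_smul, smul_assoc, LinearMap.add_apply, add_smul,
    add_comm]

/-- The elements of `L` that map a vector into a given subspace. -/
def transporter (v : M) (X : Submodule ℂ M) : Submodule ℂ L where
  carrier := {x | toU x • v ∈ X}
  add_mem' {x y} hx hy := by
    change toU (x + y) • v ∈ X
    rw [toU_add, add_smul]; exact add_mem hx hy
  zero_mem' := by
    change toU (0 : L) • v ∈ X
    rw [toU_zero, zero_smul]; exact zero_mem _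
  smul_mem' c x hx := by
    change toU (c • x) • v ∈ X
    rw [toU_smul, smul_assoc]; exact X.smul_mem c hx

/-- If `R` is a condition on weights that is inherited by the weights reached by applying `n`, then
a weight vector of a weight with `R` gives a highest weight vector of a weight with `R`. -/
theorem WeightLF.exists_isHW_of_mem (hM : WeightLF h n M) (δ : h)
    (R : Module.Dual ℂ h → Prop) (hpos : n ≤ Submodule.span ℂ {x | x ∈ n ∧
      ∃ (α : Module.Dual ℂ h) (k : ℕ), 0 < k ∧ α δ = k ∧ (∀ κ, R κ → R (α + κ)) ∧
        ∀ t : h, ⁅(t : L), x⁆ = α t • x})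
    {μ : Module.Dual ℂ h} {m : M} (hm : m ∈ weightSpace h μ M) (hm0 : m ≠ 0) (hμ : R μ) :
    ∃ (κ : Module.Dual ℂ h) (v : M), R κ ∧ v ≠ 0 ∧ IsHW n κ v := by
  obtain ⟨F, hF, hmF, hn⟩ := hM.locallyFinite m
  -- `P j` says that `F` contains a nonzero vector of a weight with `R` whose eigenvalue under `δ`
  -- is `j` above that of `μ`.
  let P : ℕ → Prop := fun j => ∃ (κ : Module.Dual ℂ h) (w : M), w ∈ F ∧ w ≠ 0 ∧
    w ∈ weightSpace h κ M ∧ κ δ = μ δ + j ∧ R κ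
  have hJ : Finite {j // P j} := by
    have hch : ∀ j : {j // P j},
        ∃ w : M, w ∈ F ∧ w ≠ 0 ∧ toU (δ : L) • w = (μ δ + (j : ℕ)) • w := by
      rintro ⟨j, κ, w, h1, h2, h3, h4, -⟩
      exact ⟨w, h1, h2, (h3 δ).trans (congrArg (· • w) h4)⟩
    choose w hw1 hw2 hw3 using hch
    -- Eigenvectors of `δ` for distinct eigenvalues are independent, and `F` is finite-dimensional;
    -- so only finitely many `j` occur and there is a largest one.
    have hli : LinearIndependent ℂ w := by
      refine Module.End.eigenvectors_linearIndependent' (Algebra.lsmul ℂ ℂ M (toU (δ : L)))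
        (fun j : {j // P j} => μ δ + (j : ℕ)) (fun i j hij => Subtype.ext ?_) w fun j => ⟨?_, hw2 j⟩
      · exact_mod_cast add_left_cancel hij
      · exact Module.End.mem_eigenspace_iff.mpr (hw3 j)
    have hli' : LinearIndependent ℂ (fun j : {j // P j} => (⟨w j, hw1 j⟩ : F)) :=
      LinearIndependent.of_comp F.subtype hli
    exact hli'.finite
  have hP0 : P 0 := ⟨μ, m, hmF, hm0, hm, by simp, hμ⟩
  obtain ⟨⟨j, κ, w, hwF, hw0, hw, hκ, hRκ⟩, hmax⟩ :=
    @Finite.exists_max {j // P j} ℕ _ ⟨⟨0, hP0⟩⟩ _ (fun j => (j : ℕ))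
  refine ⟨κ, w, hRκ, hw0, hw, ?_⟩
  -- A weight vector of `n` raises the eigenvalue of `δ`, so it kills `w` by maximality.
  have hle : n ≤ transporter w (⊥ : Submodule ℂ M) := by
    refine hpos.trans (Submodule.span_le.mpr ?_)
    rintro x ⟨hxn, α, k, hk, hα, hRα, hx⟩
    by_contra hne
    have hne' : toU x • w ≠ 0 := fun e => hne ((Submodule.mem_bot ℂ).mpr e)
    have := hmax ⟨j + k, α + κ, toU x • w, hn x hxn w hwF, hne', weight_shift hx hw, by
      rw [LinearMap.add_apply, hα, hκ]; push_cast; ring, hRα κ hRκ⟩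
    simp only at this
    omega
  exact fun x hx => (Submodule.mem_bot ℂ).mp (hle hx)

theorem IsTriangular.exists_isHW {nm : Submodule ℂ L} {δ : h} (ht : IsTriangular h n nm δ)
    (hM : WeightLF h n M) [Nontrivial M] :
    ∃ (μ : Module.Dual ℂ h) (v : M), v ≠ 0 ∧ IsHW n μ v := by
  obtain ⟨μ, hμ⟩ : ∃ μ : Module.Dual ℂ h, weightSpace h μ M ≠ ⊥ := by
    by_contra! hc
    have := hM.iSup_eq_top
    simp only [hc, iSup_bot] at this
    exact bot_ne_top this
  obtain ⟨m, hm, hm0⟩ := Submodule.exists_mem_ne_zero_of_ne_bot hμ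
  obtain ⟨κ, v, -, hv⟩ := hM.exists_isHW_of_mem δ (fun _ => True) (ht.pos.trans
    (Submodule.span_mono fun x ⟨hx, α, k, hk, hα, h⟩ =>
      ⟨hx, α, k, hk, hα, fun _ _ => trivial, h⟩)) hm hm0 trivial
  exact ⟨κ, v, hv⟩

/-- The sum of the weight spaces of a module in degree lower than that of `μ`. -/
def lowerPart (δ : h) (μ : Module.Dual ℂ h) (M : Type u) [AddCommGroup M] [Module ℂ M]
    [Module (U L) M] [IsScalarTower ℂ (U L) M] : Submodule ℂ M :=
  ⨆ κ ∈ {κ : Module.Dual ℂ h | ∃ k : ℕ, 0 < k ∧ κ δ = μ δ - k}, weightSpace h κ M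

theorem ne_of_lower {δ : h} {μ κ : Module.Dual ℂ h} (hk : ∃ k : ℕ, 0 < k ∧ κ δ = μ δ - k) :
    μ ≠ κ := by
  rintro rfl
  obtain ⟨k, hk, h1⟩ := hk
  have : (k : ℂ) = 0 := by linear_combination h1
  exact hk.ne' (by exact_mod_cast this)

theorem disjoint_lowerPart (δ : h) (μ : Module.Dual ℂ h) :
    Disjoint (weightSpace h μ M) (lowerPart δ μ M) :=
  (iSupIndep_weightSpace h).disjoint_biSup fun hk => ne_of_lower hk rfl

theorem map_mem_lowerPart (f : M →ₗ[U L] Q) {δ : h} {μ : Module.Dual ℂ h} {m : M}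
    (hm : m ∈ lowerPart δ μ M) : f m ∈ lowerPart δ μ Q := by
  have : lowerPart δ μ M ≤ (lowerPart δ μ Q).comap (f.restrictScalars ℂ) := by
    refine iSup₂_le fun κ hκ m hm => ?_
    exact (le_biSup (fun κ => weightSpace h κ Q) hκ) (map_mem_weightSpace f hm)
  exact this hm

/-- The line through `v` is stable under `h + n`, while `nm` maps it, and the lower part, into lower
degrees. `U_smul_mem_of_stable` then replaces the ordering of monomials. -/
theorem IsTriangular.mem_sup_lowerPart {nm : Submodule ℂ L} {δ : h} (ht : IsTriangular h n nm δ)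
    {μ : Module.Dual ℂ h} {v : M} (hv : IsHW n μ v) (y : U L) :
    y • v ∈ (ℂ ∙ v) ⊔ lowerPart δ μ M := by
  refine U_smul_mem_of_stable nm (h.toSubmodule ⊔ n) ht.sup_eq_top (ℂ ∙ v) _ ?_ le_sup_left ?_ y v
    (Submodule.mem_span_singleton_self v)
  · intro x hx m hm
    obtain ⟨c, rfl⟩ := Submodule.mem_span_singleton.mp hm
    rw [toU_smul_smul]
    refine Submodule.smul_mem _ _ ?_
    obtain ⟨a, ha, b, hb, rfl⟩ := Submodule.mem_sup.mp hx
    rw [toU_add, add_smul, hv.2 b hb, add_zero, hv.1 ⟨a, ha⟩]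
    exact Submodule.smul_mem _ _ (Submodule.mem_span_singleton_self v)
  · have hlow : ∀ κ : Module.Dual ℂ h, (∃ k : ℕ, κ δ = μ δ - k) → ∀ m ∈ weightSpace h κ M,
        ∀ x ∈ nm, toU x • m ∈ lowerPart δ μ M := by
      rintro κ ⟨k, hk⟩ m hm x hx
      have : nm ≤ transporter m (lowerPart δ μ M) := by
        refine ht.neg.trans (Submodule.span_le.mpr ?_)
        rintro x ⟨α, j, hj, hα, hx⟩
        refine (le_biSup (fun κ => weightSpace h κ M) ?_) (weight_shift hx hm)
        exact ⟨j + k, by omega, by rw [LinearMap.add_apply, hα, hk]; push_cast; ring⟩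
      exact this hx
    intro x hx m hm
    refine Submodule.mem_sup_right ?_
    have : (ℂ ∙ v) ⊔ lowerPart δ μ M ≤
        (lowerPart δ μ M).comap (Algebra.lsmul ℂ ℂ M (toU x)) := by
      refine sup_le ?_ (iSup₂_le ?_)
      · rw [Submodule.span_singleton_le_iff_mem]
        exact hlow μ ⟨0, by simp⟩ v hv.1 x hx
      · rintro κ ⟨k, -, hk⟩ m hm
        exact hlow κ ⟨k, hk⟩ m hm x hx
    exact this hm

/-- `w` lies in the sum of the weight spaces for `μ` and the lower weights, which is independent of
the weight space of any other weight. -/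
theorem IsTriangular.eq_or_lower {nm : Submodule ℂ L} {δ : h} (ht : IsTriangular h n nm δ)
    {μ κ : Module.Dual ℂ h} {v w : M} (hv : IsHW n μ v) (hw0 : w ≠ 0)
    (hw : w ∈ weightSpace h κ M) (y : U L) (hy : y • v = w) :
    κ = μ ∨ ∃ k : ℕ, 0 < k ∧ κ δ = μ δ - k := by
  by_contra! hc
  have h1 : w ∈ ⨆ κ' ∈ {κ' : Module.Dual ℂ h | κ' = μ ∨ ∃ k : ℕ, 0 < k ∧ κ' δ = μ δ - k},
      weightSpace h κ' M := by
    have h2 := ht.mem_sup_lowerPart hv y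
    rw [hy] at h2
    refine (sup_le ?_ (iSup₂_le fun κ' hκ' => ?_) : (ℂ ∙ v) ⊔ lowerPart δ μ M ≤ _) h2
    · rw [Submodule.span_singleton_le_iff_mem]
      exact (le_biSup (fun κ => weightSpace h κ M) (Or.inl rfl)) hv.1
    · exact le_biSup (fun κ => weightSpace h κ M) (Or.inr hκ')
  have h3 : Disjoint (weightSpace h κ M) _ := (iSupIndep_weightSpace h).disjoint_biSup
    (x := κ) (y := {κ' : Module.Dual ℂ h | κ' = μ ∨ ∃ k : ℕ, 0 < k ∧ κ' δ = μ δ - k})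
    (fun hk => by
      rcases hk with hk | ⟨k, hk, hk'⟩
      · exact hc.1 hk
      · exact hc.2 k hk hk')
  exact hw0 (Submodule.disjoint_def.mp h3 w hw h1)

/-- Two highest weight vectors that generate each other have the same weight. -/
theorem IsTriangular.weight_unique {nm : Submodule ℂ L} {δ : h} (ht : IsTriangular h n nm δ)
    [IsSimpleModule (U L) M] {μ κ : Module.Dual ℂ h} {v w : M} (hv : IsHW n μ v) (hv0 : v ≠ 0)
    (hw : IsHW n κ w) (hw0 : w ≠ 0) : μ = κ := by
  obtain ⟨y, hy⟩ := IsSimpleModule.toSpanSingleton_surjective (U L) hv0 w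
  obtain ⟨z, hz⟩ := IsSimpleModule.toSpanSingleton_surjective (U L) hw0 v
  rcases ht.eq_or_lower hv hw0 hw.1 y hy with e | ⟨k, hk, h1⟩
  · exact e.symm
  rcases ht.eq_or_lower hw hv0 hv.1 z hz with e | ⟨j, hj, h2⟩
  · exact e
  have : ((k + j : ℕ) : ℂ) = 0 := by push_cast; linear_combination h1 + h2
  have : k + j = 0 := by exact_mod_cast this
  omega

theorem isHW_verma (μ : Module.Dual ℂ h) :
    IsHW n μ (Submodule.Quotient.mk 1 : Verma h n μ) := by
  constructor
  · intro x
    rw [← Submodule.Quotient.mk_smul, ← Submodule.Quotient.mk_smul, Submodule.Quotient.eq,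
      smul_eq_mul, mul_one, ← Algebra.algebraMap_eq_smul_one]
    exact Submodule.subset_span (Or.inr ⟨x, rfl⟩)
  · intro x hx
    rw [← Submodule.Quotient.mk_smul, Submodule.Quotient.mk_eq_zero, smul_eq_mul, mul_one]
    exact Submodule.subset_span (Or.inl ⟨x, hx, rfl⟩)

/-- The generator of `L(μ)`. -/
def simpleGen (h : LieSubalgebra ℂ L) (n : Submodule ℂ L) (μ : Module.Dual ℂ h) :
    SimpleHW h n μ := Submodule.mkQ _ (Submodule.Quotient.mk 1 : Verma h n μ)

theorem isHW_simpleGen (μ : Module.Dual ℂ h) : IsHW n μ (simpleGen h n μ) :=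
  (isHW_verma μ).map _

theorem exists_smul_simpleGen (μ : Module.Dual ℂ h) (q : SimpleHW h n μ) :
    ∃ y : U L, y • simpleGen h n μ = q := by
  obtain ⟨q, rfl⟩ := Submodule.mkQ_surjective _ q
  obtain ⟨y, rfl⟩ := Submodule.mkQ_surjective _ q
  exact ⟨y, by simp [simpleGen, ← Submodule.Quotient.mk_smul]⟩

theorem simpleGen_ne_zero (μ : Module.Dual ℂ h) [Nontrivial (SimpleHW h n μ)] :
    simpleGen h n μ ≠ 0 := by
  intro h0
  obtain ⟨q, hq⟩ := exists_ne (0 : SimpleHW h n μ)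
  obtain ⟨y, rfl⟩ := exists_smul_simpleGen μ q
  exact hq (by rw [h0, smul_zero])

/-- A simple module with a highest weight vector of weight `μ` is isomorphic to `L(μ)`. -/
theorem IsTriangular.nonempty_equiv_simpleHW {nm : Submodule ℂ L} {δ : h}
    (ht : IsTriangular h n nm δ) [IsSimpleModule (U L) Q] {μ : Module.Dual ℂ h} {v : Q}
    (hv : IsHW n μ v) (hv0 : v ≠ 0) : Nonempty (Q ≃ₗ[U L] SimpleHW h n μ) := by
  have hker : vermaIdeal h n μ ≤ LinearMap.ker (LinearMap.toSpanSingleton (U L) Q v) := by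
    refine Submodule.span_le.mpr ?_
    rintro _ (⟨x, hx, rfl⟩ | ⟨x, rfl⟩)
    · exact hv.2 x hx
    · change (toU (x : L) - algebraMap ℂ (U L) (μ x)) • v = 0
      rw [sub_smul, hv.1 x, algebraMap_smul, sub_self]
  let f : Verma h n μ →ₗ[U L] Q := Submodule.liftQ _ _ hker
  have hf1 : f (Submodule.Quotient.mk 1) = v := by
    change (1 : U L) • v = v
    rw [one_smul]
  have hf : Function.Surjective f := by
    intro q
    obtain ⟨y, hy⟩ := IsSimpleModule.toSpanSingleton_surjective (U L) hv0 q
    exact ⟨Submodule.Quotient.mk y, hy⟩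
  -- The kernel is proper because `v ≠ 0`. Conversely, a proper submodule has no component along the
  -- generator, so it lies in lower degrees and its image misses `v`; as `Q` is simple, the image is
  -- zero.
  have hK : LinearMap.ker f = sSup {N : Submodule (U L) (Verma h n μ) | N ≠ ⊤} := by
    apply le_antisymm
    · refine le_sSup fun htop => hv0 ?_
      rw [← hf1, ← LinearMap.mem_ker, htop]
      trivial
    · refine sSup_le fun N hN => ?_
      by_contra hNK
      have hlow : ∀ m ∈ N, m ∈ lowerPart δ μ (Verma h n μ) := by
        intro m hm
        obtain ⟨y, rfl⟩ := Submodule.mkQ_surjective _ m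
        have h1 := ht.mem_sup_lowerPart (isHW_verma (n := n) μ) y
        rw [← Submodule.Quotient.mk_smul, smul_eq_mul, mul_one] at h1
        obtain ⟨a, ha, b, hb, hab⟩ := Submodule.mem_sup.mp h1
        obtain ⟨c, rfl⟩ := Submodule.mem_span_singleton.mp ha
        -- Modulo `N` the component `c • 1` of weight `μ` equals `-b`, a sum of vectors of lower
        -- weights, so it vanishes there.
        have hcN : (c • (Submodule.Quotient.mk 1 : Verma h n μ)) ∈ N := by
          rw [← Submodule.Quotient.mk_eq_zero]
          refine Submodule.disjoint_def.mp (disjoint_lowerPart (M := Verma h n μ ⧸ N) δ μ) _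
            (map_mem_weightSpace N.mkQ (Submodule.smul_mem _ c (isHW_verma μ).1)) ?_
          have h2 : N.mkQ (c • (Submodule.Quotient.mk 1 : Verma h n μ)) = - N.mkQ b := by
            rw [eq_neg_iff_add_eq_zero, ← map_add, hab]
            exact (Submodule.Quotient.mk_eq_zero N).mpr hm
          change N.mkQ _ ∈ _
          rw [h2]
          exact neg_mem (map_mem_lowerPart N.mkQ hb)
        by_cases hc : c = 0
        · rw [hc, zero_smul, zero_add] at hab
          rw [hab] at hb
          exact hb
        · refine absurd (eq_top_iff.mpr fun q _ => ?_) hN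
          obtain ⟨z, rfl⟩ := Submodule.mkQ_surjective _ q
          have h3 := N.smul_mem (z * algebraMap ℂ (U L) c⁻¹) hcN
          rwa [mul_smul, algebraMap_smul, smul_smul, inv_mul_cancel₀ hc, one_smul,
            ← Submodule.Quotient.mk_smul, smul_eq_mul, mul_one] at h3
      have hmap : N.map f = ⊤ := by
        refine (eq_bot_or_eq_top _).resolve_left fun hb => hNK ?_
        exact fun m hm => (Submodule.mem_bot (U L)).mp (hb ▸ Submodule.mem_map_of_mem hm)
      obtain ⟨m, hm, hmv⟩ : v ∈ N.map f := by rw [hmap]; trivial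
      refine hv0 (Submodule.disjoint_def.mp (disjoint_lowerPart δ μ) v hv.1 ?_)
      rw [← hmv]
      exact map_mem_lowerPart f (hlow m hm)
  exact ⟨(f.quotKerEquivOfSurjective hf).symm.trans (Submodule.quotEquivOfEq _ _ hK)⟩

/-- Transported to `L(κ)`, the vector `v` and the generator are two highest weight vectors of one
simple module. -/
theorem IsTriangular.mem_of_isSimpleModule {nm : Submodule ℂ L} {δ : h}
    (ht : IsTriangular h n nm δ) {X : Set (Module.Dual ℂ h)} [IsSimpleModule (U L) Q]
    (hQ : ∃ μ ∈ X, Nonempty (Q ≃ₗ[U L] SimpleHW h n μ)) {μ : Module.Dual ℂ h} {v : Q}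
    (hv : IsHW n μ v) (hv0 : v ≠ 0) : μ ∈ X := by
  obtain ⟨κ, hκ, ⟨e⟩⟩ := hQ
  have : IsSimpleModule (U L) (SimpleHW h n κ) := IsSimpleModule.congr e.symm
  have : Nontrivial (SimpleHW h n κ) := IsSimpleModule.nontrivial (U L) _
  have := ht.weight_unique (hv.map e.toLinearMap) (by simpa using hv0) (isHW_simpleGen κ)
    (simpleGen_ne_zero κ)
  rwa [this]

end Weights

/-! ### Composition factors -/

section CompositionFactors

variable {L : Type u} [LieRing L] [LieAlgebra ℂ L] {h : LieSubalgebra ℂ L} {n : Submodule ℂ L}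
variable {M : Type u} [AddCommGroup M] [Module (U L) M]
variable {Q : Type u} [AddCommGroup Q] [Module (U L) Q]
variable {X : Set (Module.Dual ℂ h)}

/-- A subquotient of `Q` is one of `M`: take preimages. -/
theorem CompositionFactorsIn.of_surjective (hM : CompositionFactorsIn h n X M) (g : M →ₗ[U L] Q)
    (hg : Function.Surjective g) : CompositionFactorsIn h n X Q := by
  intro N K hs
  let N' := N.comap g
  let g' : N' →ₗ[U L] N := g.restrict fun _ hx => hx
  have hg' : Function.Surjective (K.mkQ ∘ₗ g') := by
    refine (Submodule.mkQ_surjective K).comp fun ⟨q, hq⟩ => ?_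
    obtain ⟨m, rfl⟩ := hg q
    exact ⟨⟨m, hq⟩, rfl⟩
  let e := (K.mkQ ∘ₗ g').quotKerEquivOfSurjective hg'
  have := IsSimpleModule.congr e
  obtain ⟨μ, hμ, ⟨e'⟩⟩ := hM N' _ this
  exact ⟨μ, hμ, ⟨e.symm.trans e'⟩⟩

theorem CompositionFactorsIn.of_injective (hM : CompositionFactorsIn h n X M) (f : Q →ₗ[U L] M)
    (hf : Function.Injective f) : CompositionFactorsIn h n X Q := by
  intro N K hs
  let e₁ : N ≃ₗ[U L] N.map f := Submodule.equivMapOfInjective f hf N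
  let e : (N ⧸ K) ≃ₗ[U L] (N.map f ⧸ K.map (e₁ : N →ₗ[U L] N.map f)) :=
    Submodule.Quotient.equiv _ _ e₁ rfl
  have := IsSimpleModule.congr e.symm
  obtain ⟨μ, hμ, ⟨e'⟩⟩ := hM _ _ this
  exact ⟨μ, hμ, ⟨e.trans e'⟩⟩

end CompositionFactors

/-! ### Composition factors and highest weight vectors of subquotients -/

section CompositionFactorsWeights

variable {L : Type u} [LieRing L] [LieAlgebra ℂ L] {h : LieSubalgebra ℂ L} {n : Submodule ℂ L}
variable {M : Type u} [AddCommGroup M] [Module ℂ M] [Module (U L) M] [IsScalarTower ℂ (U L) M]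
variable {Q : Type u} [AddCommGroup Q] [Module ℂ Q] [Module (U L) Q] [IsScalarTower ℂ (U L) Q]
variable {X : Set (Module.Dual ℂ h)}

/-- The weight of a highest weight vector is the highest weight of a composition factor. -/
theorem IsTriangular.mem_of_isHW {nm : Submodule ℂ L} {δ : h} (ht : IsTriangular h n nm δ)
    (hM : CompositionFactorsIn h n X M) {μ : Module.Dual ℂ h} {v : M} (hv : IsHW n μ v)
    (hv0 : v ≠ 0) : μ ∈ X := by
  let N : Submodule (U L) M := U L ∙ v
  let v' : N := ⟨v, Submodule.mem_span_singleton_self v⟩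
  have hv' : IsHW n μ v' := IsHW.of_injective N.subtype N.injective_subtype hv
  have hv0' : v' ≠ 0 := fun e => hv0 (congrArg Subtype.val e)
  have : Nontrivial N := ⟨⟨v', 0, hv0'⟩⟩
  -- `N` is cyclic and nonzero, so it has a maximal submodule; the generator is outside it and
  -- survives in the simple quotient.
  obtain ⟨K, hK, -⟩ := (eq_top_or_exists_le_coatom (⊥ : Submodule (U L) N)).resolve_left
    bot_ne_top
  have : IsSimpleModule (U L) (N ⧸ K) := isSimpleModule_iff_isCoatom.mpr hK
  refine ht.mem_of_isSimpleModule (hM N K inferInstance) (hv'.map K.mkQ) fun h0 => hK.1 ?_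
  have h1 : v' ∈ K := (Submodule.Quotient.mk_eq_zero K).mp h0
  refine eq_top_iff.mpr fun w _ => ?_
  obtain ⟨y, hy⟩ := Submodule.mem_span_singleton.mp w.2
  have : w = y • v' := Subtype.ext hy.symm
  rw [this]
  exact K.smul_mem y h1

/-- A simple subquotient contains a highest weight vector, whose weight determines it. So
composition factors are controlled by looking only at highest weight vectors in subquotients. -/
theorem IsTriangular.compositionFactorsIn {nm : Submodule ℂ L} {δ : h}
    (ht : IsTriangular h n nm δ) (hM : WeightLF h n M)
    (H : ∀ (N : Submodule (U L) M) (K : Submodule (U L) N) (μ : Module.Dual ℂ h) (v : N ⧸ K),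
      IsHW n μ v → v ≠ 0 → μ ∈ X) : CompositionFactorsIn h n X M := by
  intro N K hs
  have hNK : WeightLF h n (N ⧸ K) :=
    (hM.of_injective N.subtype N.injective_subtype).of_surjective K.mkQ
      (Submodule.mkQ_surjective K)
  have : Nontrivial (N ⧸ K) := IsSimpleModule.nontrivial (U L) _
  obtain ⟨μ, v, hv0, hv⟩ := ht.exists_isHW hNK
  exact ⟨μ, H N K μ v hv hv0, ht.nonempty_equiv_simpleHW hv hv0⟩

end CompositionFactorsWeights

end CategoryO

end

noncomputable section

namespace CategoryO

attribute [local instance] LieRing.ofAssociativeRing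

/-! ### The Poincaré–Birkhoff–Witt theorem -/

section PBW

variable {L : Type u} [LieRing L] [LieAlgebra ℂ L]

/-- The comultiplication of the enveloping algebra. -/
def comul (L : Type u) [LieRing L] [LieAlgebra ℂ L] : U L →ₐ[ℂ] U L ⊗[ℂ] U L :=
  UniversalEnvelopingAlgebra.lift ℂ
    { toFun := fun x => toU x ⊗ₜ[ℂ] (1 : U L) + (1 : U L) ⊗ₜ[ℂ] toU x
      map_add' := fun x y => by
        rw [toU_add, TensorProduct.add_tmul, TensorProduct.tmul_add]; abel
      map_smul' := fun c x => by
        rw [toU_smul, RingHom.id_apply, smul_add, TensorProduct.smul_tmul', TensorProduct.tmul_smul]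
      map_lie' := fun {x y} => by
        rw [LieRing.of_associative_ring_bracket]
        simp only [toU_lie, TensorProduct.sub_tmul, TensorProduct.tmul_sub, mul_add, add_mul,
          Algebra.TensorProduct.tmul_mul_tmul, mul_one, one_mul]
        abel }

theorem comul_toU (x : L) : comul L (toU x) = toU x ⊗ₜ[ℂ] (1 : U L) + (1 : U L) ⊗ₜ[ℂ] toU x := by
  simp [comul, toU]

/-- The counit of the enveloping algebra. -/
def counit (L : Type u) [LieRing L] [LieAlgebra ℂ L] : U L →ₐ[ℂ] ℂ :=
  UniversalEnvelopingAlgebra.lift ℂ 0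

theorem counit_toU (x : L) : counit L (toU x) = 0 := by simp [counit, toU]

/-- The divided power `x ^ k / k!`. -/
def dividedPow (x : L) (k : ℕ) : U L := ((k.factorial : ℂ)⁻¹) • toU x ^ k

theorem dividedPow_zero (x : L) : dividedPow x 0 = 1 := by simp [dividedPow]

theorem dividedPow_one (x : L) : dividedPow x 1 = toU x := by simp [dividedPow]

/-- `x ⊗ 1` and `1 ⊗ x` commute, so the binomial theorem applies; the factorials absorb the binomial
coefficients. -/
theorem comul_dividedPow (x : L) (k : ℕ) :
    comul L (dividedPow x k) =
      ∑ p ∈ Finset.HasAntidiagonal.antidiagonal k, dividedPow x p.1 ⊗ₜ[ℂ] dividedPow x p.2 := by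
  have hc : Commute (toU x ⊗ₜ[ℂ] (1 : U L)) ((1 : U L) ⊗ₜ[ℂ] toU x) := by
    simp [Commute, SemiconjBy, Algebra.TensorProduct.tmul_mul_tmul]
  rw [dividedPow, map_smul, map_pow, comul_toU, hc.add_pow', Finset.smul_sum]
  refine Finset.sum_congr rfl fun p hp => ?_
  rw [Finset.HasAntidiagonal.mem_antidiagonal] at hp
  subst hp
  rw [Algebra.TensorProduct.tmul_pow, Algebra.TensorProduct.tmul_pow, one_pow, one_pow,
    Algebra.TensorProduct.tmul_mul_tmul, mul_one, one_mul, dividedPow, dividedPow,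
    TensorProduct.smul_tmul_smul, ← Nat.cast_smul_eq_nsmul ℂ, smul_smul]
  congr 1
  have h1 : ((p.1.factorial : ℂ)) ≠ 0 := by exact_mod_cast p.1.factorial_ne_zero
  have h2 : ((p.2.factorial : ℂ)) ≠ 0 := by exact_mod_cast p.2.factorial_ne_zero
  have h3 : (((p.1 + p.2).factorial : ℂ)) ≠ 0 := by exact_mod_cast (p.1 + p.2).factorial_ne_zero
  have h4 := Nat.add_choose_mul_factorial_mul_factorial p.2 p.1
  have h5 : (((p.1 + p.2).choose p.1 : ℕ) : ℂ) * p.1.factorial * p.2.factorial =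
    (p.1 + p.2).factorial := by
    rw [add_comm p.2 p.1] at h4
    rw [mul_right_comm]
    exact_mod_cast h4
  field_simp
  linear_combination h5

variable {κ : Type} (x : κ → L)

/-- The ordered monomial with exponents `a`. -/
def pbwMonomial (l : List κ) (a : κ →₀ ℕ) : U L := (l.map fun i => dividedPow (x i) (a i)).prod

theorem pbwMonomial_zero (l : List κ) : pbwMonomial x l 0 = 1 := by
  simp [pbwMonomial, dividedPow_zero]

theorem pbwMonomial_congr (l : List κ) {a b : κ →₀ ℕ} (h : ∀ i ∈ l, a i = b i) :
    pbwMonomial x l a = pbwMonomial x l b := by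
  unfold pbwMonomial
  congr 1
  exact List.map_congr_left fun i hi => by rw [h i hi]

theorem pbwMonomial_cons (i : κ) (l : List κ) (a : κ →₀ ℕ) :
    pbwMonomial x (i :: l) a = dividedPow (x i) (a i) * pbwMonomial x l a := by
  simp [pbwMonomial]

/-- The comultiplication is multiplicative and both tensor factors keep the order of the list, so
nothing has to be reordered. The reindexing splits a pair of exponents into its values at the head
`i` and the rest. -/
theorem comul_pbwMonomial [DecidableEq κ] (l : List κ) (hl : l.Nodup) :
    ∀ a : κ →₀ ℕ, (∀ i, i ∉ l → a i = 0) → comul L (pbwMonomial x l a) =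
      ∑ p ∈ Finset.HasAntidiagonal.antidiagonal a, pbwMonomial x l p.1 ⊗ₜ[ℂ] pbwMonomial x l p.2 := by
  induction l with
  | nil =>
    intro a ha
    have : a = 0 := by ext i; simpa using ha i
    subst this
    simp [pbwMonomial, Algebra.TensorProduct.one_def]
  | cons i l ih =>
    intro a ha
    obtain ⟨hil, hl⟩ := List.nodup_cons.mp hl
    have hea : ∀ j, j ∉ l → (a.erase i) j = 0 := by
      intro j hj
      by_cases hji : j = i
      · subst hji; simp
      · rw [Finsupp.erase_ne hji]; exact ha j (by simp [hji, hj])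
    rw [pbwMonomial_cons, pbwMonomial_congr x l (b := a.erase i), map_mul, ih hl _ hea,
      comul_dividedPow, Finset.sum_mul_sum, ← Finset.sum_product']
    · refine Finset.sum_bij'
        (fun p _ => (Finsupp.single i p.1.1 + p.2.1, Finsupp.single i p.1.2 + p.2.2))
        (fun q _ => ((q.1 i, q.2 i), (q.1.erase i, q.2.erase i))) ?_ ?_ ?_ ?_ ?_
      · rintro ⟨⟨s, t⟩, ⟨b, c⟩⟩ hp
        simp only [Finset.mem_product, Finset.HasAntidiagonal.mem_antidiagonal] at hp ⊢
        rw [← Finsupp.single_add_erase i a, ← hp.1, ← hp.2, Finsupp.single_add]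
        abel
      · rintro ⟨b, c⟩ hq
        simp only [Finset.mem_product, Finset.HasAntidiagonal.mem_antidiagonal] at hq ⊢
        rw [← hq]
        exact ⟨rfl, (Finsupp.erase_add _ _ _).symm⟩
      · rintro ⟨⟨s, t⟩, ⟨b, c⟩⟩ hp
        simp only [Finset.mem_product, Finset.HasAntidiagonal.mem_antidiagonal] at hp
        have h0 : b i + c i = 0 := by
          have := DFunLike.congr_fun hp.2 i
          simpa using this
        have hb : b i = 0 := by omega
        have hc : c i = 0 := by omega
        simp [Finsupp.erase_add, Finsupp.erase_of_notMem_support, hb, hc]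
      · rintro ⟨b, c⟩ hq
        simp [Finsupp.single_add_erase]
      · rintro ⟨⟨s, t⟩, ⟨b, c⟩⟩ hp
        simp only [Finset.mem_product, Finset.HasAntidiagonal.mem_antidiagonal] at hp
        have h0 : b i + c i = 0 := by
          have := DFunLike.congr_fun hp.2 i
          simpa using this
        have hb : b i = 0 := by omega
        have hc : c i = 0 := by omega
        have hne : ∀ j ∈ l, j ≠ i := fun j hj e => hil (e ▸ hj)
        rw [pbwMonomial_cons, pbwMonomial_cons, Algebra.TensorProduct.tmul_mul_tmul,
          pbwMonomial_congr x l (a := Finsupp.single i s + b) (b := b),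
          pbwMonomial_congr x l (a := Finsupp.single i t + c) (b := c)]
        · simp [hb, hc]
        · intro j hj; simp [(hne j hj).symm]
        · intro j hj; simp [(hne j hj).symm]
    · intro j hj
      rw [Finsupp.erase_ne]
      exact fun e => hil (e ▸ hj)

variable [Fintype κ] [DecidableEq κ]

/-- Contract a relation of degree at most `n + 1` with `(f ⊗ id) ∘ comul`, where `f` is dual to the
monomial `b₀` among those of degree at most `n`. This turns each exponent `a > b₀` into `a - b₀` and
gives a relation of degree at most `n`, to which `ih` applies. With `b₀ = single i 1` this reaches
all exponents of degree at least two. -/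
theorem linearIndependent_pbwMonomial_succ (l : List κ) (hl : l.Nodup) (hmem : ∀ i, i ∈ l) (n : ℕ)
    (hn : 1 ≤ n)
    (ih : LinearIndependent ℂ (fun a : {a : κ →₀ ℕ // a.degree ≤ n} => pbwMonomial x l a.1))
    (s : Finset (κ →₀ ℕ)) (c : (κ →₀ ℕ) → ℂ) (hs : ∀ a ∈ s, a.degree ≤ n + 1)
    (h0 : ∑ a ∈ s, c a • pbwMonomial x l a = 0) : ∀ a ∈ s, 2 ≤ a.degree → c a = 0 := by
  have key : ∀ b₀ : κ →₀ ℕ, b₀ ≠ 0 → b₀.degree ≤ n → ∀ a ∈ s, b₀ < a → c a = 0 := by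
    intro b₀ hb₀ hb₀n
    obtain ⟨f, hf⟩ : ∃ f : U L →ₗ[ℂ] ℂ, ∀ b : κ →₀ ℕ, b.degree ≤ n →
        f (pbwMonomial x l b) = if b = b₀ then 1 else 0 := by
      obtain ⟨f, hf⟩ := LinearMap.exists_extend
        ((Finsupp.lapply (⟨b₀, hb₀n⟩ : {a : κ →₀ ℕ // a.degree ≤ n})).comp ih.repr)
      refine ⟨f, fun b hb => ?_⟩
      have h1 := DFunLike.congr_fun hf
        ⟨pbwMonomial x l b, Submodule.subset_span ⟨⟨b, hb⟩, rfl⟩⟩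
      simp only [LinearMap.comp_apply, Submodule.subtype_apply] at h1
      rw [h1]
      have h2 := ih.repr_eq_single ⟨b, hb⟩
        ⟨pbwMonomial x l b, Submodule.subset_span ⟨⟨b, hb⟩, rfl⟩⟩ rfl
      change Finsupp.lapply _ (ih.repr _) = _
      rw [h2]
      simp [Finsupp.single_apply]
    let φ : U L ⊗[ℂ] U L →ₗ[ℂ] U L := (TensorProduct.lid ℂ (U L)).toLinearMap ∘ₗ f.rTensor (U L)
    have hφ : ∀ u v, φ (u ⊗ₜ v) = f u • v := fun u v => by simp [φ]
    -- The summand of `(a, 0)` may contain an unknown value of `f` in degree `n + 1`, but it is a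
    -- multiple of `1` and is subtracted below. In all other summands the first exponent has degree
    -- at most `n`.
    have hterm : ∀ a ∈ s, φ (comul L (pbwMonomial x l a)) = f (pbwMonomial x l a) • 1 +
        if b₀ < a then pbwMonomial x l (a - b₀) else 0 := by
      intro a ha
      rw [comul_pbwMonomial x l hl a (fun i hi => absurd (hmem i) hi), map_sum]
      simp only [hφ]
      have h1 : (a, 0) ∈ Finset.HasAntidiagonal.antidiagonal a := by simp
      rw [← Finset.add_sum_erase _ _ h1, pbwMonomial_zero]
      congr 1
      have h2 : ∀ p ∈ (Finset.HasAntidiagonal.antidiagonal a).erase (a, 0),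
          f (pbwMonomial x l p.1) • pbwMonomial x l p.2 =
          if p.1 = b₀ then pbwMonomial x l p.2 else 0 := by
        rintro ⟨b, d⟩ hp
        simp only [Finset.mem_erase, Finset.HasAntidiagonal.mem_antidiagonal] at hp
        have hd : d ≠ 0 := by
          rintro rfl
          apply hp.1
          rw [← hp.2, add_zero]
        have hd' : d.degree ≠ 0 := fun e => hd ((Finsupp.degree_eq_zero_iff d).mp e)
        have h3 := hs a ha
        rw [← hp.2, map_add] at h3
        rw [hf b (by omega)]
        split_ifs <;> simp
      rw [Finset.sum_congr rfl h2]
      split_ifs with hlt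
      · rw [Finset.sum_eq_single (b₀, a - b₀)]
        · simp
        · rintro ⟨b, d⟩ hp hne
          simp only [Finset.mem_erase, Finset.HasAntidiagonal.mem_antidiagonal] at hp
          rw [if_neg]
          rintro rfl
          apply hne
          rw [← hp.2, add_tsub_cancel_left]
        · intro hni
          exfalso
          apply hni
          simp only [Finset.mem_erase, Finset.HasAntidiagonal.mem_antidiagonal]
          refine ⟨fun e => hlt.ne (congrArg Prod.fst e), add_tsub_cancel_of_le hlt.le⟩
      · refine Finset.sum_eq_zero ?_
        rintro ⟨b, d⟩ hp
        simp only [Finset.mem_erase, Finset.HasAntidiagonal.mem_antidiagonal] at hp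
        rw [if_neg]
        rintro rfl
        apply hlt
        refine lt_of_le_of_ne (hp.2 ▸ le_self_add) fun e => hp.1 ?_
        have : d = 0 := by
          have := hp.2
          rw [← e] at this
          exact left_eq_add.mp this.symm
        rw [this, ← e]
    have h1 : ∑ a ∈ s, c a • (if b₀ < a then pbwMonomial x l (a - b₀) else 0) = 0 := by
      have h2 := congrArg (fun u => φ (comul L u) - f u • (1 : U L)) h0
      simp only [map_sum, map_smul, map_zero, zero_smul, sub_zero, Finset.sum_smul,
        ← Finset.sum_sub_distrib] at h2
      refine Eq.trans ?_ h2
      refine Finset.sum_congr rfl fun a ha => ?_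
      rw [hterm a ha, smul_add, smul_eq_mul, mul_smul, add_sub_cancel_left]
    let ψ : {a : κ →₀ ℕ // a ∈ s ∧ b₀ < a} → {a : κ →₀ ℕ // a.degree ≤ n} := fun a =>
      ⟨a.1 - b₀, by
        have h3 := hs a.1 a.2.1
        have h4 : a.1.degree = (a.1 - b₀).degree + b₀.degree := by
          rw [← map_add, tsub_add_cancel_of_le a.2.2.le]
        have : b₀.degree ≠ 0 := fun e => hb₀ ((Finsupp.degree_eq_zero_iff b₀).mp e)
        omega⟩
    have hψ : Function.Injective ψ := by
      intro a b hab
      have := congrArg Subtype.val hab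
      simp only [ψ] at this
      exact Subtype.ext (by
        rw [← tsub_add_cancel_of_le a.2.2.le, ← tsub_add_cancel_of_le b.2.2.le, this])
    have hli := ih.comp ψ hψ
    intro a ha hba
    have : Fintype {a : κ →₀ ℕ // a ∈ s ∧ b₀ < a} :=
      Fintype.subtype (s.filter (b₀ < ·)) (by simp)
    refine Fintype.linearIndependent_iff.mp hli (fun a => c a.1) ?_ ⟨a, ha, hba⟩
    rw [← h1]
    simp only [smul_ite, smul_zero, ← Finset.sum_filter]
    rw [Finset.sum_subtype (s.filter (b₀ < ·)) (p := fun a => a ∈ s ∧ b₀ < a) (by simp)]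
    rfl
  intro a ha h2
  obtain ⟨i, hi⟩ : ∃ i, a i ≠ 0 := by
    by_contra! hc
    have : a = 0 := by ext i; simpa using hc i
    subst this
    simp at h2
  refine key (Finsupp.single i 1) (by simp) (by simpa using hn) a ha ?_
  refine lt_of_le_of_ne ?_ ?_
  · rw [Finsupp.single_le_iff]; omega
  · rintro rfl
    simp at h2

/-- Ordered monomials in elements of `L` that are linearly independent in `U L` are linearly
independent. -/
theorem linearIndependent_pbwMonomial (l : List κ) (hl : l.Nodup) (hmem : ∀ i, i ∈ l)
    (hx : LinearIndependent ℂ fun i => toU (x i)) :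
    LinearIndependent ℂ (pbwMonomial x l) := by
  have hsingle : ∀ i, pbwMonomial x l (Finsupp.single i 1) = toU (x i) := by
    intro i
    rw [pbwMonomial, List.prod_map_eq_pow_single i, List.count_eq_one_of_mem hl (hmem i)]
    · simp [dividedPow_one]
    · intro j hj _
      rw [Finsupp.single_apply, if_neg (Ne.symm hj), dividedPow_zero]
  -- In degree at most one only the independence of `1` from the `x i` has to be added to the
  -- hypothesis, and the counit separates them.
  have hsmall : LinearIndepOn ℂ (pbwMonomial x l) {a | a.degree ≤ 1} := by
    let e : Option κ → (κ →₀ ℕ) := fun o => o.elim 0 (Finsupp.single · 1)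
    have he : Function.Injective e := by
      rintro (_ | i) (_ | j) hij
      · rfl
      · simp [e, eq_comm (a := (0 : κ →₀ ℕ))] at hij
      · simp [e] at hij
      · rw [Finsupp.single_left_injective one_ne_zero hij]
    have h1 : (1 : U L) ∉ Submodule.span ℂ (Set.range fun i => toU (x i)) := by
      intro h1
      have : Submodule.span ℂ (Set.range fun i => toU (x i)) ≤
          LinearMap.ker (counit L).toLinearMap := by
        refine Submodule.span_le.mpr ?_
        rintro _ ⟨i, rfl⟩
        exact counit_toU (x i)
      have h2 : counit L 1 = 0 := this h1
      rw [map_one] at h2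
      exact one_ne_zero h2
    have h2 : pbwMonomial x l ∘ e = fun o => Option.casesOn' o 1 fun i => toU (x i) := by
      funext o
      cases o with
      | none => exact pbwMonomial_zero x l
      | some i => exact hsingle i
    have h3 : LinearIndependent ℂ (pbwMonomial x l ∘ e) := by
      rw [h2]; exact linearIndependent_option'.mpr ⟨hx, h1⟩
    refine ((linearIndepOn_range_iff he _).mpr h3).mono ?_
    intro a ha
    change a.degree ≤ 1 at ha
    by_cases h0 : a = 0
    · exact ⟨none, h0.symm⟩
    obtain ⟨i, hi⟩ : ∃ i, a i ≠ 0 := by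
      by_contra! hc
      exact h0 (by ext i; simpa using hc i)
    refine ⟨some i, ?_⟩
    have hle : Finsupp.single i 1 ≤ a := by rw [Finsupp.single_le_iff]; omega
    have hdeg : (a - Finsupp.single i 1).degree = 0 := by
      have := congrArg Finsupp.degree (tsub_add_cancel_of_le hle)
      rw [map_add, Finsupp.degree_single] at this
      omega
    rw [Finsupp.degree_eq_zero_iff] at hdeg
    have := tsub_add_cancel_of_le hle
    rwa [hdeg, zero_add] at this
  have hall : ∀ n, 1 ≤ n → LinearIndepOn ℂ (pbwMonomial x l) {a | a.degree ≤ n} := by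
    intro n hn
    induction n, hn using Nat.le_induction with
    | base => exact hsmall
    | succ n hn ih =>
      rw [linearIndepOn_iff_linearIndepOn_finset]
      intro s hs
      rw [linearIndepOn_finset_iff]
      intro c h0
      -- The coefficients in degree at least two vanish, which leaves a relation in degree at most
      -- one.
      have h2 := linearIndependent_pbwMonomial_succ x l hl hmem n hn ih s c hs h0
      have h3 : ∑ a ∈ s.filter (fun a => a.degree ≤ 1), c a • pbwMonomial x l a = 0 := by
        rw [← h0, Finset.sum_filter]
        refine Finset.sum_congr rfl fun a ha => ?_
        split_ifs with h
        · rfl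
        · rw [h2 a ha (by omega), zero_smul]
      intro a ha
      by_cases h : a.degree ≤ 1
      · exact linearIndepOn_finset_iff.mp (hsmall.mono fun b hb => (Finset.mem_filter.mp hb).2)
          c h3 a (by simp [ha, h])
      · exact h2 a ha (by omega)
  rw [linearIndependent_iff']
  intro s c h0 a ha
  exact linearIndepOn_finset_iff.mp ((hall (s.sup Finsupp.degree + 1) (by omega)).mono
    fun b hb => ((Finset.le_sup (f := Finsupp.degree) hb).trans (Nat.le_succ _))) c h0 a ha

/-- Sorted products of elements of a spanning family span the enveloping algebra. -/
theorem span_sorted_eq_top {κ : Type} [LinearOrder κ] (x : κ → L)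
    (hx : Submodule.span ℂ (Set.range x) = ⊤) :
    Submodule.span ℂ {z | ∃ w : List κ, w.Pairwise (· ≤ ·) ∧ z = (w.map fun i => toU (x i)).prod}
      = ⊤ := by
  let Y : ℕ → Submodule ℂ (U L) := fun k => Submodule.span ℂ
    {z | ∃ w : List κ, w.length ≤ k ∧ w.Pairwise (· ≤ ·) ∧ z = (w.map fun i => toU (x i)).prod}
  have hmono : Monotone Y := fun j k hjk =>
    Submodule.span_mono fun z ⟨w, hw, hw'⟩ => ⟨w, hw.trans hjk, hw'⟩
  have hlift : ∀ (k : ℕ) (z : L), (∀ i, ∀ w : List κ, w.length ≤ k → w.Pairwise (· ≤ ·) →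
      toU (x i) * (w.map fun i => toU (x i)).prod ∈ Y (k + 1)) →
      ∀ y ∈ Y k, toU z * y ∈ Y (k + 1) := by
    intro k z hk y hy
    induction hy using Submodule.span_induction with
    | zero => rw [mul_zero]; exact zero_mem _
    | add a b _ _ ha hb => rw [mul_add]; exact add_mem ha hb
    | smul c a _ ha => rw [mul_smul_comm]; exact Submodule.smul_mem _ _ ha
    | mem y hy =>
      obtain ⟨w, hw, hs, rfl⟩ := hy
      have hz : z ∈ Submodule.span ℂ (Set.range x) := by rw [hx]; trivial
      induction hz using Submodule.span_induction with
      | zero => rw [toU_zero, zero_mul]; exact zero_mem _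
      | add a b _ _ ha hb => rw [toU_add, add_mul]; exact add_mem ha hb
      | smul c a _ ha => rw [toU_smul, smul_mul_assoc]; exact Submodule.smul_mem _ _ ha
      | mem z hz =>
        obtain ⟨i, rfl⟩ := hz
        exact hk i w hw hs
  -- Moving a letter to its sorted place costs commutators, and each of them shortens the word by
  -- one.
  have key : ∀ (k : ℕ) (i : κ) (w : List κ), w.length ≤ k → w.Pairwise (· ≤ ·) →
      toU (x i) * (w.map fun i => toU (x i)).prod -
        ((w.orderedInsert (· ≤ ·) i).map fun i => toU (x i)).prod ∈ Y k := by
    intro k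
    induction k with
    | zero =>
      intro i w hw _
      have : w = [] := List.length_eq_zero_iff.mp (by omega)
      subst this
      simp
    | succ k ih =>
      have hmul : ∀ i, ∀ w : List κ, w.length ≤ k → w.Pairwise (· ≤ ·) →
          toU (x i) * (w.map fun i => toU (x i)).prod ∈ Y (k + 1) := by
        intro i w hw hs
        rw [← sub_add_cancel (toU (x i) * _)]
        refine add_mem (hmono (Nat.le_succ k) (ih i w hw hs)) (Submodule.subset_span
          ⟨w.orderedInsert (· ≤ ·) i, ?_, hs.orderedInsert i w, rfl⟩)
        rw [List.orderedInsert_length]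
        omega
      intro i w hw hs
      cases w with
      | nil => simp
      | cons j w =>
        rw [List.orderedInsert_cons]
        split_ifs with hij
        · simp
        · simp only [List.map_cons, List.prod_cons, List.length_cons] at hw ⊢
          have hs' := (List.pairwise_cons.mp hs).2
          have e : toU (x i) * (toU (x j) * (w.map fun i => toU (x i)).prod) -
              toU (x j) * ((w.orderedInsert (· ≤ ·) i).map fun i => toU (x i)).prod =
              toU ⁅x i, x j⁆ * (w.map fun i => toU (x i)).prod +
              toU (x j) * (toU (x i) * (w.map fun i => toU (x i)).prod -
                ((w.orderedInsert (· ≤ ·) i).map fun i => toU (x i)).prod) := by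
            rw [toU_lie]
            noncomm_ring
          rw [e]
          exact add_mem (hlift k _ hmul _ (Submodule.subset_span ⟨w, by omega, hs', rfl⟩))
            (hlift k _ hmul _ (ih i w (by omega) hs'))
  have hstab : ∀ z : L, ∀ y ∈ ⨆ k, Y k, toU z • y ∈ ⨆ k, Y k := by
    intro z y hy
    rw [Submodule.mem_iSup_of_directed _ hmono.directed_le] at hy
    obtain ⟨k, hk⟩ := hy
    refine Submodule.mem_iSup_of_mem (k + 1) (hlift k z (fun i w hw hs => ?_) y hk)
    rw [← sub_add_cancel (toU (x i) * _)]
    refine add_mem (hmono (Nat.le_succ k) (key k i w hw hs)) (Submodule.subset_span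
      ⟨w.orderedInsert (· ≤ ·) i, ?_, hs.orderedInsert i w, rfl⟩)
    rw [List.orderedInsert_length]
    omega
  refine eq_top_iff.mpr fun y _ => ?_
  have h1 : (1 : U L) ∈ ⨆ k, Y k :=
    Submodule.mem_iSup_of_mem 0 (Submodule.subset_span ⟨[], by simp, by simp, by simp⟩)
  have h2 := U_smul_mem _ hstab y 1 h1
  rw [smul_eq_mul, mul_one] at h2
  refine (iSup_le fun k => Submodule.span_mono ?_ : ⨆ k, Y k ≤ _) h2
  rintro z ⟨w, -, hw, rfl⟩
  exact ⟨w, hw, rfl⟩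

/-- A sorted word is the concatenation of its constant blocks in the order of `l`. -/
theorem prod_map_eq_of_sorted {κ : Type} [LinearOrder κ] {A : Type*} [Monoid A] (f : κ → A)
    (l w : List κ) (hl : l.Pairwise (· < ·)) (hw : w.Pairwise (· ≤ ·)) (hmem : ∀ i ∈ w, i ∈ l) :
    (w.map f).prod = (l.map fun i => f i ^ w.count i).prod := by
  have h1 : w = l.flatMap fun i => List.replicate (w.count i) i := by
    refine List.Perm.eq_of_pairwise (le := (· ≤ ·)) (fun _ _ _ _ => le_antisymm) hw ?_ ?_
    · rw [List.pairwise_flatMap]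
      refine ⟨fun i _ => List.pairwise_replicate.mpr (Or.inr le_rfl), hl.imp fun hab x hx y hy => ?_⟩
      rw [List.eq_of_mem_replicate hx, List.eq_of_mem_replicate hy]
      exact hab.le
    · rw [List.perm_iff_count]
      intro a
      rw [List.count_flatMap]
      by_cases ha : a ∈ l
      · have hnd : l.Nodup := hl.imp fun h => h.ne
        rw [List.sum_map_eq_nsmul_single a]
        · simp [List.count_eq_one_of_mem hnd ha]
        · intro b hb _
          simp [List.count_replicate, hb]
      · rw [List.count_eq_zero_of_not_mem fun h => ha (hmem a h)]
        refine (List.sum_eq_zero ?_).symm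
        intro k hk
        obtain ⟨b, hb, rfl⟩ := List.mem_map.mp hk
        have : b ≠ a := fun e => ha (e ▸ hb)
        simp [List.count_replicate, this]
  conv_lhs => rw [h1]
  rw [List.map_flatMap, List.flatMap_def, List.prod_flatten, List.map_map]
  congr 1
  refine List.map_congr_left fun i _ => ?_
  simp

theorem span_pbwMonomial_eq_top {κ : Type} [LinearOrder κ] [Fintype κ] (x : κ → L)
    (hx : Submodule.span ℂ (Set.range x) = ⊤) (l : List κ) (hl : l.Pairwise (· < ·))
    (hmem : ∀ i, i ∈ l) : Submodule.span ℂ (Set.range (pbwMonomial x l)) = ⊤ := by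
  rw [eq_top_iff, ← span_sorted_eq_top x hx, Submodule.span_le]
  rintro z ⟨w, hw, rfl⟩
  rw [prod_map_eq_of_sorted _ l w hl hw fun i _ => hmem i]
  have h1 : ∀ l' : List κ, ∃ c : ℂ, (l'.map fun i => toU (x i) ^ w.count i).prod =
      c • pbwMonomial x l' (Finsupp.equivFunOnFinite.symm fun i => w.count i) := by
    intro l'
    induction l' with
    | nil => exact ⟨1, by simp [pbwMonomial]⟩
    | cons i l' ih =>
      obtain ⟨c, hc⟩ := ih
      have h0 : ((w.count i).factorial : ℂ) ≠ 0 := by exact_mod_cast (w.count i).factorial_ne_zero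
      refine ⟨(w.count i).factorial * c, ?_⟩
      rw [List.map_cons, List.prod_cons, hc, pbwMonomial_cons, dividedPow,
        Finsupp.equivFunOnFinite_symm_apply_apply, mul_smul_comm, smul_mul_assoc, smul_smul,
        mul_right_comm, mul_inv_cancel₀ h0, one_mul]
  obtain ⟨c, hc⟩ := h1 l
  rw [SetLike.mem_coe, hc]
  exact Submodule.smul_mem _ _ (Submodule.subset_span ⟨_, rfl⟩)

/-- The map of enveloping algebras induced by the inclusion of a subalgebra. -/
def subToU (p : LieSubalgebra ℂ L) : U p →ₐ[ℂ] U L :=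
  UniversalEnvelopingAlgebra.lift ℂ ((UniversalEnvelopingAlgebra.ι ℂ).comp p.incl)

theorem subToU_toU (p : LieSubalgebra ℂ L) (x : p) : subToU p (toU x) = toU (x : L) := by
  simp [subToU, toU]

/-- `U L` is the direct sum of `U p` and of a right `U p`-submodule. -/
theorem exists_right_retraction [FiniteDimensional ℂ L] (p : LieSubalgebra ℂ L)
    (q : Submodule ℂ L) (hqp : IsCompl q p.toSubmodule)
    (hinj : Function.Injective (toU : L → U L)) :
    ∃ φ : U L →ₗ[ℂ] U p, φ 1 = 1 ∧ ∀ u w, φ (u * subToU p w) = φ u * w := by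
  classical
  let bq := Module.finBasis ℂ q
  let bp := Module.finBasis ℂ p
  let r := Module.finrank ℂ q
  let s := Module.finrank ℂ p
  let B := (bq.prod bp).map (Submodule.prodEquivOfIsCompl q p.toSubmodule hqp)
  let x : Fin r ⊕ₗ Fin s → L := fun k => B (ofLex k)
  let y : Fin r → L := fun i => bq i
  have hxl : ∀ i, x (Sum.inlₗ i) = bq i := fun i => by
    simp [x, B]
    exact (Submodule.coe_prodEquivOfIsCompl' q p.toSubmodule hqp (bq i, 0)).trans (add_zero _)
  have hxr : ∀ i, x (Sum.inrₗ i) = bp i := fun i => by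
    simp [x, B]
    exact (Submodule.coe_prodEquivOfIsCompl' q p.toSubmodule hqp (0, bp i)).trans (zero_add _)
  -- The basis of `q` precedes that of `p`, so each ordered monomial is a monomial in `q` times a
  -- monomial in `p`.
  let l : List (Fin r ⊕ₗ Fin s) :=
    (List.finRange r).map Sum.inlₗ ++ (List.finRange s).map Sum.inrₗ
  have hl : l.Pairwise (· < ·) := by
    rw [List.pairwise_append, List.pairwise_map, List.pairwise_map]
    refine ⟨(List.pairwise_lt_finRange r).imp fun h => Sum.Lex.inl_lt_inl_iff.mpr h,
      (List.pairwise_lt_finRange s).imp fun h => Sum.Lex.inr_lt_inr_iff.mpr h, ?_⟩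
    intro a ha b hb
    obtain ⟨i, -, rfl⟩ := List.mem_map.mp ha
    obtain ⟨j, -, rfl⟩ := List.mem_map.mp hb
    exact Sum.Lex.inl_lt_inr i j
  have hlmem : ∀ k, k ∈ l := by
    intro k
    rcases k with i | j
    · exact List.mem_append_left _ (List.mem_map.mpr ⟨i, List.mem_finRange i, rfl⟩)
    · exact List.mem_append_right _ (List.mem_map.mpr ⟨j, List.mem_finRange j, rfl⟩)
  let e : (Fin r →₀ ℕ) × (Fin s →₀ ℕ) → (Fin r ⊕ₗ Fin s →₀ ℕ) := fun c =>
    Finsupp.equivFunOnFinite.symm fun k => Sum.elim c.1 c.2 (ofLex k)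
  have he : Function.Bijective e := by
    constructor
    · intro c d hcd
      refine Prod.ext (Finsupp.ext fun i => ?_) (Finsupp.ext fun i => ?_)
      · exact DFunLike.congr_fun hcd (Sum.inlₗ i)
      · exact DFunLike.congr_fun hcd (Sum.inrₗ i)
    · intro c
      refine ⟨(Finsupp.equivFunOnFinite.symm fun i => c (Sum.inlₗ i),
        Finsupp.equivFunOnFinite.symm fun i => c (Sum.inrₗ i)), Finsupp.ext fun k => ?_⟩
      rcases k with i | j <;> rfl
  let mon : (Fin r →₀ ℕ) × (Fin s →₀ ℕ) → U L := fun c =>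
    pbwMonomial y (List.finRange r) c.1 * subToU p (pbwMonomial bp (List.finRange s) c.2)
  have hmon : mon = pbwMonomial x l ∘ e := by
    funext c
    simp only [mon, Function.comp_apply, pbwMonomial, l, List.map_append, List.prod_append,
      List.map_map, map_list_prod]
    congr 2
    · refine List.map_congr_left fun i _ => ?_
      simp only [Function.comp_apply, hxl]
      rfl
    · refine List.map_congr_left fun i _ => ?_
      simp only [Function.comp_apply, hxr, dividedPow, map_smul, map_pow, subToU_toU]
      rfl
  have hBl : LinearIndependent ℂ fun k => toU (x k) := by
    have h1 : LinearIndependent ℂ x := B.linearIndependent.comp ofLex ofLex.injective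
    exact h1.map' (UniversalEnvelopingAlgebra.ι ℂ : L →ₗ⁅ℂ⁆ U L).toLinearMap
      (LinearMap.ker_eq_bot.mpr hinj)
  have hxspan : Submodule.span ℂ (Set.range x) = ⊤ := by
    have : Set.range x = Set.range B := ofLex.surjective.range_comp B
    rw [this, B.span_eq]
  have hli : LinearIndependent ℂ mon := by
    rw [hmon]
    exact (linearIndependent_pbwMonomial x l (hl.imp fun h => h.ne) hlmem hBl).comp e he.1
  have hspan : ⊤ ≤ Submodule.span ℂ (Set.range mon) := by
    rw [hmon, he.2.range_comp, span_pbwMonomial_eq_top x hxspan l hl hlmem]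
  let Bm : Module.Basis _ ℂ (U L) := Module.Basis.mk hli hspan
  let φ : U L →ₗ[ℂ] U p := Bm.constr ℂ fun c =>
    if c.1 = 0 then pbwMonomial bp (List.finRange s) c.2 else 0
  have hspanp : Submodule.span ℂ (Set.range (pbwMonomial bp (List.finRange s))) = ⊤ :=
    span_pbwMonomial_eq_top bp bp.span_eq _ (List.pairwise_lt_finRange s) List.mem_finRange
  -- The second factor may be any element of `U p`, because the monomials span `U p`; their
  -- independence inside `U p` plays no role.
  have hφ : ∀ (a : Fin r →₀ ℕ) (v : U p), φ (pbwMonomial y (List.finRange r) a * subToU p v) =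
      if a = 0 then v else 0 := by
    intro a v
    have hv : v ∈ Submodule.span ℂ (Set.range (pbwMonomial bp (List.finRange s))) := by
      rw [hspanp]; trivial
    induction hv using Submodule.span_induction with
    | zero => simp
    | add v w _ _ hv hw => rw [map_add, mul_add, map_add, hv, hw]; split_ifs <;> simp
    | smul c v _ hv => rw [map_smul, mul_smul_comm, map_smul, hv]; split_ifs <;> simp
    | mem v hv =>
      obtain ⟨b, rfl⟩ := hv
      have h1 : Bm (a, b) = pbwMonomial y (List.finRange r) a *
          subToU p (pbwMonomial bp (List.finRange s) b) := Module.Basis.mk_apply hli hspan (a, b)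
      rw [← h1, Module.Basis.constr_basis]
  refine ⟨φ, ?_, fun u w => ?_⟩
  · have := hφ 0 1
    rwa [pbwMonomial_zero, map_one, one_mul, if_pos rfl] at this
  · have hu : u ∈ Submodule.span ℂ (Set.range mon) := hspan trivial
    induction hu using Submodule.span_induction with
    | zero => simp
    | add v w _ _ hv hw => rw [add_mul, map_add, hv, hw, map_add, add_mul]
    | smul c v _ hv => rw [smul_mul_assoc, map_smul, hv, map_smul, smul_mul_assoc]
    | mem v hv =>
      obtain ⟨⟨a, b⟩, rfl⟩ := hv
      simp only [mon]
      rw [mul_assoc, ← map_mul, hφ, hφ]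
      split_ifs <;> simp

end PBW

end CategoryO

end

noncomputable section

namespace CategoryO

/-! ### Root systems with a base -/

section Roots

set_option linter.unusedSectionVars false

open RootPairing

variable {ι V N : Type*} [Finite ι] [AddCommGroup V] [Module ℂ V] [AddCommGroup N] [Module ℂ N]
  {P : RootPairing ι ℂ V N} [P.IsRootSystem] [P.IsCrystallographic] [P.IsReduced]
  (b : P.Base) (S : Set ι)

theorem weylGroup_ext {w w' : P.weylGroup} (h : ∀ m : V, w • m = w' • m) : w = w' := by
  refine Subtype.ext (RootPairing.Equiv.weightHom_injective P ?_)
  exact LinearEquiv.ext h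

theorem ofIdx_smul_eq (i : ι) (m : V) : weylGroup.ofIdx P i • m = m - P.coroot' i m • P.root i := by
  rw [weylGroup.ofIdx_smul, ← reflection_apply]
  rfl

theorem ofIdx_mul_self (i : ι) : weylGroup.ofIdx P i * weylGroup.ofIdx P i = 1 := by
  refine weylGroup_ext fun m => ?_
  rw [mul_smul, one_smul]
  exact P.reflection_same i m

theorem ofIdx_inv (i : ι) : (weylGroup.ofIdx P i)⁻¹ = weylGroup.ofIdx P i :=
  inv_eq_of_mul_eq_one_left (ofIdx_mul_self i)

theorem ofIdx_reflectionPerm (i j : ι) : weylGroup.ofIdx P (P.reflectionPerm j i) =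
    weylGroup.ofIdx P j * weylGroup.ofIdx P i * weylGroup.ofIdx P j := by
  refine weylGroup_ext fun m => ?_
  rw [mul_smul, mul_smul]
  change P.reflection (P.reflectionPerm j i) m = P.reflection j (P.reflection i (P.reflection j m))
  rw [P.reflection_reflectionPerm (i := i) (j := j)]
  rfl

theorem coroot'_weylGroup_smul (w : P.weylGroup) : ∀ (i : ι) (m : V),
    P.coroot' i (w • m) = P.coroot' (P.weylGroupToPerm w⁻¹ i) m := by
  obtain ⟨w, hw⟩ := w
  induction hw using weylGroup.induction with
  | mem j =>
    intro i m
    change P.coroot' i (P.reflection j m) = P.coroot' (P.weylGroupToPerm (weylGroup.ofIdx P j)⁻¹ i) m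
    rw [ofIdx_inv]
    exact P.coroot'_reflection m
  | one => intro i m; simp
  | mul x y hx hy ihx ihy =>
    intro i m
    have e : (⟨x * y, mul_mem hx hy⟩ : P.weylGroup) = ⟨x, hx⟩ * ⟨y, hy⟩ := rfl
    rw [e, mul_smul, ihx, ihy, mul_inv_rev, map_mul]
    rfl

variable {b} in
theorem isPos_neg_iff {i j : ι} (h : P.root j = - P.root i) : b.IsPos j ↔ ¬ b.IsPos i := by
  have : P.root j = P.root (P.reflectionPerm i i) := by
    rw [h, root_reflectionPerm, reflection_apply_self]
  rw [P.root.injective this]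
  exact Base.IsPos.neg_iff_not b i

/-- The coefficient of a simple root. -/
def simpleCoeff (j : b.support) : V →ₗ[ℂ] ℂ := b.toWeightBasis.coord j

theorem simpleCoeff_root [DecidableEq ι] (j k : b.support) :
    simpleCoeff b j (P.root k) = if (k : ι) = j then 1 else 0 := by
  rw [simpleCoeff, Module.Basis.coord_apply, Base.toWeightBasis_repr_root, Finsupp.single_apply]
  simp only [Subtype.ext_iff]

theorem eq_sum_simpleCoeff (m : V) : m = ∑ j, simpleCoeff b j m • P.root j := by
  conv_lhs => rw [← b.toWeightBasis.sum_repr m]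
  simp [simpleCoeff]

variable {b} in
theorem exists_nat_simpleCoeff {i : ι} (hi : b.IsPos i) (j : b.support) :
    ∃ n : ℕ, simpleCoeff b j (P.root i) = n := by
  classical
  refine hi.induction_on_add (p := fun i => ∃ n : ℕ, simpleCoeff b j (P.root i) = n) ?_ ?_
  · intro k hk
    refine ⟨if k = j then 1 else 0, ?_⟩
    rw [simpleCoeff_root b j ⟨k, hk⟩]
    simp
  · rintro i k l h ⟨n, hn⟩ hk
    refine ⟨n + if k = j then 1 else 0, ?_⟩
    rw [h, map_add, hn, simpleCoeff_root b j ⟨k, hk⟩]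
    simp

/-- Otherwise the opposite root is positive and has a nonnegative coefficient at `j`. -/
theorem isPos_of_simpleCoeff_pos {i : ι} (j : b.support) {n : ℕ} (hn : 0 < n)
    (h : simpleCoeff b j (P.root i) = n) : b.IsPos i := by
  by_contra hi
  have h1 : P.root (P.reflectionPerm i i) = - P.root i := by
    rw [root_reflectionPerm, reflection_apply_self]
  obtain ⟨m, hm⟩ := exists_nat_simpleCoeff ((isPos_neg_iff h1).mpr hi) j
  rw [h1, map_neg, h] at hm
  have : ((n + m : ℕ) : ℂ) = 0 := by push_cast; linear_combination -hm
  have : n + m = 0 := by exact_mod_cast this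
  omega

variable (P) in
/-- The lattice `ℤS`. -/
abbrev rootLattice : AddSubgroup V := AddSubgroup.closure (P.root '' S)

variable {b S}

theorem simpleCoeff_of_mem_rootLattice (hS : S ⊆ b.support) {m : V} (hm : m ∈ rootLattice P S)
    (j : b.support) (hj : (j : ι) ∉ S) : simpleCoeff b j m = 0 := by
  classical
  induction hm using AddSubgroup.closure_induction with
  | mem x hx =>
    obtain ⟨k, hk, rfl⟩ := hx
    rw [simpleCoeff_root b j ⟨k, hS hk⟩, if_neg]
    rintro rfl
    exact hj hk
  | zero => simp
  | add x y _ _ hx hy => rw [map_add, hx, hy, add_zero]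
  | neg x _ hx => rw [map_neg, hx, neg_zero]

theorem mem_rootLattice_of_simpleCoeff {i : ι} (hi : b.IsPos i)
    (h : ∀ j : b.support, (j : ι) ∉ S → simpleCoeff b j (P.root i) = 0) :
    P.root i ∈ rootLattice P S := by
  rw [eq_sum_simpleCoeff b (P.root i)]
  refine sum_mem fun j _ => ?_
  by_cases hj : (j : ι) ∈ S
  · obtain ⟨n, hn⟩ := exists_nat_simpleCoeff hi j
    rw [hn, Nat.cast_smul_eq_nsmul]
    exact AddSubgroup.nsmul_mem _ (AddSubgroup.subset_closure (Set.mem_image_of_mem _ hj)) n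
  · rw [h j hj, zero_smul]
    exact zero_mem _

theorem exists_simpleCoeff_pos {i : ι} (hi : b.IsPos i) (h : P.root i ∉ rootLattice P S) :
    ∃ (j : b.support) (n : ℕ), (j : ι) ∉ S ∧ 0 < n ∧ simpleCoeff b j (P.root i) = n := by
  by_contra! hc
  refine h (mem_rootLattice_of_simpleCoeff hi fun j hj => ?_)
  obtain ⟨n, hn⟩ := exists_nat_simpleCoeff hi j
  rcases Nat.eq_zero_or_pos n with rfl | h0
  · simpa using hn
  · exact absurd hn (hc j n hj h0)

/-- A root that differs from a positive root outside `ℤS` by an element of `ℤS` is positive. -/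
theorem isPos_of_sub_mem (hS : S ⊆ b.support) {i k : ι} (hi : b.IsPos i)
    (h : P.root i ∉ rootLattice P S) (hk : P.root k - P.root i ∈ rootLattice P S) :
    b.IsPos k ∧ P.root k ∉ rootLattice P S := by
  obtain ⟨j, n, hj, hn, h1⟩ := exists_simpleCoeff_pos hi h
  -- Elements of `ℤS` do not change the coefficient at the simple root `j` outside `S`, and one
  -- positive coefficient suffices for positivity.
  have h2 := simpleCoeff_of_mem_rootLattice hS hk j hj
  rw [map_sub, h1, sub_eq_zero] at h2
  refine ⟨isPos_of_simpleCoeff_pos b j hn h2, fun h3 => ?_⟩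
  rw [simpleCoeff_of_mem_rootLattice hS h3 j hj] at h2
  exact hn.ne (by exact_mod_cast h2)

/-- A positive root in `ℤS` that is the sum of a positive and a simple root. -/
theorem mem_of_add_mem_rootLattice (hS : S ⊆ b.support) {i j : ι} (hi : b.IsPos i)
    (hj : j ∈ b.support) (h : P.root i + P.root j ∈ rootLattice P S) :
    P.root i ∈ rootLattice P S ∧ j ∈ S := by
  classical
  have hjS : j ∈ S := by
    by_contra hj'
    have h1 := simpleCoeff_of_mem_rootLattice hS h ⟨j, hj⟩ hj'
    obtain ⟨n, hn⟩ := exists_nat_simpleCoeff hi ⟨j, hj⟩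
    rw [map_add, hn, simpleCoeff_root b ⟨j, hj⟩ ⟨j, hj⟩, if_pos rfl] at h1
    have : n + 1 = 0 := by exact_mod_cast h1
    omega
  have := sub_mem h (AddSubgroup.subset_closure (Set.mem_image_of_mem P.root hjS))
  rw [add_sub_cancel_right] at this
  exact ⟨this, hjS⟩

theorem root_mem_closure_of_isPos (hS : S ⊆ b.support) {i : ι} (hi : b.IsPos i)
    (h : P.root i ∈ rootLattice P S) : P.root i ∈ AddSubmonoid.closure (P.root '' S) := by
  rw [eq_sum_simpleCoeff b (P.root i)]
  refine sum_mem fun j _ => ?_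
  by_cases hj : (j : ι) ∈ S
  · obtain ⟨n, hn⟩ := exists_nat_simpleCoeff hi j
    rw [hn, Nat.cast_smul_eq_nsmul]
    exact AddSubmonoid.nsmul_mem _ (AddSubmonoid.subset_closure (Set.mem_image_of_mem _ hj)) n
  · rw [simpleCoeff_of_mem_rootLattice hS h j hj, zero_smul]
    exact zero_mem _

/-- The root `α` is a sum of elements of `S`; if none of them paired positively with the coroot of
`α`, then neither would `α`, but `α` pairs to `2`. -/
theorem exists_pairing_pos (hS : S ⊆ b.support) {i : ι} (hi : b.IsPos i)
    (h : P.root i ∈ rootLattice P S) : ∃ j ∈ S, 0 < P.pairingIn ℤ j i := by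
  by_contra! hc
  have h1 : ∃ z : ℤ, z ≤ 0 ∧ P.coroot' i (P.root i) = z := by
    refine AddSubmonoid.closure_induction (motive := fun m _ => ∃ z : ℤ, z ≤ 0 ∧ P.coroot' i m = z)
      ?_ ⟨0, le_rfl, by simp⟩ ?_ (root_mem_closure_of_isPos hS hi h)
    · rintro _ ⟨j, hj, rfl⟩
      refine ⟨P.pairingIn ℤ j i, hc j hj, ?_⟩
      rw [root_coroot'_eq_pairing, ← P.algebraMap_pairingIn ℤ]
      rfl
    · rintro x y _ _ ⟨z, hz, hx⟩ ⟨z', hz', hy⟩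
      exact ⟨z + z', by omega, by rw [map_add, hx, hy]; push_cast; ring⟩
  obtain ⟨z, hz, h2⟩ := h1
  rw [root_coroot'_eq_pairing, pairing_same] at h2
  have : (2 : ℤ) = z := by exact_mod_cast h2
  omega

variable (P S) in
/-- The subgroup generated by the reflections in `S`. -/
abbrev parabolic : Subgroup P.weylGroup := Subgroup.closure (weylGroup.ofIdx P '' S)

/-- Induction on the height. Some `j ∈ S` pairs positively with the root `i`, so `s_j` maps `i` to a
positive root of smaller height in `ℤS`, unless `i = j`; then conjugate by `s_j`. -/
theorem ofIdx_mem_parabolic_of_isPos (hS : S ⊆ b.support) {i : ι} (hi : b.IsPos i)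
    (h : P.root i ∈ rootLattice P S) : weylGroup.ofIdx P i ∈ parabolic P S := by
  generalize hN : (b.height i).natAbs = N
  induction N using Nat.strongRecOn generalizing i with
  | ind n ih =>
    obtain ⟨j, hj, hj'⟩ := exists_pairing_pos hS hi h
    have hjm : weylGroup.ofIdx P j ∈ parabolic P S := Subgroup.subset_closure (Set.mem_image_of_mem _ hj)
    rcases eq_or_ne i j with rfl | hij
    · exact hjm
    rw [P.zero_lt_pairingIn_iff'] at hj'
    have hk := hi.reflectionPerm (hS hj) hij
    have h1 : P.root (P.reflectionPerm j i) = P.root i + (-P.pairingIn ℤ i j) • P.root j := by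
      rw [root_reflectionPerm, neg_smul, reflection_apply_root' ℤ, sub_eq_add_neg]
    have hlt : (b.height (P.reflectionPerm j i)).natAbs < n := by
      have h2 := b.height_add_zsmul h1
      rw [Base.height_one_of_mem_support (hS hj), smul_eq_mul, mul_one] at h2
      have h3 := (b.isPos_iff).mp hi
      have h4 := (b.isPos_iff).mp hk
      omega
    have h5 : P.root (P.reflectionPerm j i) ∈ rootLattice P S := by
      rw [h1]
      exact add_mem h (AddSubgroup.zsmul_mem _ (AddSubgroup.subset_closure (Set.mem_image_of_mem _ hj)) _)
    have h6 := ih _ hlt hk h5 rfl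
    have h7 := ofIdx_reflectionPerm (P := P) (P.reflectionPerm j i) j
    rw [reflectionPerm_self] at h7
    rw [h7]
    exact mul_mem (mul_mem hjm h6) hjm

/-- The reflections in the roots in `ℤS` belong to `W^S`. -/
theorem ofIdx_mem_parabolic (hS : S ⊆ b.support) {i : ι}
    (h : P.root i ∈ rootLattice P S) : weylGroup.ofIdx P i ∈ parabolic P S := by
  by_cases hi : b.IsPos i
  · exact ofIdx_mem_parabolic_of_isPos hS hi h
  · have h1 : P.root (P.reflectionPerm i i) = - P.root i := by
      rw [root_reflectionPerm, reflection_apply_self]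
    have := ofIdx_mem_parabolic_of_isPos hS ((isPos_neg_iff h1).mpr hi) (h1 ▸ neg_mem h)
    rwa [ofIdx_reflectionPerm, ofIdx_mul_self, one_mul] at this

/-- A reflection in `S` changes an integral weight by an integral multiple of its root, and the Weyl
group preserves integrality. -/
theorem parabolic_smul_sub_mem (w : P.weylGroup) (hw : w ∈ parabolic P S) :
    ∀ m : V, (∀ i, ∃ z : ℤ, P.coroot' i m = z) → w • m - m ∈ rootLattice P S := by
  induction hw using Subgroup.closure_induction'' with
  | one => intro m _; simp
  | mem x hx =>
    obtain ⟨j, hj, rfl⟩ := hx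
    intro m hm
    obtain ⟨z, hz⟩ := hm j
    rw [ofIdx_smul_eq, hz, sub_sub_cancel_left, Int.cast_smul_eq_zsmul]
    exact neg_mem (AddSubgroup.zsmul_mem _ (AddSubgroup.subset_closure (Set.mem_image_of_mem _ hj)) z)
  | inv_mem x hx =>
    obtain ⟨j, hj, rfl⟩ := hx
    intro m hm
    obtain ⟨z, hz⟩ := hm j
    rw [ofIdx_inv, ofIdx_smul_eq, hz, sub_sub_cancel_left, Int.cast_smul_eq_zsmul]
    exact neg_mem (AddSubgroup.zsmul_mem _ (AddSubgroup.subset_closure (Set.mem_image_of_mem _ hj)) z)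
  | mul x y _ _ hx hy =>
    intro m hm
    have h1 := hx (y • m) fun i => by rw [coroot'_weylGroup_smul]; exact hm _
    rw [mul_smul]
    simpa using add_mem h1 (hy m hm)

/-- `W^S` permutes the positive roots outside `ℤS`. -/
theorem parabolic_perm (hS : S ⊆ b.support) (w : P.weylGroup) (hw : w ∈ parabolic P S) {i : ι}
    (hi : b.IsPos i) (h : P.root i ∉ rootLattice P S) :
    b.IsPos (P.weylGroupToPerm w i) ∧ P.root (P.weylGroupToPerm w i) ∉ rootLattice P S := by
  refine isPos_of_sub_mem hS hi h ?_
  rw [← weylGroup_apply_root]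
  refine parabolic_smul_sub_mem w hw _ fun j => ⟨P.pairingIn ℤ i j, ?_⟩
  rw [root_coroot'_eq_pairing, ← P.algebraMap_pairingIn ℤ]
  rfl

/-! ### The exchange condition -/

variable (P) in
/-- The product of the reflections given by a word. -/
abbrev wordProd (l : List ι) : P.weylGroup := (l.map (weylGroup.ofIdx P)).prod

theorem exists_word (w : P.weylGroup) (hw : w ∈ parabolic P S) :
    ∃ l : List ι, (∀ i ∈ l, i ∈ S) ∧ wordProd P l = w := by
  induction hw using Subgroup.closure_induction'' with
  | one => exact ⟨[], by simp, by simp [wordProd]⟩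
  | mem x hx => obtain ⟨j, hj, rfl⟩ := hx; exact ⟨[j], by simpa, by simp [wordProd]⟩
  | inv_mem x hx => obtain ⟨j, hj, rfl⟩ := hx; exact ⟨[j], by simpa, by simp [wordProd, ofIdx_inv]⟩
  | mul x y _ _ hx hy =>
    obtain ⟨l, hl, rfl⟩ := hx
    obtain ⟨l', hl', rfl⟩ := hy
    refine ⟨l ++ l', fun i hi => ?_, by simp [wordProd]⟩
    rcases List.mem_append.mp hi with h | h
    exacts [hl i h, hl' i h]

/-- Peel off the first letter `j`. If `k = j`, this is the letter to delete. Otherwise `s_j k` is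
still positive, and as `s_k s_j = s_j s_{s_j k}` the induction hypothesis applies to `s_j k` and the
rest of the word. -/
theorem exists_shorter_word (l : List ι) (hl : ∀ i ∈ l, i ∈ b.support) :
    ∀ k, b.IsPos k → ¬ b.IsPos (P.weylGroupToPerm (wordProd P l)⁻¹ k) →
      ∃ l' : List ι, (∀ i ∈ l', i ∈ b.support) ∧ l'.length + 1 = l.length ∧
        weylGroup.ofIdx P k * wordProd P l = wordProd P l' := by
  induction l with
  | nil => intro k hk h; simp [wordProd, hk] at h
  | cons j l ih =>
    intro k hk h
    have hj := hl j (by simp)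
    have hl' : ∀ i ∈ l, i ∈ b.support := fun i hi => hl i (by simp [hi])
    have hcons : wordProd P (j :: l) = weylGroup.ofIdx P j * wordProd P l := by simp [wordProd]
    rcases eq_or_ne k j with rfl | hkj
    · exact ⟨l, hl', rfl, by rw [hcons, ← mul_assoc, ofIdx_mul_self, one_mul]⟩
    · have h1 : P.weylGroupToPerm (wordProd P (j :: l))⁻¹ k =
          P.weylGroupToPerm (wordProd P l)⁻¹ (P.reflectionPerm j k) := by
        rw [hcons, mul_inv_rev, map_mul, ofIdx_inv]
        rfl
      rw [h1] at h
      obtain ⟨l', h2, h3, h4⟩ := ih hl' _ (hk.reflectionPerm hj hkj) h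
      refine ⟨j :: l', ?_, by simp [h3], ?_⟩
      · intro i hi
        rcases List.mem_cons.mp hi with rfl | hi
        exacts [hj, h2 i hi]
      · have h5 : wordProd P (j :: l') = weylGroup.ofIdx P j * wordProd P l' := by simp [wordProd]
        rw [h5, ← h4, hcons, ofIdx_reflectionPerm]
        simp only [← mul_assoc, ofIdx_mul_self, one_mul]

variable (b) in
/-- The length of an element of the Weyl group. -/
def wordLength (w : P.weylGroup) : ℕ :=
  sInf {k | ∃ l : List ι, (∀ α ∈ l, α ∈ b.support) ∧
    (l.map (weylGroup.ofIdx P)).prod = w ∧ l.length = k}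

/-- An element of maximal length maps all simple roots to negative roots. -/
theorem not_isPos_of_longest {w : P.weylGroup} (hw : w ∈ parabolic P b.support)
    (hmax : ∀ v ∈ parabolic P b.support, wordLength b v ≤ wordLength b w) {k : ι}
    (hk : k ∈ b.support) : ¬ b.IsPos (P.weylGroupToPerm w⁻¹ k) := by
  intro hpos
  have hkm : weylGroup.ofIdx P k ∈ parabolic P b.support := Subgroup.subset_closure (Set.mem_image_of_mem _ hk)
  -- If `w⁻¹` keeps `k` positive, then `v⁻¹` makes it negative, so a shortest word for `v` can be
  -- shortened to a word for `w = s_k v`. Thus `v` would be longer than `w`.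
  let v := weylGroup.ofIdx P k * w
  have hv : v ∈ parabolic P b.support := mul_mem hkm hw
  have hne : {m | ∃ l : List ι, (∀ α ∈ l, α ∈ b.support) ∧
    (l.map (weylGroup.ofIdx P)).prod = v ∧ l.length = m}.Nonempty := by
    obtain ⟨l, hl, h⟩ := exists_word v hv
    exact ⟨l.length, l, hl, h, rfl⟩
  obtain ⟨l, hl, hlv, hlen⟩ := Nat.sInf_mem hne
  have h1 : P.root (P.weylGroupToPerm v⁻¹ k) = - P.root (P.weylGroupToPerm w⁻¹ k) := by
    rw [← weylGroup_apply_root, ← weylGroup_apply_root, mul_inv_rev, mul_smul, ofIdx_inv,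
      ofIdx_smul_eq, root_coroot'_eq_pairing, pairing_same, two_smul, sub_add_cancel_left,
      smul_neg]
  have h2 : ¬ b.IsPos (P.weylGroupToPerm v⁻¹ k) := by
    rw [isPos_neg_iff h1, not_not]; exact hpos
  rw [← hlv] at h2
  obtain ⟨l', hl', h3, h4⟩ := exists_shorter_word l hl k (Base.isPos_of_mem_support hk) h2
  have h5 : wordProd P l' = w := by
    rw [← h4]
    change weylGroup.ofIdx P k * (l.map (weylGroup.ofIdx P)).prod = w
    rw [hlv, ← mul_assoc, ofIdx_mul_self, one_mul]
  have h6 : wordLength b w ≤ l'.length := Nat.sInf_le ⟨l', hl', h5, rfl⟩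
  have h7 : wordLength b v ≤ wordLength b w := hmax v hv
  have h8 : wordLength b v = l.length := hlen.symm
  omega

/-- The height is additive, so negativity passes from the simple roots to all positive roots. -/
theorem not_isPos_of_longest' {w : P.weylGroup} (hw : w ∈ parabolic P b.support)
    (hmax : ∀ v ∈ parabolic P b.support, wordLength b v ≤ wordLength b w) {k : ι}
    (hk : b.IsPos k) : ¬ b.IsPos (P.weylGroupToPerm w⁻¹ k) := by
  refine hk.induction_on_add (p := fun k => ¬ b.IsPos (P.weylGroupToPerm w⁻¹ k))
    (fun i hi => not_isPos_of_longest hw hmax hi) fun i j k h hi hj => ?_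
  have h1 : P.root (P.weylGroupToPerm w⁻¹ k) =
      P.root (P.weylGroupToPerm w⁻¹ i) + P.root (P.weylGroupToPerm w⁻¹ j) := by
    rw [← weylGroup_apply_root, ← weylGroup_apply_root, ← weylGroup_apply_root, h, smul_add]
  have h2 := not_isPos_of_longest hw hmax hj
  rw [Base.isPos_iff] at hi h2 ⊢
  rw [b.height_add h1]
  omega

/-! ### The half sum of the positive roots -/

/-- The reflection in `j` permutes `Φ` and hence fixes the sum. -/
theorem coroot'_sum_eq_zero [Fintype ι] (Φ : Finset ι) {j : ι}
    (hΦ : ∀ i ∈ Φ, P.reflectionPerm j i ∈ Φ) : P.coroot' j (∑ i ∈ Φ, P.root i) = 0 := by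
  have h1 : P.reflection j (∑ i ∈ Φ, P.root i) = ∑ i ∈ Φ, P.root i := by
    rw [map_sum]
    refine Finset.sum_bij' (fun i _ => P.reflectionPerm j i) (fun i _ => P.reflectionPerm j i)
      hΦ hΦ (fun i _ => P.reflectionPerm_self j i) (fun i _ => P.reflectionPerm_self j i) ?_
    intro i _
    rw [root_reflectionPerm]
  rw [reflection_apply, sub_eq_self] at h1
  exact (smul_eq_zero.mp h1).resolve_right (P.ne_zero j)

theorem exists_int_coroot' {m : V} (hm : ∀ j ∈ b.support, ∃ z : ℤ, P.coroot' j m = z) (i : ι) :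
    ∃ z : ℤ, P.coroot' i m = z := by
  have h1 := b.coroot_mem_span_int i
  refine Submodule.span_induction (p := fun x _ => ∃ z : ℤ, P.toLinearMap m x = z) ?_
    ⟨0, by simp⟩ ?_ ?_ h1
  · rintro _ ⟨j, hj, rfl⟩
    exact hm j hj
  · rintro x y _ _ ⟨z, hz⟩ ⟨z', hz'⟩
    exact ⟨z + z', by rw [map_add, hz, hz']; push_cast; ring⟩
  · rintro c x _ ⟨z, hz⟩
    exact ⟨c * z, by rw [map_zsmul, hz, zsmul_eq_mul]; push_cast; ring⟩

-- A simple reflection permutes the positive roots other than its own. Their sum therefore pairs to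
-- zero, and the simple root itself contributes half of `2`.
open scoped Classical in
theorem coroot'_rho [Fintype ι] {j : ι} (hj : j ∈ b.support) :
    P.coroot' j ((1 / 2 : ℂ) • ∑ i : ι with b.IsPos i, P.root i) = 1 := by
  have hmem : j ∈ Finset.univ.filter (fun i => b.IsPos i) := by
    simpa using Base.isPos_of_mem_support hj
  rw [← Finset.add_sum_erase _ _ hmem, map_smul, map_add, coroot'_sum_eq_zero,
    root_coroot'_eq_pairing, pairing_same]
  · norm_num
  · intro i hi
    rw [Finset.mem_erase, Finset.mem_filter] at hi ⊢
    refine ⟨fun e => ?_, Finset.mem_univ _, hi.2.2.reflectionPerm hj hi.1⟩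
    have h1 := congrArg P.root e
    rw [root_reflectionPerm] at h1
    have h2 := congrArg (P.reflection j) h1
    rw [reflection_same, reflection_apply_self] at h2
    exact (isPos_neg_iff h2).mp hi.2.2 (Base.isPos_of_mem_support hj)

end Roots

end CategoryO

end

noncomputable section

namespace CategoryO

/-! ### Root spaces and the Levi subalgebra -/

section LieStructure

set_option linter.unusedSectionVars false

attribute [local instance] LieRing.ofAssociativeRing

variable {g : Type u} [LieRing g] [LieAlgebra ℂ g] [FiniteDimensional ℂ g] [IsKilling ℂ g]
  {H : LieSubalgebra ℂ g} [H.IsCartanSubalgebra]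

theorem lie_mem_of_span {s t : Set g} {K : Submodule ℂ g} (h : ∀ x ∈ s, ∀ y ∈ t, ⁅x, y⁆ ∈ K)
    {x y : g} (hx : x ∈ Submodule.span ℂ s) (hy : y ∈ Submodule.span ℂ t) : ⁅x, y⁆ ∈ K := by
  induction hx using Submodule.span_induction with
  | mem x hx =>
    induction hy using Submodule.span_induction with
    | mem y hy => exact h x hx y hy
    | zero => rw [lie_zero]; exact zero_mem _
    | add y z _ _ hy hz => rw [lie_add]; exact add_mem hy hz
    | smul c y _ hy => rw [lie_smul]; exact K.smul_mem c hy
  | zero => rw [zero_lie]; exact zero_mem _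
  | add x z _ _ hx hz => rw [add_lie]; exact add_mem hx hz
  | smul c x _ hx => rw [smul_lie]; exact K.smul_mem c hx

/-- The root vectors of the roots in `A`. -/
def rootVectors (A : Set H.root) : Set g := {x | ∃ α ∈ A, x ∈ rootSpace H (α.1 : H → ℂ)}

/-- The sum of the root spaces of the roots in `A`. -/
def rootSum (A : Set H.root) : Submodule ℂ g :=
  ⨆ (α : H.root) (_ : α ∈ A), (rootSpace H (α.1 : H → ℂ)).toSubmodule

theorem rootSum_eq_span (A : Set H.root) : rootSum A = Submodule.span ℂ (rootVectors A) := by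
  refine le_antisymm (iSup₂_le fun α hα x hx => Submodule.subset_span ⟨α, hα, hx⟩)
    (Submodule.span_le.mpr ?_)
  rintro x ⟨α, hα, hx⟩
  exact le_iSup₂ (f := fun (α : H.root) (_ : α ∈ A) => (rootSpace H (α.1 : H → ℂ)).toSubmodule)
    α hα hx

theorem rootSpace_le_rootSum {A : Set H.root} {α : H.root} (hα : α ∈ A) :
    (rootSpace H (α.1 : H → ℂ)).toSubmodule ≤ rootSum A :=
  le_iSup₂ (f := fun (α : H.root) (_ : α ∈ A) => (rootSpace H (α.1 : H → ℂ)).toSubmodule) α hα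

theorem rootSum_mono {A B : Set H.root} (h : A ⊆ B) : rootSum A ≤ rootSum B :=
  iSup₂_le fun _ hα => rootSpace_le_rootSum (h hα)

theorem rootSum_union (A B : Set H.root) : rootSum (A ∪ B) = rootSum A ⊔ rootSum B := by
  refine le_antisymm (iSup₂_le fun α hα => ?_)
    (sup_le (rootSum_mono Set.subset_union_left) (rootSum_mono Set.subset_union_right))
  rcases hα with h | h
  exacts [(rootSpace_le_rootSum h).trans le_sup_left, (rootSpace_le_rootSum h).trans le_sup_right]

theorem nPos_eq_rootSum (b : (rootSystem H).Base) : nPos b = rootSum {α | b.IsPos α} := rfl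

/-- The index of the root `-α`. -/
def negRoot (α : H.root) : H.root := (rootSystem H).reflectionPerm α α

theorem root_negRoot (α : H.root) :
    (rootSystem H).root (negRoot α) = -(rootSystem H).root α := by
  rw [negRoot, RootPairing.root_reflectionPerm, RootPairing.reflection_apply_self]

theorem negRoot_negRoot (α : H.root) : negRoot (negRoot α) = α :=
  (rootSystem H).root.injective (by rw [root_negRoot, root_negRoot, neg_neg])

theorem coe_of_root_eq {α : H.root} {f : Module.Dual ℂ H} (h : (rootSystem H).root α = f) :
    (α.1 : H → ℂ) = f := by
  rw [← h]; rfl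

theorem coe_negRoot (α : H.root) : ((negRoot α).1 : H → ℂ) = -(α.1 : H → ℂ) :=
  coe_of_root_eq (root_negRoot α)

theorem isPos_negRoot (b : (rootSystem H).Base) (α : H.root) :
    b.IsPos (negRoot α) ↔ ¬ b.IsPos α := isPos_neg_iff (root_negRoot α)

/-- Brackets of root vectors. -/
theorem lie_mem_of_rootSpace {K : Submodule ℂ g} {α β : H.root} {x y : g}
    (hx : x ∈ rootSpace H (α.1 : H → ℂ)) (hy : y ∈ rootSpace H (β.1 : H → ℂ))
    (h0 : β = negRoot α → ⁅x, y⁆ ∈ K)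
    (h1 : ∀ γ : H.root, (rootSystem H).root γ = (rootSystem H).root α + (rootSystem H).root β →
      (rootSpace H (γ.1 : H → ℂ)).toSubmodule ≤ K) : ⁅x, y⁆ ∈ K := by
  have h2 : ⁅x, y⁆ ∈ rootSpace H ((α.1 : H → ℂ) + (β.1 : H → ℂ)) :=
    lie_mem_genWeightSpace_of_mem_genWeightSpace hx hy
  by_cases h3 : (rootSystem H).root α + (rootSystem H).root β = 0
  · refine h0 ((rootSystem H).root.injective ?_)
    rw [root_negRoot, eq_neg_iff_add_eq_zero, add_comm, h3]
  by_cases h4 : rootSpace H ((α.1 : H → ℂ) + (β.1 : H → ℂ)) = ⊥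
  · rw [h4, LieSubmodule.mem_bot] at h2
    rw [h2]
    exact zero_mem _
  · let γ : LieModule.Weight ℂ H g := ⟨_, h4⟩
    have hγ : γ.IsNonZero := fun h => h3 (LinearMap.ext fun t => congrFun h t)
    refine h1 ⟨γ, by simpa using hγ⟩ (LinearMap.ext fun t => rfl) h2

theorem lie_eq_of_mem_rootSpace {α : H.root} {x : g} (hx : x ∈ rootSpace H (α.1 : H → ℂ)) (t : H) :
    ⁅(t : g), x⁆ = (rootSystem H).root α t • x := lie_eq_smul_of_mem_rootSpace hx t

theorem iSupIndep_rootSpace :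
    iSupIndep fun χ : H → ℂ => (rootSpace H χ).toSubmodule := by
  rw [LieSubmodule.iSupIndep_toSubmodule]
  exact LieModule.iSupIndep_genWeightSpace ℂ H g

theorem rootSpace_zero_toSubmodule : (rootSpace H (0 : H → ℂ)).toSubmodule = H.toSubmodule := by
  rw [rootSpace_zero_eq]; rfl

theorem coe_root_ne_zero (α : H.root) : (α.1 : H → ℂ) ≠ 0 :=
  LieSubalgebra.isNonZero_coe_root α

theorem rootSum_eq_biSup (A : Set H.root) : rootSum A =
    ⨆ χ ∈ {χ : H → ℂ | ∃ α ∈ A, (α.1 : H → ℂ) = χ}, (rootSpace H χ).toSubmodule := by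
  refine le_antisymm (iSup₂_le fun α hα => ?_) (iSup₂_le ?_)
  · exact le_biSup (fun χ : H → ℂ => (rootSpace H χ).toSubmodule)
      (show (α.1 : H → ℂ) ∈ {χ : H → ℂ | ∃ α ∈ A, (α.1 : H → ℂ) = χ} from ⟨α, hα, rfl⟩)
  · rintro _ ⟨α, hα, rfl⟩
    exact rootSpace_le_rootSum hα

theorem disjoint_rootSum {A B : Set H.root} (h : Disjoint A B) :
    Disjoint (H.toSubmodule ⊔ rootSum A) (rootSum B) := by
  have h1 : H.toSubmodule ⊔ rootSum A ≤ ⨆ χ ∈ {χ : H → ℂ | χ = 0 ∨ ∃ α ∈ A, (α.1 : H → ℂ) = χ},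
      (rootSpace H χ).toSubmodule := by
    rw [rootSum_eq_biSup]
    refine sup_le ?_ (biSup_mono fun χ hχ => Or.inr hχ)
    rw [← rootSpace_zero_toSubmodule]
    exact le_biSup (fun χ : H → ℂ => (rootSpace H χ).toSubmodule) (Or.inl rfl)
  refine Disjoint.mono_left h1 ?_
  rw [rootSum_eq_biSup B]
  refine iSupIndep_rootSpace.disjoint_biSup_biSup ?_
  rw [Set.disjoint_left]
  rintro χ (rfl | ⟨α, hα, rfl⟩) ⟨β, hβ, h2⟩
  · exact coe_root_ne_zero β h2
  · have : β = α := Subtype.ext (DFunLike.coe_injective h2)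
    subst this
    exact Set.disjoint_left.mp h hα hβ

theorem cartan_sup_rootSum_univ : H.toSubmodule ⊔ rootSum (Set.univ : Set H.root) = ⊤ := by
  rw [eq_top_iff, ← LieSubmodule.top_toSubmodule (R := ℂ) (L := H),
    ← cartan_sup_iSup_rootSpace_eq_top (K := ℂ) (L := g) (H := H)]
  rw [LieSubmodule.sup_toSubmodule, LieSubmodule.iSup_toSubmodule]
  refine sup_le_sup le_rfl (iSup_le fun α => ?_)
  rw [LieSubmodule.iSup_toSubmodule]
  refine iSup_le fun hα => ?_
  exact rootSpace_le_rootSum (α := ⟨α, by simpa using hα⟩) (Set.mem_univ _)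

theorem eq_coroot_smul {α : H.root} {x y : g} (hx : x ∈ rootSpace H (α.1 : H → ℂ))
    (hy : y ∈ rootSpace H (-(α.1 : H → ℂ))) :
    ∃ c : ℂ, ⁅x, y⁆ = c • ((rootSystem H).coroot α : g) := by
  have hα : α.1.IsNonZero := LieSubalgebra.isNonZero_coe_root α
  have h1 := root_apply_cartanEquivDual_symm_ne_zero hα
  refine ⟨killingForm ℂ g x y * (2⁻¹ * α.1 ((cartanEquivDual H).symm α.1)), ?_⟩
  rw [lie_eq_killingForm_smul_of_mem_rootSpace_of_mem_rootSpace_neg hx hy, mul_smul]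
  congr 1
  have : ((cartanEquivDual H).symm α.1 : H) =
      (2⁻¹ * α.1 ((cartanEquivDual H).symm α.1)) • coroot α.1 := by
    rw [coroot, ← Nat.cast_smul_eq_nsmul ℂ, smul_smul, smul_smul]
    field_simp
    simp
  conv_lhs => rw [this]
  rfl

theorem exists_lie_eq_coroot (α : H.root) : ∃ x ∈ rootSpace H (α.1 : H → ℂ),
    ∃ y ∈ rootSpace H (-(α.1 : H → ℂ)), ⁅x, y⁆ = ((rootSystem H).coroot α : g) := by
  have hα : α.1.IsNonZero := LieSubalgebra.isNonZero_coe_root α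
  obtain ⟨h, e, f, t, he, hf⟩ := exists_isSl2Triple_of_weight_isNonZero hα
  exact ⟨e, he, f, hf, by rw [t.lie_e_f, t.h_eq_coroot hα he hf]; rfl⟩

/-- `[X_{-α}, g_β] = g_{β-α}` if `β` and `β - α` are roots. -/
theorem rootSpace_sub_le {α β γ : H.root}
    (h : (rootSystem H).root γ = (rootSystem H).root β - (rootSystem H).root α)
    {K : Submodule ℂ g} (hK : ∀ x ∈ rootSpace H (-(α.1 : H → ℂ)),
      ∀ y ∈ rootSpace H (β.1 : H → ℂ), ⁅x, y⁆ ∈ K) :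
    (rootSpace H (γ.1 : H → ℂ)).toSubmodule ≤ K := by
  have hα : α.1.IsNonZero := LieSubalgebra.isNonZero_coe_root α
  have hγ : γ.1.IsNonZero := LieSubalgebra.isNonZero_coe_root γ
  have hγ' : (γ.1 : H → ℂ) = β.1 - α.1 := coe_of_root_eq h
  -- Start at the top of the `α`-string through `β` and descend with `f`: after `m` steps the vector
  -- is in the root space of `β`, after `m + 1` steps in that of `γ`.
  obtain ⟨x, hx, x_ne0⟩ := (LieModule.chainTop α.1 β.1).exists_ne_zero
  obtain ⟨t, e, f, isSl2, he, hf⟩ := exists_isSl2Triple_of_weight_isNonZero hα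
  obtain rfl := isSl2.h_eq_coroot hα he hf
  have prim : isSl2.HasPrimitiveVectorWith x (chainLength α.1 β.1 : ℂ) :=
    have := lie_mem_genWeightSpace_of_mem_genWeightSpace he hx
    ⟨x_ne0, (chainLength_smul _ _ hx).symm, by
      rwa [LieModule.genWeightSpace_add_chainTop _ _ hα] at this⟩
  have h1 : (1 : ℤ) ≤ LieModule.chainBotCoeff α.1 β.1 := by
    refine le_chainBotCoeff_of_rootSpace_ne_top _ _ hα 1 ?_
    rw [neg_smul, one_smul, neg_add_eq_sub, ← hγ']
    exact γ.1.genWeightSpace_ne_bot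
  have h2 := chainBotCoeff_add_chainTopCoeff α.1 β.1
  set m := LieModule.chainTopCoeff α.1 β.1 with hm
  -- The string is at least `m + 1` long because `β - α` belongs to it, so `sl₂`-theory keeps the
  -- vector nonzero; it spans the one-dimensional root space of `γ`.
  have h3 : (LieModule.toEnd ℂ g g f ^ (m + 1)) x ≠ 0 :=
    prim.pow_toEnd_f_ne_zero_of_eq_nat rfl (by omega)
  have h4 := toEnd_pow_apply_mem hf hx m
  have e4 : m • -(α.1 : H → ℂ) + (LieModule.chainTop α.1 β.1 : H → ℂ) = β.1 := by
    rw [LieModule.coe_chainTop', ← hm, smul_neg, neg_add_cancel_left]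
  rw [e4] at h4
  have h5 : (LieModule.toEnd ℂ g g f ^ (m + 1)) x = ⁅f, (LieModule.toEnd ℂ g g f ^ m) x⁆ := by
    rw [pow_succ', Module.End.mul_apply, LieModule.toEnd_apply_apply]
  have h6 : (LieModule.toEnd ℂ g g f ^ (m + 1)) x ∈ rootSpace H (γ.1 : H → ℂ) := by
    rw [h5, hγ', ← neg_add_eq_sub]
    exact lie_mem_genWeightSpace_of_mem_genWeightSpace hf h4
  intro z hz
  obtain ⟨c, hc⟩ := (finrank_eq_one_iff_of_nonzero' (⟨_, h6⟩ : rootSpace H (γ.1 : H → ℂ))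
    (by simpa using h3)).mp (finrank_rootSpace_eq_one _ hγ) ⟨z, hz⟩
  have hc' : c • (LieModule.toEnd ℂ g g f ^ (m + 1)) x = z := congrArg Subtype.val hc
  rw [← hc', h5]
  exact K.smul_mem c (hK f hf _ h4)

end LieStructure

end CategoryO

end

noncomputable section

namespace CategoryO

/-! ### The Levi subalgebra: its roots, its Cartan part and the decomposition of `h` -/

section Levi

set_option linter.unusedSectionVars false

attribute [local instance] LieRing.ofAssociativeRing

variable {g : Type u} [LieRing g] [LieAlgebra ℂ g] [FiniteDimensional ℂ g] [IsKilling ℂ g]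
  {H : LieSubalgebra ℂ g} [H.IsCartanSubalgebra]

/-- The roots in `ℤS`. -/
def leviRoots (S : Set H.root) : Set H.root :=
  {α | (rootSystem H).root α ∈ rootLattice (rootSystem H) S}

/-- The span of the coroots `H_α` of the roots `α ∈ ℤS`. -/
def leviCoroots (S : Set H.root) : Submodule ℂ H :=
  Submodule.span ℂ ((rootSystem H).coroot '' leviRoots S)

theorem negRoot_mem_leviRoots {S : Set H.root} {α : H.root} (hα : α ∈ leviRoots S) :
    negRoot α ∈ leviRoots S := by
  change (rootSystem H).root (negRoot α) ∈ rootLattice (rootSystem H) S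
  rw [root_negRoot]
  exact neg_mem hα

theorem subset_leviRoots (S : Set H.root) : S ⊆ leviRoots S := fun _ hα =>
  AddSubgroup.subset_closure (Set.mem_image_of_mem _ hα)

variable {b : (rootSystem H).Base} {S : Set H.root}

/-- Induction along the addition of simple roots. If `k = i + j` lies in `ℤS` with `i` positive and
`j` simple, then `i ∈ ℤS` and `j ∈ S`, and the root spaces of `k` and `-k` are obtained as brackets
by `rootSpace_sub_le`. -/
theorem rootSpace_le_levi_of_isPos (hS : S ⊆ b.support) {α : H.root} (hpos : b.IsPos α) :
    α ∈ leviRoots S → (rootSpace H (α.1 : H → ℂ)).toSubmodule ≤ (levi S).toSubmodule ∧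
      (rootSpace H ((negRoot α).1 : H → ℂ)).toSubmodule ≤ (levi S).toSubmodule := by
  have hgen : ∀ α ∈ S, (rootSpace H (α.1 : H → ℂ)).toSubmodule ≤ (levi S).toSubmodule ∧
      (rootSpace H ((negRoot α).1 : H → ℂ)).toSubmodule ≤ (levi S).toSubmodule := by
    intro α hα
    refine ⟨fun x hx => LieSubalgebra.subset_lieSpan ⟨α, hα, Or.inl hx⟩, fun x hx =>
      LieSubalgebra.subset_lieSpan ⟨α, hα, Or.inr ?_⟩⟩
    rw [coe_negRoot] at hx
    exact hx
  -- Positivity is carried through the induction because the splitting of `k` inside `ℤS` needs `i`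
  -- to be positive.
  suffices h : b.IsPos α ∧ (α ∈ leviRoots S →
      (rootSpace H (α.1 : H → ℂ)).toSubmodule ≤ (levi S).toSubmodule ∧
      (rootSpace H ((negRoot α).1 : H → ℂ)).toSubmodule ≤ (levi S).toSubmodule) from h.2
  refine hpos.induction_on_add (p := fun α => b.IsPos α ∧ (α ∈ leviRoots S →
      (rootSpace H (α.1 : H → ℂ)).toSubmodule ≤ (levi S).toSubmodule ∧
      (rootSpace H ((negRoot α).1 : H → ℂ)).toSubmodule ≤ (levi S).toSubmodule)) ?_ ?_
  · intro i hi
    refine ⟨RootPairing.Base.isPos_of_mem_support hi, fun hm => hgen i ?_⟩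
    by_contra hiS
    have h1 := simpleCoeff_of_mem_rootLattice hS hm ⟨i, hi⟩ hiS
    classical
    rw [simpleCoeff_root b ⟨i, hi⟩ ⟨i, hi⟩, if_pos rfl] at h1
    exact one_ne_zero h1
  · rintro i j k hk ⟨hi, ih⟩ hj
    refine ⟨hi.add (RootPairing.Base.isPos_of_mem_support hj) hk, fun hm => ?_⟩
    have hm' : (rootSystem H).root i + (rootSystem H).root j ∈ rootLattice (rootSystem H) S := by
      rw [← hk]; exact hm
    obtain ⟨h1, h2⟩ := mem_of_add_mem_rootLattice hS hi hj hm'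
    obtain ⟨h3, h4⟩ := ih h1
    obtain ⟨h5, h6⟩ := hgen j h2
    constructor
    · refine rootSpace_sub_le (α := negRoot j) (β := i) ?_ fun x hx y hy => ?_
      · rw [hk, root_negRoot, sub_neg_eq_add]
      · refine (levi S).lie_mem (h5 ?_) (h3 hy)
        rwa [coe_negRoot, neg_neg] at hx
    · refine rootSpace_sub_le (α := j) (β := negRoot i) ?_ fun x hx y hy => ?_
      · rw [root_negRoot, root_negRoot, hk, neg_add, sub_eq_add_neg]
      · refine (levi S).lie_mem (h6 ?_) (h4 hy)
        rwa [← coe_negRoot] at hx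

theorem rootSpace_le_levi (hS : S ⊆ b.support) {α : H.root} (hα : α ∈ leviRoots S) :
    (rootSpace H (α.1 : H → ℂ)).toSubmodule ≤ (levi S).toSubmodule := by
  by_cases h : b.IsPos α
  · exact (rootSpace_le_levi_of_isPos hS h hα).1
  · have := (rootSpace_le_levi_of_isPos hS ((isPos_negRoot b α).mpr h)
      (negRoot_mem_leviRoots hα)).2
    rwa [negRoot_negRoot] at this

theorem coroot_mem_levi (hS : S ⊆ b.support) {α : H.root} (hα : α ∈ leviRoots S) :
    ((rootSystem H).coroot α : g) ∈ levi S := by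
  obtain ⟨x, hx, y, hy, h⟩ := exists_lie_eq_coroot α
  rw [← h]
  refine (levi S).lie_mem (rootSpace_le_levi hS hα hx)
    (rootSpace_le_levi hS (negRoot_mem_leviRoots hα) ?_)
  rw [coe_negRoot]
  exact hy

/-- The structure of the Levi subalgebra. -/
theorem levi_toSubmodule (hS : S ⊆ b.support) : (levi S).toSubmodule =
    (leviCoroots S).map H.toSubmodule.subtype ⊔ rootSum (leviRoots S) := by
  refine le_antisymm ?_ (sup_le ?_ (iSup₂_le fun α hα => rootSpace_le_levi hS hα))
  · let s : Set g := {x | ∃ α ∈ leviRoots S, x = ((rootSystem H).coroot α : g)} ∪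
      rootVectors (leviRoots S)
    have hs : (leviCoroots S).map H.toSubmodule.subtype ⊔ rootSum (leviRoots S) =
        Submodule.span ℂ s := by
      rw [Submodule.span_union, ← rootSum_eq_span, leviCoroots, Submodule.map_span]
      congr 2
      ext x
      constructor
      · rintro ⟨_, ⟨α, hα, rfl⟩, rfl⟩; exact ⟨α, hα, rfl⟩
      · rintro ⟨α, hα, rfl⟩; exact ⟨_, ⟨α, hα, rfl⟩, rfl⟩
    have key : ∀ α ∈ leviRoots S, ∀ x ∈ rootSpace H (α.1 : H → ℂ), x ∈ Submodule.span ℂ s :=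
      fun α hα x hx => Submodule.subset_span (Or.inr ⟨α, hα, hx⟩)
    -- The span of `s` is a subalgebra: opposite root vectors give multiples of a coroot, and sums
    -- of roots in `ℤS` stay in `ℤS`.
    have hlie : ∀ x ∈ s, ∀ y ∈ s, ⁅x, y⁆ ∈ Submodule.span ℂ s := by
      rintro x (⟨α, hα, rfl⟩ | ⟨α, hα, hx⟩) y (⟨β, hβ, rfl⟩ | ⟨β, hβ, hy⟩)
      · have : ⁅(rootSystem H).coroot α, (rootSystem H).coroot β⁆ = 0 := trivial_lie_zero _ _ _ _
        rw [← LieSubalgebra.coe_bracket, this]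
        exact zero_mem _
      · rw [lie_eq_of_mem_rootSpace hy]
        exact Submodule.smul_mem _ _ (key β hβ y hy)
      · rw [← lie_skew, lie_eq_of_mem_rootSpace hx]
        exact neg_mem (Submodule.smul_mem _ _ (key α hα x hx))
      · refine lie_mem_of_rootSpace hx hy ?_ ?_
        · rintro rfl
          rw [coe_negRoot] at hy
          obtain ⟨c, hc⟩ := eq_coroot_smul hx hy
          rw [hc]
          exact Submodule.smul_mem _ _ (Submodule.subset_span (Or.inl ⟨α, hα, rfl⟩))
        · intro γ hγ
          refine key γ ?_
          change (rootSystem H).root γ ∈ rootLattice (rootSystem H) S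
          rw [hγ]
          exact add_mem hα hβ
    let K : LieSubalgebra ℂ g := { Submodule.span ℂ s with
      lie_mem' := fun hx hy => lie_mem_of_span hlie hx hy }
    rw [hs]
    have : levi S ≤ K := by
      refine LieSubalgebra.lieSpan_le.mpr ?_
      rintro x ⟨α, hα, hx | hx⟩
      · exact key α (subset_leviRoots S hα) x hx
      · refine key (negRoot α) (negRoot_mem_leviRoots (subset_leviRoots S hα)) x ?_
        rw [coe_negRoot]
        exact hx
    exact this
  · rw [Submodule.map_le_iff_le_comap, leviCoroots, Submodule.span_le]
    rintro _ ⟨α, hα, rfl⟩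
    exact coroot_mem_levi hS hα

theorem map_leviCoroots_le : (leviCoroots S).map H.toSubmodule.subtype ≤ H.toSubmodule := by
  rintro _ ⟨x, _, rfl⟩
  exact x.2

/-- The Levi subalgebra is contained in `H` plus the root spaces for `ℤS`, and this sum meets every
other root space trivially. -/
theorem isLeviRoot_iff (hS : S ⊆ b.support) {α : H.root} : IsLeviRoot S α ↔ α ∈ leviRoots S := by
  refine ⟨fun h => ?_, fun h => rootSpace_le_levi hS h⟩
  by_contra hα
  have h1 : Disjoint (H.toSubmodule ⊔ rootSum (leviRoots S)) (rootSum {α}) :=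
    disjoint_rootSum (Set.disjoint_singleton_right.mpr hα)
  have h2 : (rootSpace H (α.1 : H → ℂ)).toSubmodule ≤ ⊥ := by
    refine h1 (h.trans ?_) (rootSpace_le_rootSum rfl)
    rw [levi_toSubmodule hS]
    exact sup_le_sup map_leviCoroots_le le_rfl
  refine α.1.genWeightSpace_ne_bot' (LieSubmodule.toSubmodule_injective ?_)
  exact le_bot_iff.mp h2

/-- The root spaces are independent of `H`, so an element of `a ∩ h` has no root components and
comes from the coroots alone. -/
theorem mem_leviCoroots_iff (hS : S ⊆ b.support) {t : H} :
    (t : g) ∈ levi S ↔ t ∈ leviCoroots S := by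
  constructor
  · intro h
    have h' : (t : g) ∈ (levi S).toSubmodule := h
    rw [levi_toSubmodule hS] at h'
    obtain ⟨_, ⟨s, hs, rfl⟩, r, hr, h1⟩ := Submodule.mem_sup.mp h'
    have h2 : r ∈ H.toSubmodule := by
      rw [← eq_sub_iff_add_eq'] at h1
      rw [h1]
      exact sub_mem t.2 s.2
    have h3 := (disjoint_rootSum (Set.disjoint_empty (leviRoots S)).symm).le_bot
      ⟨Submodule.mem_sup_left h2, hr⟩
    rw [Submodule.mem_bot] at h3
    rw [h3, add_zero] at h1
    have : s = t := Subtype.ext h1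
    rwa [← this]
  · intro h
    have : (t : g) ∈ (levi S).toSubmodule := by
      rw [levi_toSubmodule hS]
      exact Submodule.mem_sup_left ⟨t, h, rfl⟩
    exact this

/-! ### The orthogonal complement of the Cartan subalgebra of the Levi subalgebra -/

/-- Under the Killing form a coroot corresponds to a nonzero multiple of its root. -/
theorem killingForm_coroot_eq_zero_iff (α : H.root) (z : H) :
    killingForm ℂ g ((rootSystem H).coroot α : g) (z : g) = 0 ↔ (rootSystem H).root α z = 0 := by
  have hα : α.1.IsNonZero := LieSubalgebra.isNonZero_coe_root α
  have h1 := root_apply_cartanEquivDual_symm_ne_zero hα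
  have h2 := traceForm_coroot α.1 z
  rw [← restrict_killingForm] at h2
  have h3 : killingForm ℂ g ((rootSystem H).coroot α : g) (z : g) =
    2 • (α.1 ((cartanEquivDual H).symm α.1))⁻¹ • α.1 z := h2
  rw [h3, ← Nat.cast_smul_eq_nsmul ℂ, smul_eq_zero, smul_eq_zero]
  simp only [Nat.cast_ofNat, OfNat.ofNat_ne_zero, inv_eq_zero, false_or]
  exact or_iff_right h1

theorem mem_leviPerp_iff (hS : S ⊆ b.support) {z : H} :
    z ∈ leviPerp S ↔ ∀ α ∈ leviRoots S, (rootSystem H).root α z = 0 := by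
  constructor
  · intro h α hα
    exact (killingForm_coroot_eq_zero_iff α z).mp (h _ (coroot_mem_levi hS hα))
  · intro h y hy
    rw [mem_leviCoroots_iff hS] at hy
    induction hy using Submodule.span_induction with
    | mem y hy =>
      obtain ⟨α, hα, rfl⟩ := hy
      exact (killingForm_coroot_eq_zero_iff α z).mpr (h α hα)
    | zero => simp
    | add x y _ _ hx hy =>
      rw [show ((x + y : H) : g) = (x : g) + (y : g) from rfl, map_add, LinearMap.add_apply, hx, hy, add_zero]
    | smul c x _ hx =>
      rw [show ((c • x : H) : g) = c • (x : g) from rfl, map_smul, LinearMap.smul_apply, hx, smul_zero]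

theorem killingForm_cartan (x y : H) : killingForm ℂ g (x : g) (y : g) =
    ∑ α : H.root, (rootSystem H).root α x * (rootSystem H).root α y := by
  have h := DFunLike.congr_fun (DFunLike.congr_fun
    (restrict_killingForm_eq_sum (K := ℂ) (L := g) (H := H)) x) y
  rw [LinearMap.sum_apply, LinearMap.sum_apply, ← Finset.sum_coe_sort] at h
  exact h

/-- Roots take integral values on coroots, so conjugating the coefficients of a combination of
coroots conjugates its values under all roots. This makes a positive Hermitian form out of the
Killing form. -/
theorem exists_conj {t : H} (ht : t ∈ leviCoroots S) : ∃ t' ∈ leviCoroots S,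
    ∀ α : H.root, (rootSystem H).root α t' = star ((rootSystem H).root α t) := by
  induction ht using Submodule.span_induction with
  | mem x hx =>
    refine ⟨x, Submodule.subset_span hx, fun α => ?_⟩
    obtain ⟨β, _, rfl⟩ := hx
    have : (rootSystem H).root α ((rootSystem H).coroot β) =
        ((rootSystem H).pairingIn ℤ α β : ℂ) :=
      ((rootSystem H).algebraMap_pairingIn ℤ α β).symm
    rw [this]
    simp
  | zero => exact ⟨0, zero_mem _, fun α => by simp⟩
  | add x y _ _ hx hy =>
    obtain ⟨x', hx', h1⟩ := hx
    obtain ⟨y', hy', h2⟩ := hy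
    exact ⟨x' + y', add_mem hx' hy', fun α => by rw [map_add, map_add, h1, h2, star_add]⟩
  | smul c x _ hx =>
    obtain ⟨x', hx', h1⟩ := hx
    exact ⟨star c • x', Submodule.smul_mem _ _ hx', fun α => by
      rw [map_smul, map_smul, h1, smul_eq_mul, smul_eq_mul, star_mul']⟩

theorem eq_zero_of_forall_root {t : H} (h : ∀ α : H.root, (rootSystem H).root α t = 0) : t = 0 := by
  have h1 : ∀ f : Module.Dual ℂ H, f t = 0 := by
    intro f
    have hf : f ∈ Submodule.span ℂ (Set.range (rootSystem H).root) := by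
      rw [RootPairing.IsRootSystem.span_root_eq_top]; trivial
    induction hf using Submodule.span_induction with
    | mem x hx => obtain ⟨α, rfl⟩ := hx; exact h α
    | zero => rfl
    | add x y _ _ hx hy => rw [LinearMap.add_apply, hx, hy, add_zero]
    | smul c x _ hx => rw [LinearMap.smul_apply, hx, smul_zero]
  exact (Module.forall_dual_apply_eq_zero_iff ℂ t).mp h1

/-- The Killing form of `t` with its conjugate is the sum of `|α(t)|²` over all roots. Orthogonality
makes it zero, so all roots vanish on `t`. -/
theorem eq_zero_of_mem_leviPerp (hS : S ⊆ b.support) {t : H} (ht : t ∈ leviCoroots S)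
    (ht' : t ∈ leviPerp S) : t = 0 := by
  obtain ⟨t', ht1, h1⟩ := exists_conj ht
  have h2 := ht' t' ((mem_leviCoroots_iff hS).mpr ht1)
  rw [killingForm_cartan] at h2
  have h3 : ∑ α : H.root, (‖(rootSystem H).root α t‖ ^ 2 : ℝ) = 0 := by
    have : ((∑ α : H.root, (‖(rootSystem H).root α t‖ ^ 2 : ℝ) : ℝ) : ℂ) = 0 := by
      rw [← h2, Complex.ofReal_sum]
      refine Finset.sum_congr rfl fun α _ => ?_
      rw [h1, Complex.ofReal_pow, ← Complex.conj_mul']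
      rfl
    exact_mod_cast this
  refine eq_zero_of_forall_root fun α => ?_
  have h4 := (Finset.sum_eq_zero_iff_of_nonneg fun α _ => sq_nonneg _).mp h3 α (Finset.mem_univ α)
  simpa using h4

/-- By `eq_zero_of_mem_leviPerp` the Killing form is nondegenerate on the span of the coroots of
`ℤS`, so its orthogonal space is a complement. -/
theorem exists_add_eq (hS : S ⊆ b.support) (t : H) :
    ∃ y ∈ leviCoroots S, ∃ z ∈ leviPerp S, y + z = t := by
  let B : LinearMap.BilinForm ℂ H := (killingForm ℂ g).restrict H
  have hB : B.IsRefl := (LieModule.traceForm_isSymm ℂ H g).isRefl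
  have horth : B.orthogonal (leviCoroots S) = leviPerp S := by
    ext z
    rw [LinearMap.BilinForm.mem_orthogonal_iff]
    constructor
    · intro h y hy
      exact h y ((mem_leviCoroots_iff hS).mp hy)
    · intro h y hy
      exact h y ((mem_leviCoroots_iff hS).mpr hy)
  have h1 : IsCompl (leviCoroots S) (B.orthogonal (leviCoroots S)) := by
    rw [LinearMap.BilinForm.isCompl_orthogonal_iff_disjoint hB, horth, Submodule.disjoint_def]
    exact fun t h h' => eq_zero_of_mem_leviPerp hS h h'
  rw [horth] at h1
  have h2 : t ∈ leviCoroots S ⊔ leviPerp S := by rw [h1.sup_eq_top]; trivial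
  obtain ⟨y, hy, z, hz, h⟩ := Submodule.mem_sup.mp h2
  exact ⟨y, hy, z, hz, h⟩

end Levi

end CategoryO

end

noncomputable section

namespace CategoryO

/-! ### The nilradical and its opposite -/

section Parabolic

set_option linter.unusedSectionVars false

attribute [local instance] LieRing.ofAssociativeRing

variable {g : Type u} [LieRing g] [LieAlgebra ℂ g] [FiniteDimensional ℂ g] [IsKilling ℂ g]
  {H : LieSubalgebra ℂ g} [H.IsCartanSubalgebra]

/-- The positive roots outside `ℤS`. -/
def outPos (b : (rootSystem H).Base) (S : Set H.root) : Set H.root :=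
  {α | b.IsPos α ∧ α ∉ leviRoots S}

/-- The negative roots outside `ℤS`. -/
def outNeg (b : (rootSystem H).Base) (S : Set H.root) : Set H.root :=
  {α | ¬ b.IsPos α ∧ α ∉ leviRoots S}

variable {b : (rootSystem H).Base} {S : Set H.root}

theorem negRoot_mem_leviRoots_iff {α : H.root} : negRoot α ∈ leviRoots S ↔ α ∈ leviRoots S :=
  ⟨fun h => by have := negRoot_mem_leviRoots h; rwa [negRoot_negRoot] at this,
    negRoot_mem_leviRoots⟩

theorem mem_outNeg_iff {α : H.root} : α ∈ outNeg b S ↔ negRoot α ∈ outPos b S := by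
  change _ ∧ _ ↔ _ ∧ _
  rw [isPos_negRoot, negRoot_mem_leviRoots_iff]

theorem outPos_add_levi (hS : S ⊆ b.support) {α β γ : H.root} (hα : α ∈ leviRoots S)
    (hβ : β ∈ outPos b S)
    (h : (rootSystem H).root γ = (rootSystem H).root α + (rootSystem H).root β) :
    γ ∈ outPos b S :=
  isPos_of_sub_mem hS hβ.1 hβ.2 (by rw [h, add_sub_cancel_right]; exact hα)

theorem outNeg_add_levi (hS : S ⊆ b.support) {α β γ : H.root} (hα : α ∈ leviRoots S)
    (hβ : β ∈ outNeg b S)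
    (h : (rootSystem H).root γ = (rootSystem H).root α + (rootSystem H).root β) :
    γ ∈ outNeg b S := by
  rw [mem_outNeg_iff] at hβ ⊢
  refine outPos_add_levi hS (negRoot_mem_leviRoots hα) hβ ?_
  rw [root_negRoot, root_negRoot, root_negRoot, h, neg_add]

theorem outPos_add (hS : S ⊆ b.support) {α β γ : H.root} (hα : α ∈ outPos b S)
    (hβ : β ∈ outPos b S)
    (h : (rootSystem H).root γ = (rootSystem H).root α + (rootSystem H).root β) :
    γ ∈ outPos b S := by
  refine ⟨hα.1.add hβ.1 h, fun hγ => ?_⟩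
  obtain ⟨j, n, hj, hn, h1⟩ := exists_simpleCoeff_pos hα.1 hα.2
  obtain ⟨m, h2⟩ := exists_nat_simpleCoeff hβ.1 j
  have h3 := simpleCoeff_of_mem_rootLattice hS hγ j hj
  rw [h, map_add, h1, h2] at h3
  have : n + m = 0 := by exact_mod_cast h3
  omega

theorem leviNilradical_eq (hS : S ⊆ b.support) : leviNilradical b S = rootSum (outPos b S) := by
  have : outPos b S = {α | b.IsPos α ∧ ¬ IsLeviRoot S α} := by
    ext α
    exact and_congr_right fun _ => not_congr (isLeviRoot_iff hS).symm
  rw [this]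
  rfl

theorem cartan_lie_mem_rootSum {A : Set H.root} (t : H) {y : g} (hy : y ∈ rootSum A) :
    ⁅(t : g), y⁆ ∈ rootSum A := by
  have hs : rootSum A = Submodule.span ℂ (rootVectors A) := rootSum_eq_span A
  have hy' : y ∈ Submodule.span ℂ (rootVectors A) := hs ▸ hy
  refine lie_mem_of_span (s := {(t : g)}) ?_ (Submodule.mem_span_singleton_self _) hy'
  rintro x rfl y ⟨α, hα, hy⟩
  rw [lie_eq_of_mem_rootSpace hy]
  exact Submodule.smul_mem _ _ (rootSpace_le_rootSum hα hy)

theorem lie_mem_rootSum {A B C : Set H.root} (h0 : ∀ α ∈ A, negRoot α ∉ B)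
    (h1 : ∀ α ∈ A, ∀ β ∈ B, ∀ γ,
      (rootSystem H).root γ = (rootSystem H).root α + (rootSystem H).root β → γ ∈ C)
    {x y : g} (hx : x ∈ rootSum A) (hy : y ∈ rootSum B) : ⁅x, y⁆ ∈ rootSum C := by
  rw [rootSum_eq_span A] at hx
  rw [rootSum_eq_span B] at hy
  refine lie_mem_of_span ?_ hx hy
  rintro x ⟨α, hα, hx⟩ y ⟨β, hβ, hy⟩
  refine lie_mem_of_rootSpace hx hy (fun h => absurd hβ (h ▸ h0 α hα))
    fun γ hγ => rootSpace_le_rootSum (h1 α hα β hβ γ hγ)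

theorem levi_lie_mem_rootSum (hS : S ⊆ b.support) {A : Set H.root} (h0 : Disjoint (leviRoots S) A)
    (h1 : ∀ α ∈ leviRoots S, ∀ β ∈ A, ∀ γ,
      (rootSystem H).root γ = (rootSystem H).root α + (rootSystem H).root β → γ ∈ A)
    {x y : g} (hx : x ∈ levi S) (hy : y ∈ rootSum A) : ⁅x, y⁆ ∈ rootSum A := by
  have hx' : x ∈ (levi S).toSubmodule := hx
  rw [levi_toSubmodule hS] at hx'
  obtain ⟨_, ⟨s, hs, rfl⟩, r, hr, rfl⟩ := Submodule.mem_sup.mp hx'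
  rw [add_lie]
  exact add_mem (cartan_lie_mem_rootSum s hy) (lie_mem_rootSum
    (fun α hα h => Set.disjoint_left.mp h0 (negRoot_mem_leviRoots hα) h) h1 hr hy)

theorem disjoint_leviRoots_outPos : Disjoint (leviRoots S) (outPos b S) :=
  Set.disjoint_left.mpr fun _ h h' => h'.2 h

theorem disjoint_leviRoots_outNeg : Disjoint (leviRoots S) (outNeg b S) :=
  Set.disjoint_left.mpr fun _ h h' => h'.2 h

theorem levi_lie_mem_outPos (hS : S ⊆ b.support) {x y : g} (hx : x ∈ levi S)
    (hy : y ∈ rootSum (outPos b S)) : ⁅x, y⁆ ∈ rootSum (outPos b S) :=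
  levi_lie_mem_rootSum hS disjoint_leviRoots_outPos
    (fun _ hα _ hβ _ h => outPos_add_levi hS hα hβ h) hx hy

theorem levi_lie_mem_outNeg (hS : S ⊆ b.support) {x y : g} (hx : x ∈ levi S)
    (hy : y ∈ rootSum (outNeg b S)) : ⁅x, y⁆ ∈ rootSum (outNeg b S) :=
  levi_lie_mem_rootSum hS disjoint_leviRoots_outNeg
    (fun _ hα _ hβ _ h => outNeg_add_levi hS hα hβ h) hx hy

theorem outPos_lie_mem (hS : S ⊆ b.support) {x y : g} (hx : x ∈ rootSum (outPos b S))
    (hy : y ∈ rootSum (outPos b S)) : ⁅x, y⁆ ∈ rootSum (outPos b S) :=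
  lie_mem_rootSum (fun α hα h => (isPos_negRoot b α).mp h.1 hα.1)
    (fun _ hα _ hβ _ h => outPos_add hS hα hβ h) hx hy

/-- The roots in `ℤS` vanish on `h^⊥` and `H` is abelian, so `h^⊥` centralizes the Levi subalgebra.
-/
theorem perp_lie_levi (hS : S ⊆ b.support) {z : H} (hz : z ∈ leviPerp S) {y : g}
    (hy : y ∈ levi S) : ⁅(z : g), y⁆ = 0 := by
  have hy' : y ∈ (levi S).toSubmodule := hy
  rw [levi_toSubmodule hS, rootSum_eq_span] at hy'
  obtain ⟨_, ⟨s, hs, rfl⟩, r, hr, rfl⟩ := Submodule.mem_sup.mp hy'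
  have h1 : ⁅z, (s : H)⁆ = 0 := trivial_lie_zero H H _ _
  have h2 : ⁅(z : g), (s : g)⁆ = 0 := congrArg Subtype.val h1
  have h3 : ⁅(z : g), r⁆ ∈ (⊥ : Submodule ℂ g) := by
    refine lie_mem_of_span (s := {(z : g)}) ?_ (Submodule.mem_span_singleton_self _) hr
    rintro x rfl y ⟨α, hα, hy⟩
    rw [lie_eq_of_mem_rootSpace hy, (mem_leviPerp_iff hS).mp hz α hα, zero_smul]
    exact zero_mem _
  rw [lie_add, (Submodule.mem_bot ℂ).mp h3, add_zero]
  exact h2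

/-! ### The parabolic subalgebra -/

variable (b S) in
/-- The map `(y, z, x) ↦ y + z + x`. -/
def parabolicMap : (levi S × leviPerp S × leviNilradical b S) →ₗ[ℂ] g where
  toFun w := (w.1 : g) + ((w.2.1 : H) : g) + (w.2.2 : g)
  map_add' v w := by
    change ((v.1 : g) + (w.1 : g)) + (((v.2.1 : H) : g) + ((w.2.1 : H) : g)) +
      ((v.2.2 : g) + (w.2.2 : g)) = _
    abel
  map_smul' c w := by
    change c • (w.1 : g) + c • ((w.2.1 : H) : g) + c • (w.2.2 : g) = _
    rw [← smul_add, ← smul_add]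
    rfl

theorem levi_le (hS : S ⊆ b.support) :
    (levi S).toSubmodule ≤ H.toSubmodule ⊔ rootSum (leviRoots S) := by
  rw [levi_toSubmodule hS]
  exact sup_le_sup map_leviCoroots_le le_rfl

theorem parabolicMap_injective (hS : S ⊆ b.support) : Function.Injective (parabolicMap b S) := by
  rw [← LinearMap.ker_eq_bot, LinearMap.ker_eq_bot']
  rintro ⟨y, z, x⟩ h
  have h' : (y : g) + ((z : H) : g) + (x : g) = 0 := h
  have hx : (x : g) ∈ rootSum (outPos b S) := leviNilradical_eq hS ▸ x.2
  have hyz : (y : g) + ((z : H) : g) ∈ H.toSubmodule ⊔ rootSum (leviRoots S) :=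
    add_mem (levi_le hS y.2) (Submodule.mem_sup_left z.1.2)
  have hx0 : (x : g) = 0 := by
    rw [← Submodule.mem_bot ℂ]
    refine (disjoint_rootSum disjoint_leviRoots_outPos).le_bot ⟨?_, hx⟩
    rw [eq_neg_of_add_eq_zero_right h']
    exact neg_mem hyz
  rw [hx0, add_zero] at h'
  have hz : ((z : H) : g) ∈ levi S := by
    rw [eq_neg_of_add_eq_zero_right h']
    exact neg_mem y.2
  have hz0 : (z : H) = 0 := eq_zero_of_mem_leviPerp hS ((mem_leviCoroots_iff hS).mp hz) z.2
  rw [hz0] at h'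
  have hy0 : (y : g) = 0 := by simpa using h'
  exact Prod.ext (Subtype.ext hy0) (Prod.ext (Subtype.ext hz0) (Subtype.ext hx0))

/-- `a` commutes with `h^⊥`, and every bracket that involves the nilradical stays in it. So only the
Levi components contribute outside the nilradical, which is why `parabolicChar` respects brackets.
-/
theorem parabolicMap_lie (hS : S ⊆ b.support) (v w : levi S × leviPerp S × leviNilradical b S) :
    ∃ x : leviNilradical b S, ⁅parabolicMap b S v, parabolicMap b S w⁆ =
      parabolicMap b S (⁅v.1, w.1⁆, 0, x) := by
  obtain ⟨y, z, x⟩ := v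
  obtain ⟨y', z', x'⟩ := w
  have hx : (x : g) ∈ rootSum (outPos b S) := leviNilradical_eq hS ▸ x.2
  have hx' : (x' : g) ∈ rootSum (outPos b S) := leviNilradical_eq hS ▸ x'.2
  have h1 := perp_lie_levi hS z.2 y'.2
  have h2 := perp_lie_levi hS z'.2 y.2
  have h3 : ⁅((z : H) : g), ((z' : H) : g)⁆ = 0 := by
    have h3 : ⁅(z : H), (z' : H)⁆ = 0 := trivial_lie_zero _ _ _ _
    rw [← LieSubalgebra.coe_bracket, h3]; rfl
  have h4 := levi_lie_mem_outPos hS y.2 hx'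
  have h5 := levi_lie_mem_outPos hS y'.2 hx
  have h6 := cartan_lie_mem_rootSum (z : H) hx'
  have h7 := cartan_lie_mem_rootSum (z' : H) hx
  have h8 := outPos_lie_mem hS hx hx'
  refine ⟨⟨⁅(y : g), (x' : g)⁆ - ⁅(y' : g), (x : g)⁆ + ⁅((z : H) : g), (x' : g)⁆
    - ⁅((z' : H) : g), (x : g)⁆ + ⁅(x : g), (x' : g)⁆, ?_⟩, ?_⟩
  · exact (leviNilradical_eq hS).ge (add_mem (sub_mem (add_mem (sub_mem h4 h5) h6) h7) h8)
  · change ⁅(y : g) + ((z : H) : g) + (x : g), (y' : g) + ((z' : H) : g) + (x' : g)⁆ =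
      ⁅(y : g), (y' : g)⁆ + ((0 : H) : g) + (_ : g)
    simp only [add_lie, lie_add]
    rw [h1, h3, ← lie_skew (y : g) ((z' : H) : g), h2, ← lie_skew (x : g) (y' : g),
      ← lie_skew (x : g) ((z' : H) : g)]
    simp only [ZeroMemClass.coe_zero]
    abel

variable (b) in
/-- The parabolic subalgebra `p = a + h + n₊`. -/
def parabolicSubalgebra (hS : S ⊆ b.support) : LieSubalgebra ℂ g :=
  { LinearMap.range (parabolicMap b S) with
    lie_mem' := by
      rintro _ _ ⟨v, rfl⟩ ⟨w, rfl⟩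
      obtain ⟨x, hx⟩ := parabolicMap_lie hS v w
      exact ⟨_, hx.symm⟩ }

variable (b) in
/-- `levi × leviPerp × leviNilradical ≃ p`. -/
def parabolicEquiv (hS : S ⊆ b.support) :
    (levi S × leviPerp S × leviNilradical b S) ≃ₗ[ℂ] parabolicSubalgebra b hS :=
  LinearEquiv.ofInjective (parabolicMap b S) (parabolicMap_injective hS)

variable (b) in
/-- The homomorphism from `p` to `U(a)` that is the inclusion on `a`, `ν` on `h^⊥` and zero on the
nilradical. -/
def parabolicChar (hS : S ⊆ b.support) (ν : Module.Dual ℂ H) :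
    parabolicSubalgebra b hS →ₗ⁅ℂ⁆ U (levi S) where
  toFun w := toU ((parabolicEquiv b hS).symm w).1 +
    algebraMap ℂ (U (levi S)) (ν ((parabolicEquiv b hS).symm w).2.1)
  map_add' v w := by
    rw [map_add, Prod.fst_add, Prod.snd_add, Prod.fst_add, toU_add, Submodule.coe_add, map_add,
      map_add]
    abel
  map_smul' c w := by
    rw [map_smul, Prod.smul_fst, Prod.smul_snd, Prod.smul_fst, toU_smul, Submodule.coe_smul,
      map_smul, smul_eq_mul, map_mul, RingHom.id_apply, smul_add, Algebra.smul_def c (algebraMap _ _ _)]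
  map_lie' := by
    intro v w
    obtain ⟨v, rfl⟩ := (parabolicEquiv b hS).surjective v
    obtain ⟨w, rfl⟩ := (parabolicEquiv b hS).surjective w
    obtain ⟨x, hx⟩ := parabolicMap_lie hS v w
    have h1 : ⁅parabolicEquiv b hS v, parabolicEquiv b hS w⁆ =
        parabolicEquiv b hS (⁅v.1, w.1⁆, 0, x) := Subtype.ext hx
    rw [h1]
    simp only [LinearEquiv.symm_apply_apply]
    rw [ZeroMemClass.coe_zero, map_zero, map_zero, add_zero, toU_lie,
      LieRing.of_associative_ring_bracket, add_mul, mul_add, mul_add, add_mul, mul_add, mul_add,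
      Algebra.commutes (ν w.2.1) (toU v.1), Algebra.commutes (ν v.2.1) (toU w.1),
      Algebra.commutes (ν w.2.1) (algebraMap ℂ (U (levi S)) (ν v.2.1))]
    abel

theorem parabolicChar_apply (hS : S ⊆ b.support) (ν : Module.Dual ℂ H) (w) :
    parabolicChar b hS ν (parabolicEquiv b hS w) =
      toU w.1 + algebraMap ℂ (U (levi S)) (ν w.2.1) := by
  change toU ((parabolicEquiv b hS).symm (parabolicEquiv b hS w)).1 + _ = _
  rw [LinearEquiv.symm_apply_apply]

theorem cartan_le_parabolic (hS : S ⊆ b.support) :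
    H.toSubmodule ≤ (parabolicSubalgebra b hS).toSubmodule := by
  intro t ht
  obtain ⟨y, hy, z, hz, h⟩ := exists_add_eq hS (⟨t, ht⟩ : H)
  refine ⟨(⟨y, (mem_leviCoroots_iff hS).mpr hy⟩, ⟨z, hz⟩, 0), ?_⟩
  change (y : g) + (z : g) + (0 : g) = t
  rw [add_zero]
  exact congrArg Subtype.val h

theorem levi_le_parabolic (hS : S ⊆ b.support) :
    (levi S).toSubmodule ≤ (parabolicSubalgebra b hS).toSubmodule := by
  intro y hy
  refine ⟨(⟨y, hy⟩, 0, 0), ?_⟩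
  change y + ((0 : H) : g) + (0 : g) = y
  simp

theorem outPos_le_parabolic (hS : S ⊆ b.support) :
    rootSum (outPos b S) ≤ (parabolicSubalgebra b hS).toSubmodule := by
  intro y hy
  refine ⟨(0, 0, ⟨y, (leviNilradical_eq hS).symm ▸ hy⟩), ?_⟩
  change (0 : g) + ((0 : H) : g) + y = y
  simp

theorem isCompl_parabolic (hS : S ⊆ b.support) :
    IsCompl (rootSum (outNeg b S)) (parabolicSubalgebra b hS).toSubmodule := by
  constructor
  · have h1 : (parabolicSubalgebra b hS).toSubmodule ≤
        H.toSubmodule ⊔ rootSum (leviRoots S ∪ outPos b S) := by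
      rintro _ ⟨⟨y, z, x⟩, rfl⟩
      rw [rootSum_union, ← sup_assoc]
      exact add_mem (Submodule.mem_sup_left (add_mem (levi_le hS y.2)
        (Submodule.mem_sup_left z.1.2))) (Submodule.mem_sup_right (leviNilradical_eq hS ▸ x.2))
    refine (Disjoint.mono_left h1 (disjoint_rootSum ?_)).symm
    rw [Set.disjoint_union_left]
    exact ⟨disjoint_leviRoots_outNeg, Set.disjoint_left.mpr fun _ h h' => h'.1 h.1⟩
  · rw [codisjoint_iff, eq_top_iff, ← cartan_sup_rootSum_univ (H := H)]
    refine sup_le ((cartan_le_parabolic hS).trans le_sup_right) (iSup₂_le fun α _ => ?_)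
    by_cases h : α ∈ leviRoots S
    · exact ((rootSpace_le_levi hS h).trans (levi_le_parabolic hS)).trans le_sup_right
    by_cases h' : b.IsPos α
    · exact ((rootSpace_le_rootSum (A := outPos b S) ⟨h', h⟩).trans
        (outPos_le_parabolic hS)).trans le_sup_right
    · exact (rootSpace_le_rootSum (A := outNeg b S) ⟨h', h⟩).trans le_sup_left

/-! ### Triangular decompositions -/

-- The element is the one on which all simple roots take the value `1`; roots then take their height
-- as value.
variable (b) in
theorem exists_height : ∃ δ : H, ∀ α : H.root, b.IsPos α →
    ∃ k : ℕ, 0 < k ∧ (rootSystem H).root α δ = k := by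
  let f : Module.Dual ℂ (Module.Dual ℂ H) := b.toWeightBasis.constr ℂ fun _ => (1 : ℂ)
  obtain ⟨δ, hδ⟩ := (Module.evalEquiv ℂ H).surjective f
  have h1 : ∀ m, m δ = f m := fun m => by rw [← hδ]; rfl
  refine ⟨δ, fun α hα => ?_⟩
  have hs : ∀ j ∈ b.support, (rootSystem H).root j δ = 1 := by
    intro j hj
    have := b.toWeightBasis.constr_basis ℂ (fun _ => (1 : ℂ)) ⟨j, hj⟩
    rw [RootPairing.Base.toWeightBasis_apply] at this
    rw [h1]
    exact this
  refine hα.induction_on_add (p := fun α => ∃ k : ℕ, 0 < k ∧ (rootSystem H).root α δ = k)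
    (fun j hj => ⟨1, one_pos, by rw [hs j hj, Nat.cast_one]⟩) ?_
  rintro i j k h ⟨m, hm, h2⟩ hj
  exact ⟨m + 1, by omega, by rw [h, LinearMap.add_apply, h2, hs j hj]; push_cast; rfl⟩

variable (b) in
theorem exists_isTriangular : ∃ δ : H, (∀ α : H.root, b.IsPos α →
    ∃ k : ℕ, 0 < k ∧ (rootSystem H).root α δ = k) ∧
    IsTriangular H (nPos b) (rootSum {α | ¬ b.IsPos α}) δ := by
  obtain ⟨δ, hδ⟩ := exists_height b
  refine ⟨δ, hδ, ?_, ?_, ?_⟩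
  · rw [nPos_eq_rootSum, sup_left_comm, ← rootSum_union,
      show {α | ¬ b.IsPos α} ∪ {α | b.IsPos α} = Set.univ from
        Set.eq_univ_of_forall fun α => (em (b.IsPos α)).symm]
    exact cartan_sup_rootSum_univ
  · rw [nPos_eq_rootSum]
    conv_lhs => rw [rootSum_eq_span]
    refine Submodule.span_mono ?_
    rintro x ⟨α, hα, hx⟩
    obtain ⟨k, hk, h⟩ := hδ α hα
    exact ⟨rootSpace_le_rootSum hα hx, _, k, hk, h, lie_eq_of_mem_rootSpace hx⟩
  · rw [rootSum_eq_span]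
    refine Submodule.span_mono ?_
    rintro x ⟨α, hα, hx⟩
    obtain ⟨k, hk, h⟩ := hδ (negRoot α) ((isPos_negRoot b α).mpr hα)
    refine ⟨_, k, hk, ?_, lie_eq_of_mem_rootSpace hx⟩
    rw [root_negRoot, LinearMap.neg_apply] at h
    rw [← h, neg_neg]

theorem rootSum_eq_map (hS : S ⊆ b.support) {A : Set H.root} (hA : A ⊆ leviRoots S) :
    rootSum A = (Submodule.span ℂ {x : levi S | ∃ α ∈ A, (x : g) ∈ rootSpace H (α.1 : H → ℂ)}).map
      (levi S).toSubmodule.subtype := by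
  rw [Submodule.map_span, rootSum_eq_span]
  congr 1
  ext x
  constructor
  · rintro ⟨α, hα, hx⟩
    exact ⟨⟨x, rootSpace_le_levi hS (hA hα) hx⟩, ⟨α, hα, hx⟩, rfl⟩
  · rintro ⟨x, ⟨α, hα, hx⟩, rfl⟩
    exact ⟨α, hα, hx⟩

theorem mem_span_of_coe_mem (hS : S ⊆ b.support) {A : Set H.root} (hA : A ⊆ leviRoots S)
    {x : levi S} (hx : (x : g) ∈ rootSum A) :
    x ∈ Submodule.span ℂ {x : levi S | ∃ α ∈ A, (x : g) ∈ rootSpace H (α.1 : H → ℂ)} := by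
  rw [rootSum_eq_map hS hA] at hx
  obtain ⟨y, hy, h⟩ := hx
  have : y = x := Subtype.ext h
  exact this ▸ hy

/-- Subtract from `x` its components at the positive Levi roots. The remainder lies in `n₊` and also
in `H` plus negative root spaces, so it is zero. -/
theorem coe_mem_of_mem_leviNPos (hS : S ⊆ b.support) {x : levi S} (hx : x ∈ leviNPos b S) :
    (x : g) ∈ rootSum (leviRoots S ∩ {α | b.IsPos α}) := by
  have hx1 : (x : g) ∈ rootSum {α | b.IsPos α} := hx
  have hx2 := levi_le hS x.2
  rw [← Set.inter_union_compl (leviRoots S) {α | b.IsPos α}, rootSum_union,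
    sup_comm (rootSum _), ← sup_assoc] at hx2
  obtain ⟨r, hr, s, hs, h⟩ := Submodule.mem_sup.mp hx2
  have h1 : r = 0 := by
    rw [← Submodule.mem_bot ℂ]
    refine (disjoint_rootSum (B := {α | b.IsPos α}) ?_).le_bot ⟨hr, ?_⟩
    · exact Set.disjoint_left.mpr fun α h h' => h.2 h'
    · rw [eq_sub_of_add_eq h]
      exact sub_mem hx1 (rootSum_mono Set.inter_subset_right hs)
  rw [← h, h1, zero_add]
  exact hs

/-- The element of `a ∩ h` given by an element of `h` that belongs to `a`. -/
def toLeviCartan (t : H) (ht : (t : g) ∈ levi S) : leviCartan S := ⟨⟨t, ht⟩, t.2⟩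

theorem restrictWeight_apply (μ : Module.Dual ℂ H) (t : leviCartan S) :
    restrictWeight S μ t = μ ⟨((t : levi S) : g), t.2⟩ := rfl

theorem leviCartan_lie {α : H.root} {x : levi S} (hx : (x : g) ∈ rootSpace H (α.1 : H → ℂ))
    (t : leviCartan S) : ⁅(t : levi S), x⁆ = restrictWeight S ((rootSystem H).root α) t • x :=
  Subtype.ext (lie_eq_of_mem_rootSpace hx ⟨((t : levi S) : g), t.2⟩)

/-- The height element of `h` need not lie in `a`. Its component in `a ∩ h` serves instead, since
the roots of `a` do not see the component in `h^⊥`. -/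
theorem exists_isTriangular_levi (hS : S ⊆ b.support) :
    ∃ (nm : Submodule ℂ (levi S)) (δ : leviCartan S),
      IsTriangular (leviCartan S) (leviNPos b S) nm δ := by
  obtain ⟨δ₀, hδ₀⟩ := exists_height b
  obtain ⟨y, hy, z, hz, hyz⟩ := exists_add_eq hS δ₀
  have hy' : (y : g) ∈ levi S := (mem_leviCoroots_iff hS).mpr hy
  let δ : leviCartan S := toLeviCartan y hy'
  have hδ : ∀ α ∈ leviRoots S, restrictWeight S ((rootSystem H).root α) δ =
      (rootSystem H).root α δ₀ := by
    intro α hα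
    rw [← hyz, map_add, (mem_leviPerp_iff hS).mp hz α hα, add_zero]
    rfl
  refine ⟨Submodule.span ℂ {x : levi S | ∃ α ∈ leviRoots S ∩ {α | b.IsPos α}ᶜ,
    (x : g) ∈ rootSpace H (α.1 : H → ℂ)}, δ, ?_, ?_, ?_⟩
  · refine eq_top_iff.mpr fun x _ => ?_
    have hx : (x : g) ∈ (levi S).toSubmodule := x.2
    rw [levi_toSubmodule hS, ← Set.inter_union_compl (leviRoots S) {α | b.IsPos α},
      rootSum_union] at hx
    obtain ⟨_, ⟨s, hs, rfl⟩, w, hw, h⟩ := Submodule.mem_sup.mp hx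
    obtain ⟨p, hp, q, hq, rfl⟩ := Submodule.mem_sup.mp hw
    have hsl : (s : g) ∈ levi S := (mem_leviCoroots_iff hS).mpr hs
    have hpl : p ∈ levi S := iSup₂_le (fun α hα => rootSpace_le_levi hS hα.1) hp
    have hql : q ∈ levi S := iSup₂_le (fun α hα => rootSpace_le_levi hS hα.1) hq
    have hxe : x = ⟨q, hql⟩ + (⟨s, hsl⟩ + ⟨p, hpl⟩) := by
      refine Subtype.ext ?_
      change (x : g) = q + ((s : g) + p)
      rw [← h, add_comm q, add_assoc]
      rfl
    rw [hxe]
    refine Submodule.add_mem_sup (mem_span_of_coe_mem hS Set.inter_subset_left hq)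
      (Submodule.add_mem_sup s.2 ?_)
    exact rootSum_mono Set.inter_subset_right hp
  · intro x hx
    refine Submodule.span_mono ?_ (mem_span_of_coe_mem hS Set.inter_subset_left
      (coe_mem_of_mem_leviNPos hS hx))
    rintro x ⟨α, hα, hx⟩
    obtain ⟨k, hk, h⟩ := hδ₀ α hα.2
    exact ⟨rootSpace_le_rootSum hα.2 hx, _, k, hk, by rw [hδ α hα.1, h], leviCartan_lie hx⟩
  · refine Submodule.span_mono ?_
    rintro x ⟨α, hα, hx⟩
    obtain ⟨k, hk, h⟩ := hδ₀ (negRoot α) ((isPos_negRoot b α).mpr hα.2)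
    refine ⟨_, k, hk, ?_, leviCartan_lie hx⟩
    rw [root_negRoot, LinearMap.neg_apply] at h
    rw [hδ α hα.1, ← h, neg_neg]

/-- `n₊` is the sum of `a ∩ n₊` and the nilradical of `p`. -/
theorem mem_nPos_cases (hS : S ⊆ b.support) {x : g} (hx : x ∈ nPos b) :
    ∃ y ∈ leviNPos b S, ∃ z ∈ rootSum (outPos b S), x = (y : g) + z := by
  rw [nPos_eq_rootSum, ← Set.inter_union_compl {α | b.IsPos α} (leviRoots S), rootSum_union] at hx
  obtain ⟨p, hp, q, hq, rfl⟩ := Submodule.mem_sup.mp hx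
  have hpl : p ∈ levi S := iSup₂_le (fun α hα => rootSpace_le_levi hS hα.2) hp
  exact ⟨⟨p, hpl⟩, rootSum_mono Set.inter_subset_left hp, q, hq, rfl⟩

-- The adjoint representation is faithful and factors through `U(g)`. This supplies the injectivity
-- hypothesis of `exists_right_retraction`.
variable (g) in
theorem toU_injective : Function.Injective (toU : g → U g) := by
  have h1 : (ad ℂ g).ker = ⊥ := ad_ker_eq_bot_of_hasTrivialRadical ℂ g
  intro x y hxy
  have h2 : UniversalEnvelopingAlgebra.lift ℂ (ad ℂ g) (toU x) =
    UniversalEnvelopingAlgebra.lift ℂ (ad ℂ g) (toU y) := congrArg _ hxy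
  rw [UniversalEnvelopingAlgebra.lift_ι_apply, UniversalEnvelopingAlgebra.lift_ι_apply] at h2
  rw [LieHom.ker_eq_bot] at h1
  exact h1 h2

end Parabolic

end CategoryO

end

noncomputable section

namespace CategoryO

/-! ### Weights -/

section Weights

set_option linter.unusedSectionVars false

attribute [local instance] LieRing.ofAssociativeRing

variable {g : Type u} [LieRing g] [LieAlgebra ℂ g] [FiniteDimensional ℂ g] [IsKilling ℂ g]
  {H : LieSubalgebra ℂ g} [H.IsCartanSubalgebra]

/-- The bilinear form on the dual of `H` given by the Killing form. -/
def cartanForm (μ κ : Module.Dual ℂ H) : ℂ := μ ((cartanEquivDual H).symm κ)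

theorem cartanForm_add_left (μ μ' κ : Module.Dual ℂ H) :
    cartanForm (μ + μ') κ = cartanForm μ κ + cartanForm μ' κ := rfl

theorem cartanForm_sub_left (μ μ' κ : Module.Dual ℂ H) :
    cartanForm (μ - μ') κ = cartanForm μ κ - cartanForm μ' κ := rfl

theorem cartanForm_neg_left (μ κ : Module.Dual ℂ H) :
    cartanForm (-μ) κ = - cartanForm μ κ := rfl

theorem cartanForm_smul_left (c : ℂ) (μ κ : Module.Dual ℂ H) :
    cartanForm (c • μ) κ = c * cartanForm μ κ := rfl

theorem cartanForm_eq_killingForm (μ κ : Module.Dual ℂ H) : cartanForm μ κ =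
    killingForm ℂ g ((cartanEquivDual H).symm μ : g) ((cartanEquivDual H).symm κ : g) := by
  conv_lhs => rw [cartanForm, ← (cartanEquivDual H).apply_symm_apply μ]
  rfl

theorem cartanForm_comm (μ κ : Module.Dual ℂ H) : cartanForm μ κ = cartanForm κ μ := by
  rw [cartanForm_eq_killingForm, cartanForm_eq_killingForm, LieModule.traceForm_comm]

theorem cartanForm_add_right (μ κ κ' : Module.Dual ℂ H) :
    cartanForm μ (κ + κ') = cartanForm μ κ + cartanForm μ κ' := by
  rw [cartanForm, map_add, map_add]; rfl

theorem cartanForm_sub_right (μ κ κ' : Module.Dual ℂ H) :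
    cartanForm μ (κ - κ') = cartanForm μ κ - cartanForm μ κ' := by
  rw [cartanForm, map_sub, map_sub]; rfl

theorem cartanForm_neg_right (μ κ : Module.Dual ℂ H) :
    cartanForm μ (-κ) = - cartanForm μ κ := by
  rw [cartanForm, map_neg, map_neg]; rfl

theorem cartanForm_smul_right (c : ℂ) (μ κ : Module.Dual ℂ H) :
    cartanForm μ (c • κ) = c * cartanForm μ κ := by
  rw [cartanForm, map_smul, map_smul]; rfl

/-- The factor is `(β, β) / 2`. It is positive because the Killing form of `H_β` with itself is a
sum of squares of integers, not all zero, and equals `4 / (β, β)`. -/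
theorem exists_root_form (β : H.root) : ∃ r : ℝ, 0 < r ∧ ∀ m : Module.Dual ℂ H,
    cartanForm m ((rootSystem H).root β) = r * m ((rootSystem H).coroot β) := by
  have hβ : β.1.IsNonZero := LieSubalgebra.isNonZero_coe_root β
  have h1 := root_apply_cartanEquivDual_symm_ne_zero hβ
  set s : ℂ := β.1 ((cartanEquivDual H).symm β.1) with hs
  have h2 : killingForm ℂ g ((rootSystem H).coroot β : g) ((rootSystem H).coroot β : g) =
      2 • s⁻¹ • β.1 (coroot β.1) := traceForm_coroot β.1 (coroot β.1)
  rw [killingForm_cartan, root_apply_coroot hβ] at h2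
  have h3 : ∀ α : H.root, (rootSystem H).root α ((rootSystem H).coroot β) =
      (((rootSystem H).pairingIn ℤ α β : ℝ) : ℂ) := fun α => by
    rw [Complex.ofReal_intCast]
    exact ((rootSystem H).algebraMap_pairingIn ℤ α β).symm
  let N : ℝ := ∑ α : H.root, ((rootSystem H).pairingIn ℤ α β : ℝ) * (rootSystem H).pairingIn ℤ α β
  have hN : 0 < N := by
    refine Finset.sum_pos' (fun α _ => mul_self_nonneg _) ⟨β, Finset.mem_univ _, ?_⟩
    rw [RootPairing.pairingIn_same]
    norm_num
  have h4 : (N : ℂ) = 4 * s⁻¹ := by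
    have h5 : (N : ℂ) = ∑ α : H.root, (rootSystem H).root α ((rootSystem H).coroot β) *
        (rootSystem H).root α ((rootSystem H).coroot β) := by
      simp only [N, h3]
      push_cast
      rfl
    rw [h5, h2, nsmul_eq_mul, smul_eq_mul]
    push_cast
    ring
  have hN' : (N : ℂ) ≠ 0 := by exact_mod_cast hN.ne'
  have h6 : s = 4 / N := by rw [h4]; field_simp
  refine ⟨2 / N, by positivity, fun m => ?_⟩
  have h7 : ((rootSystem H).coroot β : H) = (2 * s⁻¹) • (cartanEquivDual H).symm β.1 := by
    change coroot β.1 = _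
    rw [coroot, ← Nat.cast_smul_eq_nsmul ℂ, smul_smul]
    norm_num
    rfl
  rw [h7, map_smul, smul_eq_mul, ← mul_assoc]
  have h8 : ((2 / N : ℝ) : ℂ) * (2 * s⁻¹) = 1 := by
    rw [h6]
    push_cast
    field_simp
    norm_num
  rw [h8, one_mul]
  rfl

theorem cartanForm_weylGroup (w : (rootSystem H).weylGroup) :
    ∀ μ κ : Module.Dual ℂ H, cartanForm (w • μ) (w • κ) = cartanForm μ κ := by
  obtain ⟨w, hw⟩ := w
  induction hw using RootPairing.weylGroup.induction with
  | mem j =>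
    intro μ κ
    have h1 : ∀ m : Module.Dual ℂ H, (⟨RootPairing.Equiv.reflection (rootSystem H) j,
        (rootSystem H).reflection_mem_weylGroup j⟩ : (rootSystem H).weylGroup) • m =
        m - m ((rootSystem H).coroot j) • (rootSystem H).root j := fun m => ofIdx_smul_eq j m
    obtain ⟨r, hr, h2⟩ := exists_root_form j
    have h3 : (rootSystem H).root j ((rootSystem H).coroot j) = 2 :=
      root_apply_coroot (LieSubalgebra.isNonZero_coe_root j)
    rw [h1, h1]
    simp only [cartanForm_sub_left, cartanForm_sub_right, cartanForm_smul_left,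
      cartanForm_smul_right, h2, h3, LinearMap.sub_apply, LinearMap.smul_apply, smul_eq_mul]
    rw [cartanForm_comm ((rootSystem H).root j) κ, h2]
    ring
  | one => intro μ κ; rfl
  | mul x y hx hy ihx ihy =>
    intro μ κ
    have e : (⟨x * y, mul_mem hx hy⟩ : (rootSystem H).weylGroup) = ⟨x, hx⟩ * ⟨y, hy⟩ := rfl
    rw [e, mul_smul, mul_smul, ihx, ihy]

theorem exists_real_cartanForm_root (α : H.root) {γ : Module.Dual ℂ H}
    (hγ : γ ∈ AddSubgroup.closure (Set.range (rootSystem H).root)) :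
    ∃ r : ℝ, cartanForm ((rootSystem H).root α) γ = r := by
  induction hγ using AddSubgroup.closure_induction with
  | mem x hx =>
    obtain ⟨β, rfl⟩ := hx
    obtain ⟨r, -, h⟩ := exists_root_form β
    refine ⟨r * (rootSystem H).pairingIn ℤ α β, ?_⟩
    rw [h, Complex.ofReal_mul, Complex.ofReal_intCast]
    congr 1
    exact ((rootSystem H).algebraMap_pairingIn ℤ α β).symm
  | zero => exact ⟨0, by simp [cartanForm]⟩
  | add x y _ _ hx hy =>
    obtain ⟨r, hr⟩ := hx
    obtain ⟨s, hs⟩ := hy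
    exact ⟨r + s, by rw [cartanForm_add_right, hr, hs, Complex.ofReal_add]⟩
  | neg x _ hx =>
    obtain ⟨r, hr⟩ := hx
    exact ⟨-r, by rw [cartanForm_neg_right, hr, Complex.ofReal_neg]⟩

/-- The form is `∑ (α, γ)²` over all roots `α`, and the numbers `(α, γ)` are real for `γ` in the
root lattice. -/
theorem exists_nonneg_cartanForm {γ : Module.Dual ℂ H}
    (hγ : γ ∈ AddSubgroup.closure (Set.range (rootSystem H).root)) :
    ∃ r : ℝ, 0 ≤ r ∧ cartanForm γ γ = r := by
  choose r hr using fun α : H.root => exists_real_cartanForm_root α hγ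
  refine ⟨∑ α, r α * r α, Finset.sum_nonneg fun α _ => mul_self_nonneg _, ?_⟩
  rw [cartanForm_eq_killingForm, killingForm_cartan, Complex.ofReal_sum]
  refine Finset.sum_congr rfl fun α _ => ?_
  rw [Complex.ofReal_mul, ← hr]
  rfl

variable (b : (rootSystem H).Base)

open scoped Classical in
/-- The scalar by which the Casimir element acts on highest weight vectors of weight `κ`. -/
def casimirScalar (κ : Module.Dual ℂ H) : ℂ :=
  cartanForm κ κ + ∑ α : H.root with b.IsPos α, cartanForm κ ((rootSystem H).root α)

theorem cartanForm_sum_right (s : Finset H.root) (κ : Module.Dual ℂ H) :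
    cartanForm κ (∑ α ∈ s, (rootSystem H).root α) =
      ∑ α ∈ s, cartanForm κ ((rootSystem H).root α) := by
  rw [cartanForm, map_sum, map_sum]; rfl

/-- Complete the square, the sum of the positive roots being `2ρ`. -/
theorem casimirScalar_eq (κ : Module.Dual ℂ H) : casimirScalar b κ =
    cartanForm (κ + rho b) (κ + rho b) - cartanForm (rho b) (rho b) := by
  classical
  have h1 : ∑ α : H.root with b.IsPos α, cartanForm κ ((rootSystem H).root α) =
      2 * cartanForm κ (rho b) := by
    rw [rho, cartanForm_smul_right, cartanForm_sum_right]
    ring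
  have h2 : casimirScalar b κ = cartanForm κ κ + 2 * cartanForm κ (rho b) := by
    rw [← h1, casimirScalar]
  rw [h2, cartanForm_add_left, cartanForm_add_right, cartanForm_add_right,
    cartanForm_comm (rho b) κ]
  ring

variable {b} {S : Set H.root}

/-- The form of `x η` with a root `β` is a positive multiple of the value of `η` at the coroot of
`x⁻¹ β`, and `x⁻¹ ∈ W^S` keeps `β` among the positive roots outside `ℤS`. -/
theorem exists_pos_cartanForm_sum (hS : S ⊆ b.support) {η : Module.Dual ℂ H}
    (hη : ∀ α, b.IsPos α → ∃ n : ℕ, 0 < n ∧ (rootSystem H).coroot' α η = n)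
    {x : (rootSystem H).weylGroup} (hx : x ∈ parabolic (rootSystem H) S) :
    ∀ l : List H.root, (∀ β ∈ l, β ∈ outPos b S) → l ≠ [] → ∃ r : ℝ, 0 < r ∧
      cartanForm (x • η) (l.map (rootSystem H).root).sum = r := by
  have key : ∀ β ∈ outPos b S, ∃ r : ℝ, 0 < r ∧
      cartanForm (x • η) ((rootSystem H).root β) = r := by
    intro β hβ
    obtain ⟨r, hr, h⟩ := exists_root_form β
    obtain ⟨n, hn, h1⟩ := hη _ (parabolic_perm hS x⁻¹ (inv_mem hx) hβ.1 hβ.2).1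
    refine ⟨r * n, by positivity, ?_⟩
    rw [h, Complex.ofReal_mul, Complex.ofReal_natCast, ← h1, ← coroot'_weylGroup_smul]
    rfl
  intro l
  induction l with
  | nil => intro _ h; exact absurd rfl h
  | cons β l ih =>
    intro hl _
    obtain ⟨r, hr, h⟩ := key β (hl β (by simp))
    by_cases h0 : l = []
    · refine ⟨r, hr, ?_⟩
      rw [h0, ← h]
      simp
    · obtain ⟨r', hr', h'⟩ := ih (fun β hβ => hl β (by simp [hβ])) h0
      refine ⟨r + r', by positivity, ?_⟩
      rw [List.map_cons, List.sum_cons, cartanForm_add_right, h, h', Complex.ofReal_add]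

/-- The Casimir scalars separate the highest weights of the block from the lower weights outside
`ν + ℤS`. -/
theorem casimirScalar_ne (hS : S ⊆ b.support) {η : Module.Dual ℂ H}
    (hη : ∀ α, b.IsPos α → ∃ n : ℕ, 0 < n ∧ (rootSystem H).coroot' α η = n)
    {x x' : (rootSystem H).weylGroup} (hx : x ∈ parabolic (rootSystem H) S)
    (l : List H.root) (hl : ∀ β ∈ l, β ∈ outPos b S) (hl0 : l ≠ []) :
    casimirScalar b (-(x' • η) - rho b) ≠
      casimirScalar b (-(x • η) - rho b - (l.map (rootSystem H).root).sum) := by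
  set γ := (l.map (rootSystem H).root).sum with hγ
  have hγm : γ ∈ AddSubgroup.closure (Set.range (rootSystem H).root) := by
    refine list_sum_mem fun y hy => ?_
    obtain ⟨β, _, rfl⟩ := List.mem_map.mp hy
    exact AddSubgroup.subset_closure ⟨β, rfl⟩
  obtain ⟨r, hr, h1⟩ := exists_pos_cartanForm_sum hS hη hx l hl hl0
  obtain ⟨s, hs, h2⟩ := exists_nonneg_cartanForm hγm
  rw [casimirScalar_eq, casimirScalar_eq, sub_add_cancel,
    show -(x • η) - rho b - γ + rho b = -(x • η + γ) by abel]
  rw [cartanForm_neg_left, cartanForm_neg_right, cartanForm_neg_left, cartanForm_neg_right,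
    neg_neg, neg_neg, cartanForm_weylGroup, cartanForm_add_left, cartanForm_add_right,
    cartanForm_add_right, cartanForm_weylGroup, cartanForm_comm γ, h2, h1]
  -- By invariance the forms of `x' η` and of `x η` with themselves both equal that of `η`. Equality
  -- of the scalars would leave `2 (x η, γ) + (γ, γ) = 0`.
  intro h
  have h3 : ((r + r + s : ℝ) : ℂ) = 0 := by
    push_cast
    linear_combination -h
  have h4 : r + r + s = 0 := by exact_mod_cast h3
  linarith

/-! ### The dominant weight -/

theorem coroot'_negRoot (α : H.root) (m : Module.Dual ℂ H) :
    (rootSystem H).coroot' (negRoot α) m = - (rootSystem H).coroot' α m := by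
  have : (rootSystem H).coroot (negRoot α) = - (rootSystem H).coroot α := by
    rw [negRoot, RootPairing.coroot_reflectionPerm, RootPairing.coreflection_apply_self]
  change m ((rootSystem H).coroot (negRoot α)) = - m ((rootSystem H).coroot α)
  rw [this, map_neg]

theorem exists_int_coroot'_rho (α : H.root) :
    ∃ z : ℤ, (rootSystem H).coroot' α (rho b) = z :=
  exists_int_coroot' (b := b) (fun j hj => ⟨1, by
    rw [Int.cast_one, rho]
    exact coroot'_rho hj⟩) α

/-- The value equals that of `λ + ρ` at the coroot of `β = -w⁻¹ α`, which is positive because `w` is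
longest. Dominance makes the integer nonnegative; if it were zero, `s_β` would fix `λ` under the dot
action, against regularity. -/
theorem exists_pos_coroot' {lam : Module.Dual ℂ H} (hint : IsIntegral lam)
    (hdom : IsDominant b lam) (hreg : IsRegular b lam) {w : (rootSystem H).weylGroup}
    (hw : IsLongestElement b {α | α ∈ b.support} w) {α : H.root} (hα : b.IsPos α) :
    ∃ n : ℕ, 0 < n ∧ (rootSystem H).coroot' α (-(w • (lam + rho b))) = n := by
  set β := negRoot ((rootSystem H).weylGroupToPerm w⁻¹ α) with hβ
  have hpos : b.IsPos β := by
    rw [hβ, isPos_negRoot]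
    exact not_isPos_of_longest' hw.1 hw.2 hα
  have h1 : (rootSystem H).coroot' α (-(w • (lam + rho b))) =
      (rootSystem H).coroot' β (lam + rho b) := by
    rw [hβ, coroot'_negRoot, map_neg, coroot'_weylGroup_smul]
  obtain ⟨k, hk⟩ := hint β
  obtain ⟨k', hk'⟩ := exists_int_coroot'_rho (b := b) β
  have h2 : (rootSystem H).coroot' β (lam + rho b) = ((k + k' : ℤ) : ℂ) := by
    rw [map_add, hk', Int.cast_add]
    exact congrArg (· + (k' : ℂ)) hk
  have h3 : 0 ≤ k + k' := hdom β hpos _ h2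
  have h4 : k + k' ≠ 0 := by
    intro h0
    rw [h0, Int.cast_zero] at h2
    have h5 : RootPairing.weylGroup.ofIdx (rootSystem H) β = 1 := by
      refine hreg _ ?_
      rw [dot, ofIdx_smul_eq, h2, zero_smul, sub_zero, add_sub_cancel_right]
    have h6 := ofIdx_smul_eq (P := rootSystem H) β ((rootSystem H).root β)
    rw [h5, one_smul, RootPairing.root_coroot'_eq_pairing, RootPairing.pairing_same, eq_comm,
      sub_eq_self, smul_eq_zero] at h6
    exact h6.elim two_ne_zero ((rootSystem H).ne_zero β)
  obtain ⟨n, hn⟩ := Int.eq_ofNat_of_zero_le h3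
  refine ⟨n, by omega, ?_⟩
  rw [h1, h2, hn]
  simp

/-! ### Restriction of weights -/

theorem apply_leviPerp_of_mem (hS : S ⊆ b.support) {m : Module.Dual ℂ H}
    (hm : m ∈ rootLattice (rootSystem H) S) {z : H} (hz : z ∈ leviPerp S) : m z = 0 := by
  induction hm using AddSubgroup.closure_induction with
  | mem x hx =>
    obtain ⟨β, hβ, rfl⟩ := hx
    exact (mem_leviPerp_iff hS).mp hz β (subset_leviRoots S hβ)
  | zero => rfl
  | add x y _ _ hx hy => rw [LinearMap.add_apply, hx, hy, add_zero]
  | neg x _ hx => rw [LinearMap.neg_apply, hx, neg_zero]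

/-- A weight is determined by its restrictions to `a ∩ h` and `h^⊥`. -/
theorem weight_ext (hS : S ⊆ b.support) {μ κ : Module.Dual ℂ H}
    (h1 : restrictWeight S μ = restrictWeight S κ) (h2 : ∀ z ∈ leviPerp S, μ z = κ z) : μ = κ := by
  refine LinearMap.ext fun t => ?_
  obtain ⟨y, hy, z, hz, rfl⟩ := exists_add_eq hS t
  rw [map_add, map_add, h2 z hz]
  congr 1
  exact DFunLike.congr_fun h1 (toLeviCartan y ((mem_leviCoroots_iff hS).mpr hy))

theorem exists_weight (hS : S ⊆ b.support) (κ : Module.Dual ℂ (leviCartan S))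
    (ν : Module.Dual ℂ H) : ∃ μ : Module.Dual ℂ H, restrictWeight S μ = κ ∧
      ∀ z ∈ leviPerp S, μ z = ν z := by
  have hc : IsCompl (leviCoroots S) (leviPerp S) := by
    constructor
    · rw [Submodule.disjoint_def]
      exact fun t h h' => eq_zero_of_mem_leviPerp hS h h'
    · rw [codisjoint_iff, eq_top_iff]
      intro t _
      obtain ⟨y, hy, z, hz, rfl⟩ := exists_add_eq hS t
      exact Submodule.add_mem_sup hy hz
  let e : leviCoroots S →ₗ[ℂ] leviCartan S :=
    { toFun := fun t => toLeviCartan t ((mem_leviCoroots_iff hS).mpr t.2)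
      map_add' := fun _ _ => rfl
      map_smul' := fun _ _ => rfl }
  refine ⟨LinearMap.ofIsCompl hc (κ ∘ₗ e) (ν ∘ₗ (leviPerp S).subtype), ?_, ?_⟩
  · refine LinearMap.ext fun t => ?_
    have ht : (⟨((t : levi S) : g), t.2⟩ : H) ∈ leviCoroots S :=
      (mem_leviCoroots_iff hS).mp (t : levi S).2
    rw [restrictWeight_apply]
    exact LinearMap.ofIsCompl_apply_left hc ⟨_, ht⟩
  · intro z hz
    exact LinearMap.ofIsCompl_apply_right hc ⟨z, hz⟩

theorem restrictWeight_eq_zero (hS : S ⊆ b.support) {m : Module.Dual ℂ H}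
    (h : ∀ α ∈ leviRoots S, (rootSystem H).coroot' α m = 0) : restrictWeight S m = 0 := by
  refine LinearMap.ext fun t => ?_
  have ht : (⟨((t : levi S) : g), t.2⟩ : H) ∈ leviCoroots S :=
    (mem_leviCoroots_iff hS).mp (t : levi S).2
  rw [restrictWeight_apply]
  have : leviCoroots S ≤ LinearMap.ker m := by
    refine Submodule.span_le.mpr ?_
    rintro _ ⟨α, hα, rfl⟩
    exact h α hα
  exact this ht

/-- The reflections in the roots of `a` permute the positive roots outside `ℤS`. The sum of these
roots is thus killed by the coroots of `a` and restricts to zero. -/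
theorem restrictWeight_rho (hS : S ⊆ b.support) : restrictWeight S (rho b) = leviRho b S := by
  classical
  have h1 : (Finset.univ.filter fun α : H.root => b.IsPos α) =
      (Finset.univ.filter fun α : H.root => b.IsPos α ∧ IsLeviRoot S α) ∪
      (Finset.univ.filter fun α : H.root => α ∈ outPos b S) := by
    ext α
    have h : α ∈ outPos b S ↔ b.IsPos α ∧ α ∉ leviRoots S := Iff.rfl
    simp only [Finset.mem_filter, Finset.mem_univ, true_and, Finset.mem_union, h,
      isLeviRoot_iff hS]
    tauto
  have h2 : restrictWeight S
      (∑ α ∈ Finset.univ.filter (fun α : H.root => α ∈ outPos b S), (rootSystem H).root α) = 0 := by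
    refine restrictWeight_eq_zero hS fun α hα => coroot'_sum_eq_zero _ fun β hβ => ?_
    simp only [Finset.mem_filter, Finset.mem_univ, true_and] at hβ ⊢
    exact parabolic_perm hS _ (ofIdx_mem_parabolic hS hα) hβ.1 hβ.2
  have h3 : rho b = (1 / 2 : ℂ) • ∑ α ∈ Finset.univ.filter (fun α : H.root => b.IsPos α),
      (rootSystem H).root α := by
    rw [rho]
  have h4 : leviRho b S = (1 / 2 : ℂ) • ∑ α ∈ Finset.univ.filter
      (fun α : H.root => b.IsPos α ∧ IsLeviRoot S α),
      restrictWeight S ((rootSystem H).root α) := by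
    rw [leviRho]
  rw [h3, h4, h1, Finset.sum_union, map_smul, map_add, h2, add_zero, map_sum]
  rw [Finset.disjoint_left]
  intro α h h'
  simp only [Finset.mem_filter, Finset.mem_univ, true_and, isLeviRoot_iff hS] at h h'
  exact h'.2 h.2

theorem restrictWeight_reflection {α : H.root} {t : leviCartan S}
    (ht : ((t : levi S) : g) = ((rootSystem H).coroot α : g)) (m : Module.Dual ℂ H) :
    restrictWeight S (RootPairing.weylGroup.ofIdx (rootSystem H) α • m) =
      Module.preReflection (restrictWeight S ((rootSystem H).root α))
        (Module.Dual.eval ℂ (leviCartan S) t) (restrictWeight S m) := by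
  rw [ofIdx_smul_eq, map_sub, map_smul, Module.preReflection_apply]
  congr 2
  change m ((rootSystem H).coroot α) = m ⟨((t : levi S) : g), t.2⟩
  congr 1
  exact Subtype.ext ht.symm

theorem exists_leviWeylGroup (hS : S ⊆ b.support) {x : (rootSystem H).weylGroup}
    (hx : x ∈ parabolic (rootSystem H) S) : ∃ y ∈ leviWeylGroup S, ∀ m : Module.Dual ℂ H,
      restrictWeight S (x • m) = y (restrictWeight S m) := by
  have key : ∀ α ∈ S, ∃ y ∈ leviWeylGroup S, ∀ m : Module.Dual ℂ H,
      restrictWeight S (RootPairing.weylGroup.ofIdx (rootSystem H) α • m) =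
        y (restrictWeight S m) := by
    intro α hα
    have hl := subset_leviRoots S hα
    let t : leviCartan S := toLeviCartan ((rootSystem H).coroot α) (coroot_mem_levi hS hl)
    exact ⟨_, Submonoid.subset_closure ⟨α, t, (isLeviRoot_iff hS).mpr hl, rfl, rfl⟩,
      restrictWeight_reflection rfl⟩
  induction hx using Subgroup.closure_induction'' with
  | one => exact ⟨1, one_mem _, fun m => by rw [one_smul]; rfl⟩
  | mem x hx => obtain ⟨α, hα, rfl⟩ := hx; exact key α hα
  | inv_mem x hx => obtain ⟨α, hα, rfl⟩ := hx; rw [ofIdx_inv]; exact key α hα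
  | mul x y _ _ hx hy =>
    obtain ⟨x', hx', h1⟩ := hx
    obtain ⟨y', hy', h2⟩ := hy
    exact ⟨x' * y', mul_mem hx' hy', fun m => by rw [mul_smul, h1, h2]; rfl⟩

/-- The Weyl group of `a` is generated here by the reflections in all roots of `a`, not only those
in `S`; `ofIdx_mem_parabolic` puts them into `W^S`. -/
theorem exists_parabolic (hS : S ⊆ b.support)
    {y : Module.End ℂ (Module.Dual ℂ (leviCartan S))} (hy : y ∈ leviWeylGroup S) :
    ∃ x ∈ parabolic (rootSystem H) S, ∀ m : Module.Dual ℂ H,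
      restrictWeight S (x • m) = y (restrictWeight S m) := by
  induction hy using Submonoid.closure_induction with
  | one => exact ⟨1, one_mem _, fun m => by rw [one_smul]; rfl⟩
  | mem y hy =>
    obtain ⟨α, t, hα, ht, rfl⟩ := hy
    exact ⟨_, ofIdx_mem_parabolic hS ((isLeviRoot_iff hS).mp hα), restrictWeight_reflection ht⟩
  | mul x y _ _ hx hy =>
    obtain ⟨x', hx', h1⟩ := hx
    obtain ⟨y', hy', h2⟩ := hy
    exact ⟨x' * y', mul_mem hx' hy', fun m => by rw [mul_smul, h1, h2]; rfl⟩

/-- The weights `-(x η) - ρ` with `x ∈ W^S`. -/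
def blockWeights (b : (rootSystem H).Base) (S : Set H.root) (η : Module.Dual ℂ H) :
    Set (Module.Dual ℂ H) :=
  {μ | ∃ x ∈ parabolic (rootSystem H) S, μ = -(x • η) - rho b}

theorem sub_mem_of_blockWeights {η : Module.Dual ℂ H}
    (hη : ∀ α, ∃ z : ℤ, (rootSystem H).coroot' α η = z) {μ κ : Module.Dual ℂ H}
    (hμ : μ ∈ blockWeights b S η) (hκ : κ ∈ blockWeights b S η) :
    μ - κ ∈ rootLattice (rootSystem H) S := by
  obtain ⟨x, hx, rfl⟩ := hμ
  obtain ⟨y, hy, rfl⟩ := hκ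
  have := sub_mem (parabolic_smul_sub_mem y hy η hη) (parabolic_smul_sub_mem x hx η hη)
  have e : y • η - η - (x • η - η) = -(x • η) - rho b - (-(y • η) - rho b) := by abel
  rwa [e] at this

/-- Adding the half sum of `a` to a restriction amounts to adding `ρ` before restricting. This turns
the dot orbit of the restriction of `ν` into the restrictions of the `W^S`-orbit of `-η`, shifted by
`-ρ`. -/
theorem restrictWeight_blockWeights (hS : S ⊆ b.support) {η ν : Module.Dual ℂ H}
    (hν : ν ∈ blockWeights b S η) :
    {μ | ∃ x ∈ leviWeylGroup S, μ = x (restrictWeight S ν + leviRho b S) - leviRho b S} =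
      restrictWeight S '' blockWeights b S η := by
  obtain ⟨x₀, hx₀, rfl⟩ := hν
  have h0 : restrictWeight S (-(x₀ • η) - rho b) + leviRho b S = restrictWeight S (x₀ • (-η)) := by
    rw [← restrictWeight_rho hS, ← map_add, sub_add_cancel, smul_neg]
  rw [h0]
  ext μ
  constructor
  · rintro ⟨y, hy, rfl⟩
    obtain ⟨x, hx, h⟩ := exists_parabolic hS hy
    refine ⟨_, ⟨x * x₀, mul_mem hx hx₀, rfl⟩, ?_⟩
    rw [map_sub, restrictWeight_rho hS, ← h, ← mul_smul, smul_neg]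
  · rintro ⟨_, ⟨x, hx, rfl⟩, rfl⟩
    obtain ⟨y, hy, h⟩ := exists_leviWeylGroup hS (mul_mem hx (inv_mem hx₀))
    refine ⟨y, hy, ?_⟩
    rw [map_sub, restrictWeight_rho hS, ← h, ← mul_smul, inv_mul_cancel_right, smul_neg]

/-- An element of `h^⊥` that is positive on the roots of the nilradical. -/
theorem exists_grading (hS : S ⊆ b.support) : ∃ z ∈ leviPerp S, ∀ α ∈ outPos b S,
    ∃ k : ℕ, 0 < k ∧ (rootSystem H).root α z = k := by
  classical
  -- The total coefficient at simple roots outside `S`: zero on `ℤS` and positive on every positive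
  -- root outside it.
  let f : Module.Dual ℂ (Module.Dual ℂ H) :=
    ∑ j ∈ Finset.univ.filter (fun j : b.support => (j : H.root) ∉ S), simpleCoeff b j
  obtain ⟨z, hz⟩ := (Module.evalEquiv ℂ H).surjective f
  have h1 : ∀ m, m z = ∑ j ∈ Finset.univ.filter (fun j : b.support => (j : H.root) ∉ S),
      simpleCoeff b j m := fun m => by
    rw [← LinearMap.sum_apply]
    change m z = f m
    rw [← hz]
    rfl
  refine ⟨z, (mem_leviPerp_iff hS).mpr fun α hα => ?_, fun α hα => ?_⟩
  · rw [h1]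
    refine Finset.sum_eq_zero fun j hj => simpleCoeff_of_mem_rootLattice hS hα j ?_
    simpa using hj
  · choose n hn using exists_nat_simpleCoeff hα.1
    obtain ⟨j, m, hj, hm, h2⟩ := exists_simpleCoeff_pos hα.1 hα.2
    refine ⟨∑ j ∈ Finset.univ.filter (fun j : b.support => (j : H.root) ∉ S), n j, ?_, ?_⟩
    · refine Finset.sum_pos' (fun _ _ => Nat.zero_le _) ⟨j, by simpa using hj, ?_⟩
      have : n j = m := by
        have := (hn j).symm.trans h2
        exact_mod_cast this
      omega
    · rw [h1, Nat.cast_sum]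
      exact Finset.sum_congr rfl fun j _ => hn j

end Weights

end CategoryO

end

noncomputable section

namespace CategoryO

/-! ### Generalized eigenvectors -/

section GeneralizedKernel

set_option linter.unusedSectionVars false

attribute [local instance] LieRing.ofAssociativeRing

variable {L : Type u} [LieRing L] [LieAlgebra ℂ L] {V Q : Type u} [AddCommGroup V] [Module ℂ V]
  [Module (U L) V] [IsScalarTower ℂ (U L) V] [AddCommGroup Q] [Module ℂ Q]
  [Module (U L) Q] [IsScalarTower ℂ (U L) Q]

/-- The vectors killed by a polynomial in `Ω` with all roots in `E`. -/
def generalizedKernel (Ω : U L) (E : Set ℂ) (V : Type u) [AddCommGroup V] [Module ℂ V]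
    [Module (U L) V] [IsScalarTower ℂ (U L) V] : Submodule ℂ V where
  carrier := {v | ∃ p : Polynomial ℂ, (∀ c, p.eval c = 0 → c ∈ E) ∧ Polynomial.aeval Ω p • v = 0}
  add_mem' := by
    rintro v w ⟨p, hp, hv⟩ ⟨q, hq, hw⟩
    refine ⟨p * q, fun c hc => ?_, ?_⟩
    · rw [Polynomial.eval_mul, mul_eq_zero] at hc
      exact hc.elim (hp c) (hq c)
    · rw [smul_add, map_mul, mul_smul _ _ w, hw, smul_zero, add_zero, ← map_mul, mul_comm, map_mul,
        mul_smul, hv, smul_zero]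
  zero_mem' := ⟨1, fun c hc => by simp at hc, smul_zero _⟩
  smul_mem' := by
    rintro c v ⟨p, hp, hv⟩
    exact ⟨p, hp, by rw [smul_algebra_smul_comm, hv, smul_zero]⟩

theorem smul_mem_generalizedKernel {Ω : U L} {E : Set ℂ} {y : U L} (hy : Commute y Ω) {v : V}
    (hv : v ∈ generalizedKernel Ω E V) : y • v ∈ generalizedKernel Ω E V := by
  obtain ⟨p, hp, hv⟩ := hv
  refine ⟨p, hp, ?_⟩
  have h : Commute y (Polynomial.aeval Ω p) := by
    clear hp hv
    induction p using Polynomial.induction_on' with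
    | add p q hp hq => rw [map_add]; exact hp.add_right hq
    | monomial n a =>
      rw [Polynomial.aeval_monomial]
      exact Commute.mul_right (Algebra.commutes a y).symm (hy.pow_right n)
  rw [← mul_smul, ← h.eq, mul_smul, hv, smul_zero]

/-- Enlarge the annihilating polynomial by the factor `X - e`. This is how an eigenvector modulo the
generalized kernel is absorbed into it. -/
theorem mem_generalizedKernel_of_sub {Ω : U L} {E : Set ℂ} {e : ℂ} (he : e ∈ E) {v : V}
    (hv : Ω • v - e • v ∈ generalizedKernel Ω E V) : v ∈ generalizedKernel Ω E V := by
  obtain ⟨p, hp, hv⟩ := hv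
  refine ⟨p * (Polynomial.X - Polynomial.C e), fun c hc => ?_, ?_⟩
  · rw [Polynomial.eval_mul, mul_eq_zero, Polynomial.eval_sub, Polynomial.eval_X,
      Polynomial.eval_C, sub_eq_zero] at hc
    exact hc.elim (hp c) fun h => h ▸ he
  · rw [map_mul, mul_smul, map_sub, Polynomial.aeval_X, Polynomial.aeval_C, sub_smul,
      algebraMap_smul, hv]

theorem map_mem_generalizedKernel {Ω : U L} {E : Set ℂ} (f : V →ₗ[U L] Q) {v : V}
    (hv : v ∈ generalizedKernel Ω E V) : f v ∈ generalizedKernel Ω E Q := by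
  obtain ⟨p, hp, hv⟩ := hv
  exact ⟨p, hp, by rw [← map_smul, hv, map_zero]⟩

theorem mem_generalizedKernel_of_map {Ω : U L} {E : Set ℂ} (f : V →ₗ[U L] Q)
    (hf : Function.Injective f) {v : V} (hv : f v ∈ generalizedKernel Ω E Q) :
    v ∈ generalizedKernel Ω E V := by
  obtain ⟨p, hp, hv⟩ := hv
  exact ⟨p, hp, hf (by rw [map_smul, hv, map_zero])⟩

/-- A polynomial in `Ω` acts on an eigenvector by its value at the eigenvalue, which must therefore
be a root. -/
theorem mem_of_mem_generalizedKernel {Ω : U L} {E : Set ℂ} {v : V}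
    (hv : v ∈ generalizedKernel Ω E V) (hv0 : v ≠ 0) {c : ℂ} (hc : Ω • v = c • v) : c ∈ E := by
  obtain ⟨p, hp, hv⟩ := hv
  refine hp c ?_
  have h : ∀ p : Polynomial ℂ, Polynomial.aeval Ω p • v = p.eval c • v := by
    intro p
    induction p using Polynomial.induction_on' with
    | add p q hp hq => rw [map_add, add_smul, hp, hq, Polynomial.eval_add, add_smul]
    | monomial n a =>
      have hn : ∀ n : ℕ, Ω ^ n • v = c ^ n • v := by
        intro n
        induction n with
        | zero => rw [pow_zero, pow_zero, one_smul, one_smul]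
        | succ n ih =>
          rw [pow_succ, mul_smul, hc, smul_algebra_smul_comm, ih, smul_smul, pow_succ']
      rw [Polynomial.aeval_monomial, mul_smul, hn, algebraMap_smul, smul_smul,
        Polynomial.eval_monomial]
  rw [h, smul_eq_zero] at hv
  exact hv.resolve_right hv0

end GeneralizedKernel

/-! ### Casimir elements -/

section Casimir

set_option linter.unusedSectionVars false

attribute [local instance] LieRing.ofAssociativeRing

variable {g : Type u} [LieRing g] [LieAlgebra ℂ g] [FiniteDimensional ℂ g] [IsKilling ℂ g]
  {H : LieSubalgebra ℂ g} [H.IsCartanSubalgebra]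

theorem eq_sum_killingForm {I : Type*} [Fintype I] [DecidableEq I] {a b : I → g}
    (hab : ∀ i j, killingForm ℂ g (a i) (b j) = if i = j then 1 else 0) {x : g}
    (hx : x ∈ Submodule.span ℂ (Set.range a)) : x = ∑ j, killingForm ℂ g x (b j) • a j := by
  induction hx using Submodule.span_induction with
  | mem x hx => obtain ⟨i, rfl⟩ := hx; simp [hab]
  | zero => simp
  | add x y _ _ hx hy =>
    simp only [map_add, LinearMap.add_apply, add_smul, Finset.sum_add_distrib]
    rw [← hx, ← hy]
  | smul c x _ hx =>
    simp only [map_smul, LinearMap.smul_apply, smul_assoc, ← Finset.smul_sum]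
    rw [← hx]

theorem toU_sum {L : Type u} [LieRing L] [LieAlgebra ℂ L] {I : Type*} (s : Finset I) (a : I → L) :
    toU (∑ i ∈ s, a i) = ∑ i ∈ s, toU (a i) :=
  map_sum (UniversalEnvelopingAlgebra.ι ℂ) a s

/-- The invariance of Casimir elements. -/
theorem commute_sum_of_dual {I : Type*} [Fintype I] [DecidableEq I] {a b : I → g}
    (hab : ∀ i j, killingForm ℂ g (a i) (b j) = if i = j then 1 else 0) (y : g)
    (ha : ∀ i, ⁅y, a i⁆ ∈ Submodule.span ℂ (Set.range a))
    (hb : ∀ i, ⁅y, b i⁆ ∈ Submodule.span ℂ (Set.range b)) :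
    Commute (toU y) (∑ i, toU (b i) * toU (a i)) := by
  have hba : ∀ i j, killingForm ℂ g (b i) (a j) = if i = j then 1 else 0 := fun i j => by
    rw [LieModule.traceForm_comm, hab]
    simp only [eq_comm]
  -- Invariance of the Killing form makes the matrices of `ad y` in the two dual bases negative
  -- transposes of each other, so the two double sums cancel.
  have hinv : ∀ i j, killingForm ℂ g ⁅y, a j⁆ (b i) = - killingForm ℂ g ⁅y, b i⁆ (a j) := by
    intro i j
    rw [← lie_skew, map_neg, LinearMap.neg_apply, LieModule.traceForm_apply_lie_apply,
      LieModule.traceForm_comm]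
  have h0 : ∑ i, (toU ⁅y, b i⁆ * toU (a i) + toU (b i) * toU ⁅y, a i⁆) = 0 := by
    rw [Finset.sum_add_distrib]
    have h1 : ∑ i, toU ⁅y, b i⁆ * toU (a i) =
        ∑ i, ∑ j, killingForm ℂ g ⁅y, b i⁆ (a j) • (toU (b j) * toU (a i)) := by
      refine Finset.sum_congr rfl fun i _ => ?_
      conv_lhs => rw [eq_sum_killingForm hba (hb i)]
      rw [toU_sum, Finset.sum_mul]
      simp only [toU_smul, smul_mul_assoc]
    have h2 : ∑ i, toU (b i) * toU ⁅y, a i⁆ =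
        ∑ i, ∑ j, killingForm ℂ g ⁅y, a i⁆ (b j) • (toU (b i) * toU (a j)) := by
      refine Finset.sum_congr rfl fun i _ => ?_
      conv_lhs => rw [eq_sum_killingForm hab (ha i)]
      rw [toU_sum, Finset.mul_sum]
      simp only [toU_smul, mul_smul_comm]
    rw [h1, h2, Finset.sum_comm (s := Finset.univ) (t := Finset.univ)
      (f := fun i j => killingForm ℂ g ⁅y, a i⁆ (b j) • (toU (b i) * toU (a j))),
      ← Finset.sum_add_distrib]
    refine Finset.sum_eq_zero fun i _ => ?_
    rw [← Finset.sum_add_distrib]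
    refine Finset.sum_eq_zero fun j _ => ?_
    rw [hinv, neg_smul, add_neg_cancel]
  have h3 : toU y * ∑ i, toU (b i) * toU (a i) - (∑ i, toU (b i) * toU (a i)) * toU y = 0 := by
    rw [← h0, Finset.mul_sum, Finset.sum_mul, ← Finset.sum_sub_distrib]
    refine Finset.sum_congr rfl fun i _ => ?_
    rw [toU_lie, toU_lie]
    noncomm_ring
  exact sub_eq_zero.mp h3

/-- An `sl₂`-triple for each positive root provides the vectors for `α` and `-α` at the same time.
Choosing for positive roots only makes one normalization valid for both signs. -/
theorem exists_rootVec (b : (rootSystem H).Base) : ∃ X : H.root → g, (∀ α, X α ∈ rootSpace H (α.1 : H → ℂ)) ∧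
    ∀ α, killingForm ℂ g (X α) (X (negRoot α)) = 1 := by
  classical
  have h1 : ∀ α : H.root, ∃ e ∈ rootSpace H (α.1 : H → ℂ), ∃ f ∈ rootSpace H (-(α.1 : H → ℂ)),
      killingForm ℂ g e f = 1 := by
    intro α
    have hα : α.1.IsNonZero := LieSubalgebra.isNonZero_coe_root α
    obtain ⟨h, e, f, t, he, hf⟩ := exists_isSl2Triple_of_weight_isNonZero hα
    have hef := lie_eq_killingForm_smul_of_mem_rootSpace_of_mem_rootSpace_neg he hf
    have h0 : killingForm ℂ g e f ≠ 0 := by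
      intro h0
      rw [t.lie_e_f, h0, zero_smul] at hef
      exact t.h_ne_zero hef
    exact ⟨e, he, (killingForm ℂ g e f)⁻¹ • f, Submodule.smul_mem _ _ hf, by
      rw [map_smul, smul_eq_mul, inv_mul_cancel₀ h0]⟩
  choose e he f hf hef using h1
  refine ⟨fun α => if b.IsPos α then e α else f (negRoot α), fun α => ?_, fun α => ?_⟩
  · by_cases h : b.IsPos α
    · simpa only [if_pos h] using he α
    · have := hf (negRoot α)
      rw [coe_negRoot, neg_neg] at this
      simpa only [if_neg h] using this
  · by_cases h : b.IsPos α
    · have h' : ¬ b.IsPos (negRoot α) := by rw [isPos_negRoot, not_not]; exact h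
      simp only [if_pos h, if_neg h', negRoot_negRoot]
      exact hef α
    · have h' : b.IsPos (negRoot α) := (isPos_negRoot b α).mpr h
      simp only [if_neg h, if_pos h']
      rw [LieModule.traceForm_comm]
      exact hef (negRoot α)

variable (b : (rootSystem H).Base) (S : Set H.root)

/-- Root vectors with `κ(X_α, X_{-α}) = 1`. -/
def rootVec : H.root → g := (exists_rootVec b).choose

theorem rootVec_mem (α : H.root) : rootVec b α ∈ rootSpace H (α.1 : H → ℂ) :=
  (exists_rootVec b).choose_spec.1 α

theorem rootVec_neg (α : H.root) : killingForm ℂ g (rootVec b α) (rootVec b (negRoot α)) = 1 :=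
  (exists_rootVec b).choose_spec.2 α

theorem killingForm_rootVec [DecidableEq H.root] (α β : H.root) :
    killingForm ℂ g (rootVec b α) (rootVec b (negRoot β)) = if α = β then 1 else 0 := by
  split_ifs with h
  · rw [h, rootVec_neg]
  · refine killingForm_apply_eq_zero_of_mem_rootSpace_of_add_ne_zero ℂ g H (rootVec_mem b α)
      (rootVec_mem b (negRoot β)) fun h0 => h ?_
    rw [coe_negRoot, add_neg_eq_zero] at h0
    exact Subtype.ext (DFunLike.coe_injective h0)

theorem rootSum_le_span_rootVec (A : Set H.root) :
    rootSum A ≤ Submodule.span ℂ (Set.range fun α : A => rootVec b α) := by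
  refine iSup₂_le fun α hα x hx => ?_
  have h1 : rootVec b α ≠ 0 := by
    intro h0
    have := rootVec_neg b α
    rw [h0, map_zero, LinearMap.zero_apply] at this
    exact zero_ne_one this
  obtain ⟨c, hc⟩ := (finrank_eq_one_iff_of_nonzero'
    (⟨_, rootVec_mem b α⟩ : rootSpace H (α.1 : H → ℂ)) (by simpa using h1)).mp
    (finrank_rootSpace_eq_one _ (LieSubalgebra.isNonZero_coe_root α)) ⟨x, hx⟩
  have hc' : c • rootVec b α = x := congrArg Subtype.val hc
  rw [← hc']
  exact Submodule.smul_mem _ _ (Submodule.subset_span ⟨⟨α, hα⟩, rfl⟩)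

theorem lie_rootVec_neg (α : H.root) : ⁅rootVec b α, rootVec b (negRoot α)⁆ =
    ((cartanEquivDual H).symm ((rootSystem H).root α) : g) := by
  have h1 := rootVec_mem b (negRoot α)
  rw [coe_negRoot] at h1
  rw [lie_eq_killingForm_smul_of_mem_rootSpace_of_mem_rootSpace_neg (rootVec_mem b α) h1,
    rootVec_neg, one_smul]
  rfl

variable (H) in
/-- The trace form of `H`. -/
def cartanTraceForm : LinearMap.BilinForm ℂ H := LieModule.traceForm ℂ H g

theorem cartanTraceForm_nondegenerate : (cartanTraceForm H).Nondegenerate :=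
  traceForm_cartan_nondegenerate ℂ g H

variable (H) in
/-- A basis of `H`. -/
def cartanBasis : Module.Basis (Fin (Module.finrank ℂ H)) ℂ H := Module.finBasis ℂ H

variable (H) in
/-- The dual basis for the Killing form. -/
def cartanDualBasis : Module.Basis (Fin (Module.finrank ℂ H)) ℂ H :=
  (cartanTraceForm H).dualBasis cartanTraceForm_nondegenerate (cartanBasis H)

theorem killingForm_cartanBasis (i j : Fin (Module.finrank ℂ H)) :
    killingForm ℂ g (cartanBasis H i : g) (cartanDualBasis H j : g) = if i = j then 1 else 0 := by
  rw [LieModule.traceForm_comm]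
  exact (cartanTraceForm H).apply_dualBasis_left cartanTraceForm_nondegenerate (cartanBasis H) j i

/-- The Casimir element. -/
def casimir : U g := ∑ i, toU (cartanDualBasis H i : g) * toU (cartanBasis H i : g) +
  ∑ α : H.root, toU (rootVec b (negRoot α)) * toU (rootVec b α)

open scoped Classical in
/-- The part of the Casimir element for the roots outside `ℤS`. -/
def outCasimir : U g := ∑ α : H.root with α ∈ outPos b S,
  toU (rootVec b (negRoot α)) * toU (rootVec b α)

theorem mem_rootSpace_zero (t : H) : (t : g) ∈ rootSpace H (0 : H → ℂ) := by
  have : (t : g) ∈ (rootSpace H (0 : H → ℂ)).toSubmodule := by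
    rw [rootSpace_zero_toSubmodule]; exact t.2
  exact this

theorem span_range_eq_top {I : Type*} (e : Module.Basis I ℂ H) (f : H.root ≃ H.root) :
    Submodule.span ℂ (Set.range (Sum.elim (fun i => (e i : g)) fun α => rootVec b (f α))) = ⊤ := by
  rw [eq_top_iff, ← cartan_sup_rootSum_univ (H := H), Set.Sum.elim_range, Submodule.span_union]
  refine sup_le_sup ?_ ((rootSum_le_span_rootVec b _).trans (Submodule.span_mono ?_))
  · intro t ht
    have h1 : (⟨t, ht⟩ : H) ∈ Submodule.span ℂ (Set.range e) := by rw [e.span_eq]; trivial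
    have h2 := Submodule.mem_map_of_mem (f := H.toSubmodule.subtype) h1
    rw [Submodule.map_span, ← Set.range_comp] at h2
    exact h2
  · rintro _ ⟨α, rfl⟩
    exact ⟨f.symm α, congrArg (rootVec b) (f.apply_symm_apply α)⟩

/-- `α ↦ -α`. -/
def negEquiv : H.root ≃ H.root := ⟨negRoot, negRoot, negRoot_negRoot, negRoot_negRoot⟩

/-- A basis of `H` with the root vectors, and the dual basis with the opposite root vectors, are
dual bases of `g` for the Killing form. -/
theorem commute_casimir (y : g) : Commute (toU y) (casimir b) := by
  classical
  have h := commute_sum_of_dual (I := Fin (Module.finrank ℂ H) ⊕ H.root)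
    (a := Sum.elim (fun i => (cartanBasis H i : g)) fun α => rootVec b α)
    (b := Sum.elim (fun i => (cartanDualBasis H i : g)) fun α => rootVec b (negEquiv α)) ?_ y
    (fun i => (span_range_eq_top b (cartanBasis H) (Equiv.refl _)).ge trivial)
    (fun i => (span_range_eq_top b (cartanDualBasis H) negEquiv).ge trivial)
  · rw [Fintype.sum_sum_type] at h
    exact h
  · rintro (i | α) (j | β)
    · simpa using killingForm_cartanBasis i j
    · refine (killingForm_apply_eq_zero_of_mem_rootSpace_of_add_ne_zero ℂ g H
        (mem_rootSpace_zero _) (rootVec_mem b _) ?_).trans (by simp)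
      rw [zero_add]
      exact coe_root_ne_zero _
    · refine (killingForm_apply_eq_zero_of_mem_rootSpace_of_add_ne_zero ℂ g H
        (rootVec_mem b _) (mem_rootSpace_zero _) ?_).trans (by simp)
      rw [add_zero]
      exact coe_root_ne_zero _
    · simpa [negEquiv] using killingForm_rootVec b α β

variable {S}

/-- The root vectors of the nilradical and of its opposite are dual to each other, so an element
that normalizes both commutes with the sum of the products. -/
theorem commute_outCasimir {y : g} (h1 : ∀ x ∈ rootSum (outPos b S), ⁅y, x⁆ ∈ rootSum (outPos b S))
    (h2 : ∀ x ∈ rootSum (outNeg b S), ⁅y, x⁆ ∈ rootSum (outNeg b S)) :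
    Commute (toU y) (outCasimir b S) := by
  classical
  have h := commute_sum_of_dual (I := {α // α ∈ outPos b S})
    (a := fun α => rootVec b α) (b := fun α => rootVec b (negRoot α)) ?_ y
    (fun i => rootSum_le_span_rootVec b _ (h1 _ (rootSpace_le_rootSum i.2 (rootVec_mem b _))))
    (fun i => ?_)
  · rw [outCasimir, Finset.sum_subtype (p := fun α => α ∈ outPos b S) _ (fun α => by simp)]
    convert h
  · rintro ⟨α, hα⟩ ⟨β, hβ⟩
    simpa using killingForm_rootVec b α β
  · have h3 : rootSum (outNeg b S) ≤ Submodule.span ℂ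
        (Set.range fun α : {α // α ∈ outPos b S} => rootVec b (negRoot α)) := by
      refine (rootSum_le_span_rootVec b _).trans (Submodule.span_mono ?_)
      rintro _ ⟨⟨α, hα⟩, rfl⟩
      exact ⟨⟨negRoot α, mem_outNeg_iff.mp hα⟩, by simp only [negRoot_negRoot]⟩
    refine h3 (h2 _ (rootSpace_le_rootSum ?_ (rootVec_mem b _)))
    rw [mem_outNeg_iff, negRoot_negRoot]
    exact i.2

variable (S) in
/-- The Casimir element of the Levi subalgebra `a + h`. -/
def leviCasimir : U g := casimir b - (2 : ℂ) • outCasimir b S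

variable {b}

theorem commute_leviCasimir_of_levi (hS : S ⊆ b.support) {y : g} (hy : y ∈ levi S) :
    Commute (toU y) (leviCasimir b S) :=
  (commute_casimir b y).sub_right ((commute_outCasimir b (fun _ => levi_lie_mem_outPos hS hy)
    fun _ => levi_lie_mem_outNeg hS hy).smul_right _)

theorem commute_leviCasimir_of_cartan (t : H) :
    Commute (toU (t : g)) (leviCasimir b S) :=
  (commute_casimir b _).sub_right ((commute_outCasimir b (fun _ => cartan_lie_mem_rootSum t)
    fun _ => cartan_lie_mem_rootSum t).smul_right _)

/-! ### The action on weight vectors -/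

variable {V : Type u} [AddCommGroup V] [Module ℂ V] [Module (U g) V] [IsScalarTower ℂ (U g) V]

theorem cartanCasimir_smul {κ : Module.Dual ℂ H} {v : V} (hv : v ∈ weightSpace H κ V) :
    (∑ i, toU (cartanDualBasis H i : g) * toU (cartanBasis H i : g)) • v =
      cartanForm κ κ • v := by
  have h1 : (cartanEquivDual H).symm κ = ∑ i, κ (cartanBasis H i) • cartanDualBasis H i := by
    refine (cartanEquivDual H).injective ?_
    rw [LinearEquiv.apply_symm_apply]
    refine (cartanBasis H).ext fun j => ?_
    rw [map_sum, LinearMap.sum_apply]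
    have h2 : ∀ i, cartanEquivDual H (κ (cartanBasis H i) • cartanDualBasis H i)
        (cartanBasis H j) = if j = i then κ (cartanBasis H i) else 0 := by
      intro i
      have h3 := killingForm_cartanBasis (H := H) j i
      rw [LieModule.traceForm_comm] at h3
      have h4 : cartanEquivDual H (cartanDualBasis H i) (cartanBasis H j) =
        if j = i then 1 else 0 := h3
      rw [map_smul, LinearMap.smul_apply, h4]
      simp
    rw [Finset.sum_congr rfl fun i _ => h2 i]
    simp
  rw [Finset.sum_smul, cartanForm, h1, map_sum, Finset.sum_smul]
  refine Finset.sum_congr rfl fun i _ => ?_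
  rw [mul_smul, hv (cartanBasis H i), toU_smul_smul, hv (cartanDualBasis H i), smul_smul,
    map_smul, smul_eq_mul]

-- In the terms of negative roots the factors are interchanged. The commutators act on `v` by the
-- numbers `(κ, α)`, which together with `(κ, κ)` make up `casimirScalar`.
open scoped Classical in
theorem casimir_smul {κ : Module.Dual ℂ H} {v : V} (hv : v ∈ weightSpace H κ V) :
    casimir b • v = casimirScalar b κ • v + (2 : ℂ) • ∑ α : H.root with b.IsPos α,
      toU (rootVec b (negRoot α)) • toU (rootVec b α) • v := by
  let F : H.root → V := fun α => toU (rootVec b (negRoot α)) • toU (rootVec b α) • v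
  have h1 : ∑ α : H.root, F α = ∑ α : H.root with b.IsPos α, (F α + F (negRoot α)) := by
    rw [← Finset.sum_filter_add_sum_filter_not Finset.univ (fun α => b.IsPos α),
      Finset.sum_add_distrib]
    congr 1
    refine Finset.sum_nbij' negRoot negRoot ?_ ?_ (fun α _ => negRoot_negRoot α)
      (fun α _ => negRoot_negRoot α) fun α _ => by rw [negRoot_negRoot]
    · intro α hα
      simpa [isPos_negRoot] using hα
    · intro α hα
      simpa [isPos_negRoot] using hα
  have h2 : ∀ α, F (negRoot α) = cartanForm κ ((rootSystem H).root α) • v + F α := by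
    intro α
    change toU (rootVec b (negRoot (negRoot α))) • toU (rootVec b (negRoot α)) • v = _
    rw [negRoot_negRoot, toU_swap, lie_rootVec_neg, hv, add_comm]
    rfl
  rw [casimir, add_smul, cartanCasimir_smul hv, Finset.sum_smul, casimirScalar, add_smul,
    add_assoc]
  congr 1
  have h3 : ∑ α : H.root, (toU (rootVec b (negRoot α)) * toU (rootVec b α)) • v =
      ∑ α : H.root, F α := Finset.sum_congr rfl fun α _ => mul_smul _ _ _
  rw [h3, h1, Finset.sum_smul, Finset.smul_sum, ← Finset.sum_add_distrib]
  refine Finset.sum_congr rfl fun α _ => ?_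
  rw [h2, two_smul]
  change F α + (_ + F α) = _ + (F α + F α)
  abel

-- Subtracting `outCasimir` twice removes exactly the terms of the nilradical and leaves the scalar
-- unchanged. Hence this element and the full Casimir element act by the same scalar on vectors
-- killed by `n₊`.
open scoped Classical in
theorem leviCasimir_smul {κ : Module.Dual ℂ H} {v : V} (hv : v ∈ weightSpace H κ V) :
    leviCasimir b S • v = casimirScalar b κ • v +
      (2 : ℂ) • ∑ α : H.root with b.IsPos α ∧ α ∈ leviRoots S,
        toU (rootVec b (negRoot α)) • toU (rootVec b α) • v := by
  let F : H.root → V := fun α => toU (rootVec b (negRoot α)) • toU (rootVec b α) • v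
  have h1 : ∑ α : H.root with b.IsPos α, F α =
      ∑ α : H.root with b.IsPos α ∧ α ∈ leviRoots S, F α +
        ∑ α : H.root with α ∈ outPos b S, F α := by
    rw [← Finset.sum_filter_add_sum_filter_not (Finset.univ.filter fun α => b.IsPos α)
      (fun α => α ∈ leviRoots S), Finset.filter_filter, Finset.filter_filter]
    congr 1
    exact Finset.sum_congr (by ext α; rw [Finset.mem_filter, Finset.mem_filter]; exact Iff.rfl) fun _ _ => rfl
  have h2 : outCasimir b S • v = ∑ α : H.root with α ∈ outPos b S, F α := by
    rw [outCasimir, Finset.sum_smul]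
    exact Finset.sum_congr rfl fun α _ => mul_smul _ _ _
  rw [leviCasimir, sub_smul, casimir_smul hv, smul_assoc, h2]
  change _ + (2 : ℂ) • ∑ α : H.root with b.IsPos α, F α - _ = _
  rw [h1, smul_add]
  change _ = _ + (2 : ℂ) • ∑ α : H.root with b.IsPos α ∧ α ∈ leviRoots S, F α
  abel

/-- For vectors that are highest weight vectors only modulo a stable subspace `G`; it is applied
with a generalized kernel as `G`, in combination with `mem_generalizedKernel_of_sub`. -/
theorem casimir_sub_mem {κ : Module.Dual ℂ H} {v : V} (hv : v ∈ weightSpace H κ V)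
    (G : Submodule ℂ V) (hG : ∀ x : g, ∀ w ∈ G, toU x • w ∈ G)
    (hn : ∀ x ∈ nPos b, toU x • v ∈ G) : casimir b • v - casimirScalar b κ • v ∈ G := by
  classical
  rw [casimir_smul hv, add_sub_cancel_left]
  refine G.smul_mem _ (sum_mem fun α hα => hG _ _ (hn _ ?_))
  exact rootSpace_le_rootSum (A := {α | b.IsPos α}) (by simpa using hα) (rootVec_mem b α)

theorem leviCasimir_sub_mem (hS : S ⊆ b.support) {κ : Module.Dual ℂ H} {v : V}
    (hv : v ∈ weightSpace H κ V) (G : Submodule ℂ V)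
    (hG : ∀ x : levi S, ∀ w ∈ G, toU (x : g) • w ∈ G)
    (hn : ∀ x ∈ leviNPos b S, toU (x : g) • v ∈ G) :
    leviCasimir b S • v - casimirScalar b κ • v ∈ G := by
  classical
  rw [leviCasimir_smul hv, add_sub_cancel_left]
  refine G.smul_mem _ (sum_mem fun α hα => ?_)
  rw [Finset.mem_filter] at hα
  have h1 := rootSpace_le_levi hS hα.2.2 (rootVec_mem b α)
  have h2 := rootSpace_le_levi hS (negRoot_mem_leviRoots hα.2.2) (rootVec_mem b (negRoot α))
  refine hG ⟨_, h2⟩ _ (hn ⟨_, h1⟩ ?_)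
  exact rootSpace_le_rootSum (A := {α | b.IsPos α}) hα.2.1 (rootVec_mem b α)

theorem casimir_smul_of_isHW {κ : Module.Dual ℂ H} {v : V} (hv : IsHW (nPos b) κ v) :
    casimir b • v = casimirScalar b κ • v := by
  have := casimir_sub_mem hv.1 ⊥ (fun x w hw => by
    rw [(Submodule.mem_bot ℂ).mp hw, smul_zero]; exact zero_mem _)
    fun x hx => by rw [hv.2 x hx]; exact zero_mem _
  exact sub_eq_zero.mp ((Submodule.mem_bot ℂ).mp this)

theorem leviCasimir_smul_of_isHW (hS : S ⊆ b.support) {κ : Module.Dual ℂ H} {v : V}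
    (hv : IsHW (nPos b) κ v) : leviCasimir b S • v = casimirScalar b κ • v := by
  have := leviCasimir_sub_mem hS hv.1 ⊥ (fun x w hw => by
    rw [(Submodule.mem_bot ℂ).mp hw, smul_zero]; exact zero_mem _)
    fun x hx => by rw [hv.2 x hx]; exact zero_mem _
  exact sub_eq_zero.mp ((Submodule.mem_bot ℂ).mp this)

end Casimir

end CategoryO

end

noncomputable section

namespace CategoryO

/-! ### Modules generated by weight vectors -/

section Generation

set_option linter.unusedSectionVars false

attribute [local instance] LieRing.ofAssociativeRing

variable {L : Type u} [LieRing L] [LieAlgebra ℂ L] {h : LieSubalgebra ℂ L} {n : Submodule ℂ L}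
  {V : Type u} [AddCommGroup V] [Module ℂ V] [Module (U L) V] [IsScalarTower ℂ (U L) V]

theorem smul_mem_iSup_weightSpace {x : L} {α : Module.Dual ℂ h}
    (hx : ∀ t : h, ⁅(t : L), x⁆ = α t • x) {v : V}
    (hv : v ∈ ⨆ μ : Module.Dual ℂ h, weightSpace h μ V) :
    toU x • v ∈ ⨆ μ : Module.Dual ℂ h, weightSpace h μ V := by
  refine Submodule.iSup_induction _ (motive := fun v => toU x • v ∈
    ⨆ μ : Module.Dual ℂ h, weightSpace h μ V) hv (fun μ v hv => ?_)
    (by rw [smul_zero]; exact zero_mem _) (fun v w hv hw => by rw [smul_add]; exact add_mem hv hw)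
  exact Submodule.mem_iSup_of_mem (α + μ) (weight_shift hx hv)

theorem IsTriangular.smul_mem_iSup {nm : Submodule ℂ L} {δ : h} (ht : IsTriangular h n nm δ)
    (x : L) {v : V} (hv : v ∈ ⨆ μ : Module.Dual ℂ h, weightSpace h μ V) :
    toU x • v ∈ ⨆ μ : Module.Dual ℂ h, weightSpace h μ V := by
  have h1 : (⊤ : Submodule ℂ L) ≤ transporter v (⨆ μ : Module.Dual ℂ h, weightSpace h μ V) := by
    rw [← ht.sup_eq_top]
    refine sup_le (ht.neg.trans (Submodule.span_le.mpr ?_)) (sup_le ?_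
      (ht.pos.trans (Submodule.span_le.mpr ?_)))
    · rintro x ⟨α, k, -, -, hx⟩
      exact smul_mem_iSup_weightSpace hx hv
    · intro t ht'
      change toU t • v ∈ ⨆ μ : Module.Dual ℂ h, weightSpace h μ V
      refine Submodule.iSup_induction _ (motive := fun v => toU t • v ∈
        ⨆ μ : Module.Dual ℂ h, weightSpace h μ V) hv (fun μ v hv => ?_)
        (by rw [smul_zero]; exact zero_mem _)
        (fun v w hv hw => by rw [smul_add]; exact add_mem hv hw)
      rw [hv ⟨t, ht'⟩]
      exact Submodule.smul_mem _ _ (Submodule.mem_iSup_of_mem μ hv)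
    · rintro x ⟨-, α, k, -, -, hx⟩
      exact smul_mem_iSup_weightSpace hx hv
  exact h1 (Submodule.mem_top (x := x))

/-- A module generated by weight vectors is the sum of its weight spaces. -/
theorem IsTriangular.iSup_eq_top_of_span {nm : Submodule ℂ L} {δ : h} (ht : IsTriangular h n nm δ)
    {X : Set V} (hX : Submodule.span (U L) X = ⊤)
    (hw : ∀ v ∈ X, v ∈ ⨆ μ : Module.Dual ℂ h, weightSpace h μ V) :
    (⨆ μ : Module.Dual ℂ h, weightSpace h μ V) = ⊤ := by
  have h1 : Submodule.span (U L) X ≤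
      stableSubmodule (⨆ μ : Module.Dual ℂ h, weightSpace h μ V)
        fun x m hm => ht.smul_mem_iSup x hm :=
    Submodule.span_le.mpr hw
  rw [hX] at h1
  exact eq_top_iff.mpr fun v _ => h1 (Submodule.mem_top (x := v))

/-- Local finiteness is inherited from generators. -/
theorem locallyFinite_of_span [FiniteDimensional ℂ L] {X : Set V}
    (hX : Submodule.span (U L) X = ⊤)
    (hlf : ∀ v ∈ X, ∃ F : Submodule ℂ V, FiniteDimensional ℂ F ∧ v ∈ F ∧
      ∀ x ∈ n, ∀ w ∈ F, toU x • w ∈ F) (v : V) :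
    ∃ F : Submodule ℂ V, FiniteDimensional ℂ F ∧ v ∈ F ∧ ∀ x ∈ n, ∀ w ∈ F, toU x • w ∈ F := by
  let Y : Submodule ℂ V :=
    { carrier := {v | ∃ F : Submodule ℂ V, FiniteDimensional ℂ F ∧ v ∈ F ∧
        ∀ x ∈ n, ∀ w ∈ F, toU x • w ∈ F}
      add_mem' := by
        rintro v w ⟨F, h1, h2, h3⟩ ⟨F', h1', h2', h3'⟩
        refine ⟨F ⊔ F', inferInstance, Submodule.add_mem_sup h2 h2', fun x hx w hw => ?_⟩
        obtain ⟨a, ha, b, hb, rfl⟩ := Submodule.mem_sup.mp hw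
        rw [smul_add]
        exact Submodule.add_mem_sup (h3 x hx a ha) (h3' x hx b hb)
      zero_mem' := ⟨⊥, inferInstance, zero_mem _, fun x _ w hw => by
        rw [(Submodule.mem_bot ℂ).mp hw, smul_zero]; exact zero_mem _⟩
      smul_mem' := by
        rintro c v ⟨F, h1, h2, h3⟩
        exact ⟨F, h1, F.smul_mem c h2, h3⟩ }
  have hY : ∀ x : L, ∀ m ∈ Y, toU x • m ∈ Y := by
    rintro y m ⟨F, h1, h2, h3⟩
    let act : L →ₗ[ℂ] V →ₗ[ℂ] V :=
      (Algebra.lsmul ℂ ℂ V).toLinearMap ∘ₗ (UniversalEnvelopingAlgebra.ι ℂ : L →ₗ⁅ℂ⁆ U L).toLinearMap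
    have hact : ∀ x v, act x v = toU x • v := fun _ _ => rfl
    have hfin : FiniteDimensional ℂ (Submodule.map₂ act ⊤ F) :=
      Module.Finite.iff_fg.mpr (Submodule.FG.map₂ act Module.Finite.fg_top
        (Module.Finite.iff_fg.mp h1))
    -- `F + L F` is finite-dimensional because `L` is, and it is `n`-stable because `x y' c = y' x c
    -- + [x, y'] c`.
    refine ⟨F ⊔ Submodule.map₂ act ⊤ F, inferInstance,
      Submodule.mem_sup_right (hact y m ▸ Submodule.apply_mem_map₂ act trivial h2), ?_⟩
    intro x hx w hw
    obtain ⟨a, ha, b, hb, rfl⟩ := Submodule.mem_sup.mp hw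
    rw [smul_add]
    refine add_mem (Submodule.mem_sup_left (h3 x hx a ha)) (Submodule.mem_sup_right ?_)
    have hle : Submodule.map₂ act ⊤ F ≤
        (Submodule.map₂ act ⊤ F).comap (Algebra.lsmul ℂ ℂ V (toU x)) := by
      refine Submodule.map₂_le.mpr fun y' _ c hc => ?_
      change toU x • toU y' • c ∈ Submodule.map₂ act ⊤ F
      rw [toU_swap]
      exact add_mem (Submodule.apply_mem_map₂ act trivial (h3 x hx c hc))
        (Submodule.apply_mem_map₂ act trivial hc)
    exact hle hb
  have h1 : Submodule.span (U L) X ≤ stableSubmodule Y hY := Submodule.span_le.mpr hlf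
  rw [hX] at h1
  exact h1 (Submodule.mem_top (x := v))

end Generation

/-! ### Parabolic maps -/

section ParabolicMap

set_option linter.unusedSectionVars false

attribute [local instance] LieRing.ofAssociativeRing

variable {g : Type u} [LieRing g] [LieAlgebra ℂ g] [FiniteDimensional ℂ g] [IsKilling ℂ g]
  {H : LieSubalgebra ℂ g} [H.IsCartanSubalgebra] {b : (rootSystem H).Base} {S : Set H.root}
  {ν : Module.Dual ℂ H}
  {M : Type u} [AddCommGroup M] [Module ℂ M] [Module (U (levi S)) M]
  [IsScalarTower ℂ (U (levi S)) M]
  {V : Type u} [AddCommGroup V] [Module ℂ V] [Module (U g) V] [IsScalarTower ℂ (U g) V]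

theorem rootSum_smul_mem {A : Set H.root} {v : V} {X : Submodule ℂ V}
    (h : ∀ α ∈ A, ∀ x ∈ rootSpace H (α.1 : H → ℂ), toU x • v ∈ X) :
    ∀ x ∈ rootSum A, toU x • v ∈ X := by
  have : rootSum A ≤ transporter v X := iSup₂_le fun α hα x hx => h α hα x hx
  exact fun x hx => this hx

/-- The eigenspaces of an element of `H`. -/
def degSpace (z : H) (c : ℂ) (V : Type u) [AddCommGroup V] [Module ℂ V] [Module (U g) V]
    [IsScalarTower ℂ (U g) V] : Submodule ℂ V :=
  Module.End.eigenspace (Algebra.lsmul ℂ ℂ V (toU (z : g))) c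

theorem mem_degSpace {z : H} {c : ℂ} {v : V} : v ∈ degSpace z c V ↔ toU (z : g) • v = c • v :=
  Module.End.mem_eigenspace_iff

/-- The sum of the eigenspaces of `z` for the eigenvalues `c - k`, `k > 0`. -/
def lowerDeg (z : H) (c : ℂ) (V : Type u) [AddCommGroup V] [Module ℂ V] [Module (U g) V]
    [IsScalarTower ℂ (U g) V] : Submodule ℂ V :=
  ⨆ k ∈ {k : ℕ | 0 < k}, degSpace z (c - k) V

theorem disjoint_degSpace (z : H) (c : ℂ) : Disjoint (degSpace z c V) (lowerDeg z c V) := by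
  have h1 := Module.End.eigenspaces_iSupIndep (Algebra.lsmul ℂ ℂ V (toU (z : g))) c
  refine h1.mono_right (iSup₂_le fun k hk => ?_)
  have hne : c - k ≠ c := by
    intro h
    have : (k : ℂ) = 0 := by linear_combination -h
    exact (ne_of_gt hk) (by exact_mod_cast this)
  exact le_iSup₂_of_le (c - (k : ℂ)) hne le_rfl

theorem smul_mem_degSpace {z : H} {c : ℂ} {α : H.root} {x : g}
    (hx : x ∈ rootSpace H (α.1 : H → ℂ)) {v : V} (hv : v ∈ degSpace z c V) :
    toU x • v ∈ degSpace z (c + (rootSystem H).root α z) V := by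
  rw [mem_degSpace] at hv ⊢
  rw [toU_swap, hv, lie_eq_of_mem_rootSpace hx, toU_smul, smul_assoc, toU_smul_smul, add_smul]

theorem root_outNeg {z : H} (hz : ∀ α ∈ outPos b S, ∃ k : ℕ, 0 < k ∧ (rootSystem H).root α z = k)
    {α : H.root} (hα : α ∈ outNeg b S) : ∃ k : ℕ, 0 < k ∧ (rootSystem H).root α z = -k := by
  obtain ⟨k, hk, h⟩ := hz _ (mem_outNeg_iff.mp hα)
  refine ⟨k, hk, ?_⟩
  rw [root_negRoot, LinearMap.neg_apply] at h
  rw [← h, neg_neg]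

theorem degSpace_le_lowerDeg {z : H} {c : ℂ} {k : ℕ} (hk : 0 < k) :
    degSpace z (c - k) V ≤ lowerDeg z c V :=
  le_iSup₂ (f := fun (k : ℕ) (_ : k ∈ {k : ℕ | 0 < k}) => degSpace z (c - k) V) k hk

/-- The part of degree `c` of the module generated by a `p`-stable subspace `F` of degree `c`
is `F`. -/
theorem mem_of_degSpace (hS : S ⊆ b.support) {z : H}
    (hz : ∀ α ∈ outPos b S, ∃ k : ℕ, 0 < k ∧ (rootSystem H).root α z = k)
    {F : Submodule ℂ V} (hF : ∀ x ∈ parabolicSubalgebra b hS, ∀ m ∈ F, toU x • m ∈ F) {c : ℂ}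
    (hFc : F ≤ degSpace z c V) {v : V} (hv : v ∈ Submodule.span (U g) (F : Set V))
    (hvc : v ∈ degSpace z c V) : v ∈ F := by
  -- `g` is the sum of the opposite nilradical, which lowers the degree, and of `p`, which preserves
  -- `F`. So the generated module is `F` plus lower degrees.
  have key : ∀ y : U g, ∀ m ∈ F, y • m ∈ F ⊔ lowerDeg z c V := by
    refine U_smul_mem_of_stable (rootSum (outNeg b S)) (parabolicSubalgebra b hS).toSubmodule
      (isCompl_parabolic hS).sup_eq_top F _ hF le_sup_left ?_
    intro x hx m hm
    refine rootSum_smul_mem (fun α hα x hx => ?_) x hx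
    obtain ⟨k, hk, h⟩ := root_outNeg hz hα
    obtain ⟨a, ha, w, hw, rfl⟩ := Submodule.mem_sup.mp hm
    rw [smul_add]
    refine add_mem (Submodule.mem_sup_right ?_) (Submodule.mem_sup_right ?_)
    · have := smul_mem_degSpace hx (hFc ha)
      rw [h, ← sub_eq_add_neg] at this
      exact degSpace_le_lowerDeg hk this
    · have hle : lowerDeg z c V ≤ (lowerDeg z c V).comap (Algebra.lsmul ℂ ℂ V (toU x)) := by
        refine iSup₂_le fun j hj w hw => ?_
        have := smul_mem_degSpace hx hw
        rw [h, show c - (j : ℂ) + -(k : ℂ) = c - ((j + k : ℕ) : ℂ) by push_cast; ring] at this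
        exact degSpace_le_lowerDeg (Nat.add_pos_left hj k) this
      exact hle hw
  have h1 : ∀ v ∈ Submodule.span (U g) (F : Set V), ∀ y : U g, y • v ∈ F ⊔ lowerDeg z c V := by
    intro v hv
    induction hv using Submodule.span_induction with
    | mem x hx => exact fun y => key y x hx
    | zero => intro y; rw [smul_zero]; exact zero_mem _
    | add x w _ _ hx hw => intro y; rw [smul_add]; exact add_mem (hx y) (hw y)
    | smul a x _ hx => intro y; rw [← mul_smul]; exact hx _
  have h2 := h1 v hv 1
  rw [one_smul] at h2
  obtain ⟨a, ha, w, hw, rfl⟩ := Submodule.mem_sup.mp h2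
  have h3 : w = 0 := by
    rw [← Submodule.mem_bot ℂ]
    refine (disjoint_degSpace z c).le_bot ⟨?_, hw⟩
    have := sub_mem hvc (hFc ha)
    rwa [add_sub_cancel_left] at this
  rw [h3, add_zero]
  exact ha

end ParabolicMap

end CategoryO

end

noncomputable section

namespace CategoryO

/-! ### Parabolic maps: generation, finiteness and weights -/

section ParabolicMapBasic

set_option linter.unusedSectionVars false

attribute [local instance] LieRing.ofAssociativeRing

variable {g : Type u} [LieRing g] [LieAlgebra ℂ g] [FiniteDimensional ℂ g] [IsKilling ℂ g]
  {H : LieSubalgebra ℂ g} [H.IsCartanSubalgebra] {b : (rootSystem H).Base} {S : Set H.root}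
  {ν : Module.Dual ℂ H}
  {M : Type u} [AddCommGroup M] [Module ℂ M] [Module (U (levi S)) M]
  [IsScalarTower ℂ (U (levi S)) M]
  {V : Type u} [AddCommGroup V] [Module ℂ V] [Module (U g) V] [IsScalarTower ℂ (U g) V]
  {f : M →ₗ[ℂ] V}

variable (b S ν) in
/-- A linear map of an `a`-module to a `g`-module that is linear for the parabolic subalgebra `p`,
where `p` acts on the `a`-module as for parabolic induction. -/
structure IsParabolicMap (f : M →ₗ[ℂ] V) : Prop where
  levi_smul : ∀ (y : levi S) (m : M), toU (y : g) • f m = f (toU y • m)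
  perp_smul : ∀ z ∈ leviPerp S, ∀ m : M, toU (z : g) • f m = ν z • f m
  out_smul : ∀ x ∈ rootSum (outPos b S), ∀ m : M, toU x • f m = 0

theorem IsParabolicMap.leviToU_smul (hf : IsParabolicMap b S ν f) (y : U (levi S)) :
    ∀ m : M, leviToU S y • f m = f (y • m) := by
  induction y using U_induction with
  | hι x =>
    intro m
    rw [← hf.levi_smul]
    congr 1
    simp [leviToU]
  | hc c => intro m; rw [AlgHom.commutes, algebraMap_smul, algebraMap_smul, map_smul]
  | hadd y z hy hz => intro m; rw [map_add, add_smul, add_smul, map_add, hy, hz]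
  | hmul y z hy hz => intro m; rw [map_mul, mul_smul, mul_smul, hz, hy]

theorem IsParabolicMap.smul_mem_map (hf : IsParabolicMap b S ν f) (hS : S ⊆ b.support)
    (M' : Submodule (U (levi S)) M) {x : g} (hx : x ∈ parabolicSubalgebra b hS) {v : V}
    (hv : v ∈ (M'.restrictScalars ℂ).map f) : toU x • v ∈ (M'.restrictScalars ℂ).map f := by
  obtain ⟨m, hm, rfl⟩ := hv
  obtain ⟨⟨y, z, x⟩, rfl⟩ := hx
  change toU ((y : g) + ((z : H) : g) + (x : g)) • f m ∈ _
  rw [toU_add, toU_add, add_smul, add_smul, hf.levi_smul, hf.perp_smul _ z.2,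
    hf.out_smul _ ((leviNilradical_eq hS).le x.2), add_zero, ← map_smul, ← map_add]
  exact ⟨_, add_mem (M'.smul_mem _ hm) ((M'.restrictScalars ℂ).smul_mem _ hm), rfl⟩

theorem IsParabolicMap.smul_mem_range (hf : IsParabolicMap b S ν f) (hS : S ⊆ b.support)
    {x : g} (hx : x ∈ parabolicSubalgebra b hS) {v : V}
    (hv : v ∈ LinearMap.range f) : toU x • v ∈ LinearMap.range f := by
  have h := hf.smul_mem_map hS ⊤ hx (v := v)
  rw [Submodule.restrictScalars_top, Submodule.map_top] at h
  exact h hv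

/-- The preimage of an `a`-stable subspace. -/
def IsParabolicMap.comap (hf : IsParabolicMap b S ν f) (G : Submodule ℂ V)
    (hG : ∀ y : levi S, ∀ v ∈ G, toU (y : g) • v ∈ G) : Submodule (U (levi S)) M :=
  stableSubmodule (G.comap f) fun y m hm => by
    change f (toU y • m) ∈ G
    rw [← hf.levi_smul]
    exact hG y _ hm

/-- `h` is the sum of `a ∩ h` and `h^⊥`, and `h^⊥` acts on the image by `ν`. -/
theorem IsParabolicMap.map_mem_weightSpace (hf : IsParabolicMap b S ν f) (hS : S ⊆ b.support)
    {μ : Module.Dual ℂ H} (hμ : ∀ z ∈ leviPerp S, μ z = ν z) {m : M}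
    (hm : m ∈ weightSpace (leviCartan S) (restrictWeight S μ) M) : f m ∈ weightSpace H μ V := by
  intro t
  obtain ⟨y, hy, z, hz, rfl⟩ := exists_add_eq hS t
  have hy' : (y : g) ∈ levi S := (mem_leviCoroots_iff hS).mpr hy
  have h1 := hm (toLeviCartan y hy')
  rw [show ((y + z : H) : g) = (y : g) + (z : g) from rfl, toU_add, add_smul, map_add, add_smul,
    hf.perp_smul z hz, hμ z hz, hf.levi_smul ⟨y, hy'⟩]
  congr 1
  rw [← map_smul]
  exact congrArg f h1

theorem IsParabolicMap.mem_weightSpace (hf : IsParabolicMap b S ν f)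
    (hinj : Function.Injective f) {μ : Module.Dual ℂ H} {m : M} (hm : f m ∈ weightSpace H μ V) :
    m ∈ weightSpace (leviCartan S) (restrictWeight S μ) M := by
  intro t
  refine hinj ?_
  rw [← hf.levi_smul, map_smul]
  exact hm ⟨((t : levi S) : g), t.2⟩

/-- The nilradical kills the image, so `n₊` acts there through `a ∩ n₊`. In particular highest
weight conditions in `M` carry over to `V`. -/
theorem IsParabolicMap.nPos_smul (hf : IsParabolicMap b S ν f) (hS : S ⊆ b.support) {x : g}
    (hx : x ∈ nPos b) : ∃ y ∈ leviNPos b S, ∀ m : M, toU x • f m = f (toU y • m) := by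
  obtain ⟨y, hy, z, hz, rfl⟩ := mem_nPos_cases hS hx
  exact ⟨y, hy, fun m => by
    rw [toU_add, add_smul, hf.out_smul z hz, add_zero, hf.levi_smul]⟩

/-- The module generated by the image of a parabolic map is a weight module and locally finite. -/
theorem IsParabolicMap.weightLF (hf : IsParabolicMap b S ν f) (hS : S ⊆ b.support)
    (hgen : Submodule.span (U g) (Set.range f) = ⊤)
    (hM : WeightLF (leviCartan S) (leviNPos b S) M) : WeightLF H (nPos b) V where
  iSup_eq_top := by
    obtain ⟨δ, -, ht⟩ := exists_isTriangular b
    refine ht.iSup_eq_top_of_span hgen ?_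
    rintro _ ⟨m, rfl⟩
    obtain ⟨s, w, hw, -, rfl⟩ := exists_weight_sum hM.iSup_eq_top m
    rw [map_sum]
    refine sum_mem fun κ _ => ?_
    obtain ⟨μ, rfl, hμ⟩ := exists_weight hS κ ν
    exact Submodule.mem_iSup_of_mem μ (hf.map_mem_weightSpace hS hμ (hw _))
  locallyFinite := by
    refine locallyFinite_of_span hgen ?_
    rintro _ ⟨m, rfl⟩
    obtain ⟨F, hF, hm, hn⟩ := hM.locallyFinite m
    refine ⟨F.map f, inferInstance, ⟨m, hm, rfl⟩, ?_⟩
    rintro x hx _ ⟨w, hw, rfl⟩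
    obtain ⟨y, hy, h⟩ := hf.nPos_smul hS hx
    exact ⟨_, hn y hy w hw, (h w).symm⟩

theorem IsParabolicMap.finite (hf : IsParabolicMap b S ν f)
    (hgen : Submodule.span (U g) (Set.range f) = ⊤) [hM : Module.Finite (U (levi S)) M] :
    Module.Finite (U g) V := by
  classical
  obtain ⟨s, hs⟩ := hM.fg_top
  refine ⟨⟨s.image f, ?_⟩⟩
  rw [eq_top_iff, ← hgen, Submodule.span_le]
  rintro _ ⟨m, rfl⟩
  have hm : m ∈ Submodule.span (U (levi S)) (s : Set M) := hs ▸ Submodule.mem_top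
  induction hm using Submodule.span_induction with
  | mem x hx => exact Submodule.subset_span (by simpa using ⟨x, hx, rfl⟩)
  | zero => rw [map_zero]; exact zero_mem _
  | add x y _ _ hx hy => rw [map_add]; exact add_mem hx hy
  | smul a x _ hx =>
    rw [← hf.leviToU_smul]
    exact Submodule.smul_mem _ _ hx

/-- The weights of `M` lie in one coset of the root lattice. -/
theorem exists_weight_mem_of_factors (hS : S ⊆ b.support) {Λ : Set (Module.Dual ℂ H)}
    (hΛ : ∀ μ ∈ Λ, μ - ν ∈ rootLattice (rootSystem H) S)
    (hM : WeightLF (leviCartan S) (leviNPos b S) M)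
    (hfac : CompositionFactorsIn (leviCartan S) (leviNPos b S) (restrictWeight S '' Λ) M)
    {κ : Module.Dual ℂ (leviCartan S)} {m : M} (hm : m ∈ weightSpace (leviCartan S) κ M)
    (hm0 : m ≠ 0) : ∃ μ : Module.Dual ℂ H, μ - ν ∈ rootLattice (rootSystem H) S ∧
      restrictWeight S μ = κ := by
  obtain ⟨nm, δ, ht⟩ := exists_isTriangular_levi (b := b) hS
  obtain ⟨δ', hδ'⟩ := exists_height b
  obtain ⟨y, hy, z, hz, hyz⟩ := exists_add_eq hS δ'
  have hy' : (y : g) ∈ levi S := (mem_leviCoroots_iff hS).mpr hy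
  -- Climb from `κ` to a highest weight vector. Only elements of `ℤS` are added on the way, and the
  -- weight reached is the restriction of an element of `Λ`.
  obtain ⟨κ', v, ⟨γ, hγ, rfl⟩, hv0, hv⟩ := hM.exists_isHW_of_mem (toLeviCartan y hy')
    (fun κ' => ∃ γ ∈ rootLattice (rootSystem H) S, κ' = κ + restrictWeight S γ) (by
      intro x hx
      refine Submodule.span_mono ?_ (mem_span_of_coe_mem hS Set.inter_subset_left
        (coe_mem_of_mem_leviNPos hS hx))
      rintro x ⟨α, hα, hx⟩
      obtain ⟨k, hk, hk'⟩ := hδ' α hα.2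
      refine ⟨rootSpace_le_rootSum (A := {α | b.IsPos α}) hα.2 hx,
        restrictWeight S ((rootSystem H).root α), k, hk, ?_, ?_, leviCartan_lie hx⟩
      · rw [← hk', ← hyz, map_add, (mem_leviPerp_iff hS).mp hz α hα.1, add_zero]
        rfl
      · rintro _ ⟨γ, hγ, rfl⟩
        exact ⟨(rootSystem H).root α + γ, add_mem hα.1 hγ, by rw [map_add]; abel⟩)
    hm hm0 ⟨0, zero_mem _, by rw [map_zero, add_zero]⟩
  obtain ⟨μ, hμ, h⟩ := ht.mem_of_isHW hfac hv hv0
  refine ⟨μ - γ, ?_, by rw [map_sub, h, add_sub_cancel_right]⟩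
  rw [sub_right_comm]
  exact sub_mem (hΛ μ hμ) hγ

theorem apply_perp_of_sub_mem (hS : S ⊆ b.support) {μ : Module.Dual ℂ H}
    (hμ : μ - ν ∈ rootLattice (rootSystem H) S) {z : H} (hz : z ∈ leviPerp S) : μ z = ν z :=
  sub_eq_zero.mp (apply_leviPerp_of_mem hS hμ hz)

theorem IsParabolicMap.range_le_degSpace (hf : IsParabolicMap b S ν f) {z : H}
    (hz : z ∈ leviPerp S) : LinearMap.range f ≤ degSpace z (ν z) V := by
  rintro _ ⟨m, rfl⟩
  exact mem_degSpace.mpr (hf.perp_smul z hz m)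

/-- The image of `M'` is `p`-stable of degree `ν(z)`, so it is recovered in this degree from the
`g`-submodule that it generates. This transfers questions on submodules of `M` to `V` and back. -/
theorem IsParabolicMap.mem_map_of_mem_degSpace (hf : IsParabolicMap b S ν f) (hS : S ⊆ b.support)
    {z : H} (hz : z ∈ leviPerp S)
    (hz' : ∀ α ∈ outPos b S, ∃ k : ℕ, 0 < k ∧ (rootSystem H).root α z = k)
    (M' : Submodule (U (levi S)) M) {v : V} (hv : v ∈ Submodule.span (U g) (f '' M'))
    (hvc : v ∈ degSpace z (ν z) V) : v ∈ f '' M' :=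
  mem_of_degSpace hS hz' (F := (M'.restrictScalars ℂ).map f)
    (fun _ hx _ hm => hf.smul_mem_map hS M' hx hm)
    (LinearMap.map_le_range.trans (hf.range_le_degSpace hz)) hv hvc

theorem IsParabolicMap.mem_range_of_mem_degSpace (hf : IsParabolicMap b S ν f) (hS : S ⊆ b.support)
    (hgen : Submodule.span (U g) (Set.range f) = ⊤) {z : H} (hz : z ∈ leviPerp S)
    (hz' : ∀ α ∈ outPos b S, ∃ k : ℕ, 0 < k ∧ (rootSystem H).root α z = k)
    {v : V} (hvc : v ∈ degSpace z (ν z) V) : v ∈ LinearMap.range f := by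
  obtain ⟨m, -, h⟩ := hf.mem_map_of_mem_degSpace hS hz hz' ⊤
    (by rw [Submodule.top_coe, Set.image_univ, hgen]; trivial) hvc
  exact ⟨m, h⟩

/-- Elements of `ℤS` vanish on `h^⊥`. -/
theorem truncSubspace_le_degSpace (hS : S ⊆ b.support) {z : H} (hz : z ∈ leviPerp S) :
    truncSubspace S ν V ≤ degSpace z (ν z) V := by
  refine iSup₂_le fun μ hμ v hv => mem_degSpace.mpr ?_
  rw [hv z, apply_perp_of_sub_mem hS hμ hz]

/-- The image of a parabolic map that generates is the truncation. -/
theorem IsParabolicMap.range_eq_truncSubspace (hf : IsParabolicMap b S ν f) (hS : S ⊆ b.support)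
    (hgen : Submodule.span (U g) (Set.range f) = ⊤) {Λ : Set (Module.Dual ℂ H)}
    (hΛ : ∀ μ ∈ Λ, μ - ν ∈ rootLattice (rootSystem H) S)
    (hM : WeightLF (leviCartan S) (leviNPos b S) M)
    (hfac : CompositionFactorsIn (leviCartan S) (leviNPos b S) (restrictWeight S '' Λ) M) :
    LinearMap.range f = truncSubspace S ν V := by
  refine le_antisymm ?_ fun v hv => ?_
  · rintro _ ⟨m, rfl⟩
    obtain ⟨s, w, hw, -, rfl⟩ := exists_weight_sum hM.iSup_eq_top m
    rw [map_sum]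
    refine sum_mem fun κ _ => ?_
    by_cases h0 : w κ = 0
    · rw [h0, map_zero]; exact zero_mem _
    obtain ⟨μ, hμ, rfl⟩ := exists_weight_mem_of_factors hS hΛ hM hfac (hw κ) h0
    exact Submodule.mem_iSup_of_mem μ (Submodule.mem_iSup_of_mem hμ
      (hf.map_mem_weightSpace hS (fun z hz => apply_perp_of_sub_mem hS hμ hz) (hw _)))
  · obtain ⟨z, hz, hz'⟩ := exists_grading (b := b) hS
    exact hf.mem_range_of_mem_degSpace hS hgen hz hz' (truncSubspace_le_degSpace hS hz hv)

/-- Highest weight vectors modulo a proper submodule. -/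
theorem exists_hw_lift (hS : S ⊆ b.support) {Λ : Set (Module.Dual ℂ H)}
    (hM : WeightLF (leviCartan S) (leviNPos b S) M)
    (hfac : CompositionFactorsIn (leviCartan S) (leviNPos b S) (restrictWeight S '' Λ) M)
    {M' : Submodule (U (levi S)) M} (hM' : M' ≠ ⊤) : ∃ κ ∈ Λ, ∃ m : M, m ∉ M' ∧
      m ∈ weightSpace (leviCartan S) (restrictWeight S κ) M ∧
      ∀ x ∈ leviNPos b S, toU x • m ∈ M' := by
  obtain ⟨nm, δ, ht⟩ := exists_isTriangular_levi (b := b) hS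
  have : Nontrivial (M ⧸ M') := Submodule.Quotient.nontrivial_iff.mpr hM'
  obtain ⟨_, v, hv0, hv⟩ := ht.exists_isHW (hM.of_surjective M'.mkQ (Submodule.mkQ_surjective M'))
  obtain ⟨κ, hκ, rfl⟩ :=
    ht.mem_of_isHW (hfac.of_surjective M'.mkQ (Submodule.mkQ_surjective M')) hv hv0
  obtain ⟨m, hm, rfl⟩ := exists_weight_lift hM.iSup_eq_top M'.mkQ (Submodule.mkQ_surjective M') hv.1
  refine ⟨κ, hκ, m, fun h => hv0 ((Submodule.Quotient.mk_eq_zero M').mpr h), hm, fun x hx => ?_⟩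
  rw [← Submodule.Quotient.mk_eq_zero M']
  exact hv.2 x hx

end ParabolicMapBasic

end CategoryO

end

noncomputable section

namespace CategoryO

/-! ### Composition factors of induced modules -/

section Factors

set_option linter.unusedSectionVars false

attribute [local instance] LieRing.ofAssociativeRing

variable {g : Type u} [LieRing g] [LieAlgebra ℂ g] [FiniteDimensional ℂ g] [IsKilling ℂ g]
  {H : LieSubalgebra ℂ g} [H.IsCartanSubalgebra] {b : (rootSystem H).Base} {S : Set H.root}
  {ν η : Module.Dual ℂ H}
  {M : Type u} [AddCommGroup M] [Module ℂ M] [Module (U (levi S)) M]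
  [IsScalarTower ℂ (U (levi S)) M]
  {V : Type u} [AddCommGroup V] [Module ℂ V] [Module (U g) V] [IsScalarTower ℂ (U g) V]
  {f : M →ₗ[ℂ] V}

/-- Products of root vectors for the roots in `A`. -/
inductive IsWord (A : Set H.root) : List H.root → U g → Prop
  | nil : IsWord A [] 1
  | cons {β : H.root} {l : List H.root} {x : g} {y : U g} : β ∈ A →
      x ∈ rootSpace H (β.1 : H → ℂ) → IsWord A l y → IsWord A (β :: l) (toU x * y)

/-- The weight of a word. -/
def wordWeight (l : List H.root) : Module.Dual ℂ H := (l.map (rootSystem H).root).sum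

theorem wordWeight_cons (β : H.root) (l : List H.root) :
    wordWeight (β :: l) = (rootSystem H).root β + wordWeight l := rfl

theorem IsWord.mem {A : Set H.root} {l : List H.root} {y : U g} (h : IsWord A l y) :
    ∀ β ∈ l, β ∈ A := by
  induction h with
  | nil => exact fun β hβ => absurd hβ List.not_mem_nil
  | cons hβ _ _ ih => exact List.forall_mem_cons.mpr ⟨hβ, ih⟩

theorem IsWord.smul_mem_weightSpace {A : Set H.root} {l : List H.root} {y : U g}
    (h : IsWord A l y) {κ : Module.Dual ℂ H} {v : V} (hv : v ∈ weightSpace H κ V) :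
    y • v ∈ weightSpace H (wordWeight l + κ) V := by
  induction h with
  | nil => rw [one_smul, show wordWeight ([] : List H.root) = 0 from rfl, zero_add]; exact hv
  | cons hβ hx _ ih =>
    rw [mul_smul, wordWeight_cons, add_assoc]
    exact weight_shift (lie_eq_of_mem_rootSpace hx) ih

theorem IsWord.commutator_cartan {A : Set H.root} {l : List H.root} {y : U g}
    (h : IsWord A l y) (t : H) :
    toU (t : g) * y = y * toU (t : g) + wordWeight l t • y := by
  induction h with
  | nil => simp [wordWeight]
  | @cons β l x y hβ hx _ ih =>
    have h1 : toU (t : g) * toU x = toU x * toU (t : g) + (rootSystem H).root β t • toU x := by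
      rw [← toU_smul, ← lie_eq_of_mem_rootSpace hx, toU_lie]; abel
    rw [← mul_assoc, h1, add_mul, mul_assoc, ih, wordWeight_cons, LinearMap.add_apply, add_smul,
      mul_add, mul_smul_comm, smul_mul_assoc, mul_assoc]
    abel

/-- The span of the words of given length and weight. -/
def wordSpan (A : Set H.root) (k : ℕ) (γ : Module.Dual ℂ H) : Submodule ℂ (U g) :=
  Submodule.span ℂ {y | ∃ l, IsWord A l y ∧ l.length = k ∧ wordWeight l = γ}

theorem wordSpan_cons {A : Set H.root} {k : ℕ} {γ γ' : Module.Dual ℂ H} {β : H.root} (hβ : β ∈ A)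
    {x : g} (hx : x ∈ rootSpace H (β.1 : H → ℂ)) (hγ : γ' = (rootSystem H).root β + γ) {y : U g}
    (hy : y ∈ wordSpan A k γ) : toU x * y ∈ wordSpan A (k + 1) γ' := by
  have h : wordSpan A k γ ≤ (wordSpan A (k + 1) γ').comap (LinearMap.mulLeft ℂ (toU x)) := by
    refine Submodule.span_le.mpr ?_
    rintro y ⟨l, hl, rfl, rfl⟩
    exact Submodule.subset_span ⟨β :: l, .cons hβ hx hl, rfl, by rw [hγ, wordWeight_cons]⟩
  exact h hy

/-- `ad x` is a derivation that preserves the opposite nilradical, so it replaces one letter at a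
time. The length of the word is kept, and nonempty words remain nonempty. -/
theorem IsWord.commutator_levi (hS : S ⊆ b.support) {l : List H.root} {y : U g}
    (h : IsWord (outNeg b S) l y) {α : H.root} (hα : α ∈ leviRoots S) {x : g}
    (hx : x ∈ rootSpace H (α.1 : H → ℂ)) :
    toU x * y - y * toU x ∈
      wordSpan (outNeg b S) l.length ((rootSystem H).root α + wordWeight l) := by
  induction h with
  | nil => simp
  | @cons β l x' y hβ hx' hl ih =>
    have h1 : toU x * (toU x' * y) - toU x' * y * toU x =
        toU ⁅x, x'⁆ * y + toU x' * (toU x * y - y * toU x) := by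
      rw [toU_lie]; noncomm_ring
    rw [h1]
    refine add_mem ?_ (wordSpan_cons hβ hx' (by rw [wordWeight_cons]; abel) ih)
    let K : Submodule ℂ g := (wordSpan (outNeg b S) (l.length + 1)
      ((rootSystem H).root α + wordWeight (β :: l))).comap
        (LinearMap.mulRight ℂ y ∘ₗ (UniversalEnvelopingAlgebra.ι ℂ : g →ₗ⁅ℂ⁆ U g).toLinearMap)
    change ⁅x, x'⁆ ∈ K
    refine lie_mem_of_rootSpace hx hx' (fun h => ?_) fun γ hγ w hw => ?_
    · exact absurd (h ▸ negRoot_mem_leviRoots hα)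
        (Set.disjoint_right.mp disjoint_leviRoots_outNeg hβ)
    · change toU w * y ∈ wordSpan (outNeg b S) (l.length + 1)
        ((rootSystem H).root α + wordWeight (β :: l))
      exact wordSpan_cons (outNeg_add_levi hS hα hβ hγ) hw
        (by rw [wordWeight_cons, hγ, add_assoc]) (Submodule.subset_span ⟨l, hl, rfl, rfl⟩)

/-- The sum of the generalized eigenspaces of the Casimir element of `a + h`. -/
def leviKernel (b : (rootSystem H).Base) (S : Set H.root) (E : Set ℂ) (V : Type u)
    [AddCommGroup V] [Module ℂ V] [Module (U g) V] [IsScalarTower ℂ (U g) V] : Submodule ℂ V :=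
  generalizedKernel (leviCasimir b S) E V

theorem leviKernel_cartan {E : Set ℂ} (t : H) {v : V} (hv : v ∈ leviKernel b S E V) :
    toU (t : g) • v ∈ leviKernel b S E V :=
  smul_mem_generalizedKernel (commute_leviCasimir_of_cartan t) hv

theorem leviKernel_levi (hS : S ⊆ b.support) {E : Set ℂ} {x : g} (hx : x ∈ levi S) {v : V}
    (hv : v ∈ leviKernel b S E V) : toU x • v ∈ leviKernel b S E V :=
  smul_mem_generalizedKernel (commute_leviCasimir_of_levi hS hx) hv

theorem wordSpan_smul_mem {A : Set H.root} {k : ℕ} {γ : Module.Dual ℂ H} {v : V}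
    {X : Submodule ℂ V} (h : ∀ l y, IsWord A l y → l.length = k → wordWeight l = γ → y • v ∈ X)
    {y : U g} (hy : y ∈ wordSpan A k γ) : y • v ∈ X := by
  have : wordSpan A k γ ≤ X.comap
      ((LinearMap.toSpanSingleton (U g) V v).restrictScalars ℂ) := by
    refine Submodule.span_le.mpr ?_
    rintro y ⟨l, hl, h1, h2⟩
    exact h l y hl h1 h2
  exact this hy

/-- The submodule of the vectors that nonempty words map to a generalized eigenspace. -/
def wordKernel (hS : S ⊆ b.support) (hf : IsParabolicMap b S ν f) (E : Set ℂ) :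
    Submodule (U (levi S)) M :=
  stableSubmodule
    { carrier := {m | ∀ l y, IsWord (outNeg b S) l y → l ≠ [] → y • f m ∈ leviKernel b S E V}
      add_mem' := fun {m m'} h h' l y hl hl0 => by
        rw [map_add, smul_add]; exact add_mem (h l y hl hl0) (h' l y hl hl0)
      zero_mem' := fun l y _ _ => by rw [map_zero, smul_zero]; exact zero_mem _
      smul_mem' := fun c m h l y hl hl0 => by
        rw [map_smul, smul_algebra_smul_comm]
        exact Submodule.smul_mem _ _ (h l y hl hl0) } (by
    intro x m hm l y hl hl0
    rw [← hf.levi_smul]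
    let K : Submodule ℂ g := (leviKernel b S E V).comap
      ((LinearMap.toSpanSingleton (U g) V (f m)).restrictScalars ℂ ∘ₗ LinearMap.mulLeft ℂ y ∘ₗ
        (UniversalEnvelopingAlgebra.ι ℂ : g →ₗ⁅ℂ⁆ U g).toLinearMap)
    have hK : ∀ x : g, x ∈ K ↔ (y * toU x) • f m ∈ leviKernel b S E V := fun _ => Iff.rfl
    rw [← mul_smul]
    -- `y x` is rewritten as `x y - [x, y]`: the generalized kernel is stable under `a + h`, and the
    -- commutator is a combination of words of the same length.
    refine (hK x).mp ((levi_le hS).trans (sup_le (fun t ht => ?_) (iSup₂_le fun α hα x hx => ?_))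
      x.2)
    · rw [hK, eq_sub_of_add_eq (hl.commutator_cartan ⟨t, ht⟩).symm, sub_smul, smul_assoc, mul_smul]
      exact sub_mem (leviKernel_cartan _ (hm l y hl hl0))
        (Submodule.smul_mem _ _ (hm l y hl hl0))
    · rw [hK, show y * toU x = toU x * y - (toU x * y - y * toU x) by abel, sub_smul, mul_smul]
      refine sub_mem (leviKernel_levi hS (rootSpace_le_levi hS hα hx) (hm l y hl hl0))
        (wordSpan_smul_mem (fun l' y' hl' h1 _ => hm l' y' hl' ?_)
          (hl.commutator_levi hS hα hx))
      rintro rfl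
      exact hl0 (List.length_eq_zero_iff.mp h1.symm))

theorem exists_wordHeight {δ : H}
    (hδ : ∀ α : H.root, b.IsPos α → ∃ k : ℕ, 0 < k ∧ (rootSystem H).root α δ = k)
    (l : List H.root) (hl : ∀ β ∈ l, β ∈ outNeg b S) : ∃ k : ℕ, wordWeight l δ = -k := by
  induction l with
  | nil => exact ⟨0, by simp [wordWeight]⟩
  | cons β l ih =>
    obtain ⟨k, hk⟩ := ih fun β hβ => hl β (List.mem_cons_of_mem _ hβ)
    obtain ⟨j, -, hj⟩ := root_outNeg (z := δ) (fun α hα => hδ α hα.1) (hl β List.mem_cons_self)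
    exact ⟨j + k, by rw [wordWeight_cons, LinearMap.add_apply, hj, hk]; push_cast; ring⟩

/-- The scalars by which the Casimir element of `a + h` may act on the vectors of lower degree. -/
def lowerScalars (b : (rootSystem H).Base) (S : Set H.root) (Λ : Set (Module.Dual ℂ H)) : Set ℂ :=
  {c | ∃ κ ∈ Λ, ∃ l : List H.root, l ≠ [] ∧ (∀ β ∈ l, β ∈ outNeg b S) ∧
    c = casimirScalar b (wordWeight l + κ)}

/-- If it were proper, there would be a weight vector `m` outside it that is a highest weight vector
modulo it. For a word `y` use induction on its depth `N`. The Casimir element of `a + h` acts on `y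
f(m)` by the scalar of its weight, up to terms built from `x y f(m) = [x, y] f(m) + y f(x m)` with
`x ∈ a ∩ n₊`; the first part has smaller depth, and `x m` already belongs to the submodule. -/
theorem wordKernel_eq_top (hS : S ⊆ b.support) (hf : IsParabolicMap b S ν f)
    {Λ : Set (Module.Dual ℂ H)} (hΛ : ∀ μ ∈ Λ, μ - ν ∈ rootLattice (rootSystem H) S)
    (hM : WeightLF (leviCartan S) (leviNPos b S) M)
    (hfac : CompositionFactorsIn (leviCartan S) (leviNPos b S) (restrictWeight S '' Λ) M) :
    wordKernel hS hf (lowerScalars b S Λ) = ⊤ := by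
  by_contra hne
  obtain ⟨κ, hκ, m, hm, hmw, hmn⟩ := exists_hw_lift hS hM hfac hne
  obtain ⟨δ, hδ⟩ := exists_height b
  refine hm ?_
  have hfm := hf.map_mem_weightSpace hS
    (fun z hz => apply_perp_of_sub_mem hS (hΛ κ hκ) hz) hmw
  have key : ∀ N : ℕ, ∀ l y, IsWord (outNeg b S) l y → l ≠ [] → wordWeight l δ = -(N : ℂ) →
      y • f m ∈ leviKernel b S (lowerScalars b S Λ) V := by
    intro N
    induction N using Nat.strong_induction_on with
    | _ N ih =>
      intro l y hl hl0 hN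
      refine mem_generalizedKernel_of_sub (E := lowerScalars b S Λ)
        (e := casimirScalar b (wordWeight l + κ)) ⟨κ, hκ, l, hl0, hl.mem, rfl⟩
        (leviCasimir_sub_mem hS (hl.smul_mem_weightSpace hfm) _
          (fun x w hw => leviKernel_levi hS x.2 hw) fun x hx => ?_)
      have h1 : Submodule.span ℂ {x : levi S | ∃ α ∈ leviRoots S ∩ {α | b.IsPos α},
          (x : g) ∈ rootSpace H (α.1 : H → ℂ)} ≤
          (transporter (y • f m) (leviKernel b S (lowerScalars b S Λ) V)).comap
            (levi S).toSubmodule.subtype := by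
        refine Submodule.span_le.mpr ?_
        rintro x ⟨α, ⟨hα, hpos⟩, hx⟩
        change toU (x : g) • y • f m ∈ leviKernel b S (lowerScalars b S Λ) V
        rw [← mul_smul, ← sub_add_cancel (toU (x : g) * y) (y * toU (x : g)), add_smul, mul_smul y,
          hf.levi_smul]
        refine add_mem (wordSpan_smul_mem (fun l' y' hl' h1 h2 => ?_)
          (hl.commutator_levi hS hα hx))
          (hmn x (rootSpace_le_rootSum (A := {α | b.IsPos α}) hpos hx) l y hl hl0)
        obtain ⟨N', hN'⟩ := exists_wordHeight hδ l' hl'.mem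
        obtain ⟨k, hk, hk'⟩ := hδ α hpos
        refine ih N' ?_ l' y' hl' ?_ hN'
        · have h3 : (N : ℂ) = ((N' + k : ℕ) : ℂ) := by
            have := congrArg (fun γ => γ δ) h2
            simp only [LinearMap.add_apply] at this
            rw [hN', hk', hN] at this
            push_cast
            linear_combination this
          have h4 : N = N' + k := by exact_mod_cast h3
          omega
        · rintro rfl
          exact hl0 (List.length_eq_zero_iff.mp h1.symm)
      exact h1 (mem_span_of_coe_mem hS Set.inter_subset_left (coe_mem_of_mem_leviNPos hS hx))
  intro l y hl hl0
  obtain ⟨N, hN⟩ := exists_wordHeight hδ l hl.mem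
  exact key N l y hl hl0 hN

/-- `f(M)` is `p`-stable, so `V` is spanned by words in the opposite nilradical applied to `f(M)`.
The nonempty words land in the generalized kernel. -/
theorem exists_add_word (hS : S ⊆ b.support) (hf : IsParabolicMap b S ν f)
    (hgen : Submodule.span (U g) (Set.range f) = ⊤) {E : Set ℂ} (hE : wordKernel hS hf E = ⊤)
    (v : V) : ∃ m : M, ∃ w ∈ leviKernel b S E V, v = f m + w := by
  let W : Submodule ℂ V := Submodule.span ℂ
    {v | ∃ l y m, IsWord (outNeg b S) l y ∧ l ≠ [] ∧ v = y • f m}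
  have hW : W ≤ leviKernel b S E V := by
    refine Submodule.span_le.mpr ?_
    rintro _ ⟨l, y, m, hl, hl0, rfl⟩
    have hm : m ∈ wordKernel hS hf E := hE ▸ Submodule.mem_top
    exact hm l y hl hl0
  have key : ∀ y : U g, ∀ w ∈ LinearMap.range f, y • w ∈ LinearMap.range f ⊔ W := by
    refine U_smul_mem_of_stable (rootSum (outNeg b S)) (parabolicSubalgebra b hS).toSubmodule
      (isCompl_parabolic hS).sup_eq_top _ _ (fun x hx m hm => hf.smul_mem_range hS hx hm)
      le_sup_left ?_
    intro x hx m hm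
    refine rootSum_smul_mem (fun α hα x hx => ?_) x hx
    obtain ⟨_, ⟨m, rfl⟩, w, hw, rfl⟩ := Submodule.mem_sup.mp hm
    rw [smul_add]
    refine Submodule.mem_sup_right (add_mem (Submodule.subset_span
      ⟨[α], toU x, m, ?_, List.cons_ne_nil _ _, rfl⟩) ?_)
    · have := IsWord.cons hα hx (IsWord.nil (A := outNeg b S))
      rwa [mul_one] at this
    · have hle : W ≤ W.comap (Algebra.lsmul ℂ ℂ V (toU x)) := by
        refine Submodule.span_le.mpr ?_
        rintro _ ⟨l, y, m, hl, hl0, rfl⟩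
        exact Submodule.subset_span ⟨α :: l, toU x * y, m, hl.cons hα hx, List.cons_ne_nil _ _,
          (mul_smul _ _ _).symm⟩
      exact hle hw
  have hv : v ∈ Submodule.span (U g) (Set.range f) := hgen ▸ Submodule.mem_top
  have h1 : ∀ v ∈ Submodule.span (U g) (Set.range f), ∀ y : U g, y • v ∈ LinearMap.range f ⊔ W := by
    intro v hv
    induction hv using Submodule.span_induction with
    | mem x hx => exact fun y => key y x hx
    | zero => intro y; rw [smul_zero]; exact zero_mem _
    | add x w _ _ hx hw => intro y; rw [smul_add]; exact add_mem (hx y) (hw y)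
    | smul a x _ hx => intro y; rw [← mul_smul]; exact hx _
  have h2 := h1 v hv 1
  rw [one_smul] at h2
  obtain ⟨_, ⟨m, rfl⟩, w, hw, h⟩ := Submodule.mem_sup.mp h2
  exact ⟨m, w, hW hw, h.symm⟩

/-- Both scalars equal `(η, η) - (ρ, ρ)`. -/
theorem casimirScalar_blockWeights {κ μ : Module.Dual ℂ H} (hκ : κ ∈ blockWeights b S η)
    (hμ : μ ∈ blockWeights b S η) : casimirScalar b κ = casimirScalar b μ := by
  obtain ⟨x, -, rfl⟩ := hκ
  obtain ⟨y, -, rfl⟩ := hμ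
  simp only [casimirScalar_eq, sub_add_cancel, cartanForm_neg_left, cartanForm_neg_right,
    cartanForm_weylGroup]

/-- If the preimage of the generalized kernel in `M` were proper, a highest weight vector modulo it
would belong to it, as all weights allowed have the same scalar. The Casimir element is central, so
the property spreads from `f(M)` to `V`. -/
theorem mem_generalizedKernel_casimir (hS : S ⊆ b.support) (hf : IsParabolicMap b S ν f)
    (hgen : Submodule.span (U g) (Set.range f) = ⊤) (hν : ν ∈ blockWeights b S η)
    (hΛ : ∀ μ ∈ blockWeights b S η, μ - ν ∈ rootLattice (rootSystem H) S)
    (hM : WeightLF (leviCartan S) (leviNPos b S) M)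
    (hfac : CompositionFactorsIn (leviCartan S) (leviNPos b S)
      (restrictWeight S '' blockWeights b S η) M) (v : V) :
    v ∈ generalizedKernel (casimir b) {casimirScalar b ν} V := by
  have hG : ∀ x : g, ∀ w ∈ generalizedKernel (casimir b) {casimirScalar b ν} V,
      toU x • w ∈ generalizedKernel (casimir b) {casimirScalar b ν} V :=
    fun x w hw => smul_mem_generalizedKernel (commute_casimir b x) hw
  have h1 : hf.comap _ (fun x w hw => hG x w hw) = ⊤ := by
    by_contra hne
    obtain ⟨κ, hκ, m, hm, hmw, hmn⟩ := exists_hw_lift hS hM hfac hne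
    have hfm := hf.map_mem_weightSpace hS
      (fun z hz => apply_perp_of_sub_mem hS (hΛ κ hκ) hz) hmw
    refine hm (mem_generalizedKernel_of_sub (E := {casimirScalar b ν}) (e := casimirScalar b κ)
      (casimirScalar_blockWeights hκ hν) (casimir_sub_mem hfm _ hG fun x hx => ?_))
    obtain ⟨y, hy, h⟩ := hf.nPos_smul hS hx
    rw [h]
    exact hmn y hy
  have h2 : Submodule.span (U g) (Set.range f) ≤ stableSubmodule _ hG := by
    refine Submodule.span_le.mpr ?_
    rintro _ ⟨m, rfl⟩
    exact (h1 ▸ Submodule.mem_top : m ∈ hf.comap _ (fun x w hw => hG x w hw))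
  rw [hgen] at h2
  exact h2 (Submodule.mem_top (x := v))

/-- The weights of the highest weight vectors in subquotients of induced modules. -/
theorem IsParabolicMap.mem_blockWeights (hf : IsParabolicMap b S ν f) (hS : S ⊆ b.support)
    (hgen : Submodule.span (U g) (Set.range f) = ⊤) (hν : ν ∈ blockWeights b S η)
    (hη : ∀ α, b.IsPos α → ∃ n : ℕ, 0 < n ∧ (rootSystem H).coroot' α η = n)
    (hΛ : ∀ μ ∈ blockWeights b S η, μ - ν ∈ rootLattice (rootSystem H) S)
    (hM : WeightLF (leviCartan S) (leviNPos b S) M)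
    (hfac : CompositionFactorsIn (leviCartan S) (leviNPos b S)
      (restrictWeight S '' blockWeights b S η) M)
    {N : Submodule (U g) V} {K : Submodule (U g) N} {μ : Module.Dual ℂ H} {v : N ⧸ K}
    (hv : IsHW (nPos b) μ v) (hv0 : v ≠ 0) : μ ∈ blockWeights b S η := by
  obtain ⟨z, hz, hz'⟩ := exists_grading (b := b) hS
  have hN : WeightLF H (nPos b) N :=
    (hf.weightLF hS hgen hM).of_injective N.subtype N.injective_subtype
  obtain ⟨n, hn, rfl⟩ := exists_weight_lift hN.iSup_eq_top K.mkQ (Submodule.mkQ_surjective K) hv.1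
  by_cases hμz : μ z = ν z
  · have hnV : (n : V) ∈ degSpace z (ν z) V :=
      mem_degSpace.mpr ((congrArg Subtype.val (hn z)).trans (by rw [hμz]; rfl))
    obtain ⟨m, hm⟩ := hf.mem_range_of_mem_degSpace hS hgen hz hz' hnV
    have hn0 : (n : V) ≠ 0 := fun h => hv0 (by
      rw [show n = 0 from Subtype.ext h, map_zero])
    -- The subquotient `N / K` of `V` is cut down to a subquotient of `M` in which the class of `m`
    -- is still a nonzero highest weight vector.
    let N' : Submodule (U (levi S)) M :=
      hf.comap (N.restrictScalars ℂ) fun y w hw => N.smul_mem _ hw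
    let K' : Submodule (U (levi S)) N' := (hf.comap ((K.map N.subtype).restrictScalars ℂ)
      fun y w hw => (K.map N.subtype).smul_mem _ hw).comap N'.subtype
    have hmN : m ∈ N' := by
      change f m ∈ N
      rw [hm]
      exact n.2
    have hK' : ∀ (w : M) (hw : w ∈ N') (k : N), (k : V) = f w →
        (K'.mkQ ⟨w, hw⟩ = 0 ↔ K.mkQ k = 0) := by
      intro w hw k hk
      change Submodule.Quotient.mk (p := K') _ = 0 ↔ Submodule.Quotient.mk (p := K) _ = 0
      rw [Submodule.Quotient.mk_eq_zero, Submodule.Quotient.mk_eq_zero]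
      refine ⟨?_, fun h => ⟨k, h, hk⟩⟩
      rintro ⟨k', hk', h⟩
      rwa [show k = k' from Subtype.ext (hk.trans h.symm)]
    have hw : IsHW (leviNPos b S) (restrictWeight S μ) (K'.mkQ ⟨m, hmN⟩) := by
      constructor
      · intro t
        have h1 : K'.mkQ (toU (t : levi S) • ⟨m, hmN⟩ - restrictWeight S μ t • ⟨m, hmN⟩) = 0 := by
          refine (hK' _ (sub_mem (N'.smul_mem _ hmN) ((N'.restrictScalars ℂ).smul_mem _ hmN)) 0
            ?_).mpr (map_zero _)
          rw [map_sub, ← hf.levi_smul, map_smul, hm]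
          exact (sub_eq_zero.mpr (congrArg Subtype.val (hn ⟨((t : levi S) : g), t.2⟩))).symm
        rw [map_sub, sub_eq_zero, map_smul, map_smul_complex] at h1
        exact h1
      · intro x hx
        have h1 := hv.2 (x : g) hx
        rw [← map_smul] at h1
        rw [← map_smul]
        refine (hK' _ (N'.smul_mem _ hmN) (toU (x : g) • n) ?_).mpr h1
        rw [← hf.levi_smul, hm]
        rfl
    obtain ⟨nm, δ, ht⟩ := exists_isTriangular_levi (b := b) hS
    obtain ⟨κ, hκ, h⟩ := ht.mem_of_isHW ((hfac.of_injective N'.subtype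
      N'.injective_subtype).of_surjective K'.mkQ (Submodule.mkQ_surjective K')) hw
      (fun h => hv0 ((hK' m hmN n hm.symm).mp h))
    have : μ = κ := by
      refine weight_ext hS h.symm fun z hz => ?_
      rw [apply_perp_of_sub_mem hS (hΛ κ hκ) hz]
      refine smul_left_injective ℂ hn0 ?_
      change μ z • (n : V) = ν z • (n : V)
      rw [← hm, ← hf.perp_smul z hz, hm]
      exact (congrArg Subtype.val (hn z)).symm
    rwa [this]
  · exfalso
    -- Write `n = f(m) + w` with `w` in the kernel. Then `z - ν(z)` kills `f(m)` and multiplies `n`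
    -- by the nonzero scalar `μ(z) - ν(z)`, so `n` lies in the kernel together with `w`.
    have h1 : (n : V) ∈ leviKernel b S (lowerScalars b S (blockWeights b S η)) V := by
      obtain ⟨m, w, hw, h⟩ := exists_add_word hS hf hgen (wordKernel_eq_top hS hf hΛ hM hfac) n
      have h2 : toU (z : g) • (n : V) = μ z • (n : V) := congrArg Subtype.val (hn z)
      have h3 : (μ z - ν z) • (n : V) = toU (z : g) • w - ν z • w := by
        rw [sub_smul, ← h2, h, smul_add, smul_add, hf.perp_smul z hz]
        abel
      have h4 : (μ z - ν z) • (n : V) ∈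
          leviKernel b S (lowerScalars b S (blockWeights b S η)) V := by
        rw [h3]
        exact sub_mem (leviKernel_cartan z hw) (Submodule.smul_mem _ _ hw)
      have h5 := Submodule.smul_mem _ (μ z - ν z)⁻¹ h4
      rwa [smul_smul, inv_mul_cancel₀ (sub_ne_zero.mpr hμz), one_smul] at h5
    have h2 := mem_generalizedKernel_casimir hS hf hgen hν hΛ hM hfac (n : V)
    -- Both Casimir elements act on the highest weight vector by `casimirScalar b μ`. This number is
    -- then the scalar of the block and also a scalar of the lower part, which `casimirScalar_ne`
    -- excludes.
    have h3 := mem_of_mem_generalizedKernel (map_mem_generalizedKernel K.mkQ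
      (mem_generalizedKernel_of_map N.subtype N.injective_subtype h1)) hv0
      (leviCasimir_smul_of_isHW hS hv)
    have h4 := mem_of_mem_generalizedKernel (map_mem_generalizedKernel K.mkQ
      (mem_generalizedKernel_of_map N.subtype N.injective_subtype h2)) hv0
      (casimir_smul_of_isHW hv)
    obtain ⟨κ, ⟨x, hx, rfl⟩, l, hl0, hl, h5⟩ := h3
    obtain ⟨x', -, rfl⟩ := hν
    refine casimirScalar_ne hS hη (x' := x') hx (l.map negRoot) ?_ (by simpa using hl0)
      ((Set.mem_singleton_iff.mp h4).symm.trans (h5.trans (congrArg _ ?_)))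
    · intro β hβ
      obtain ⟨α, hα, rfl⟩ := List.mem_map.mp hβ
      exact mem_outNeg_iff.mp (hl α hα)
    · have : ∀ l : List H.root,
          ((l.map negRoot).map (rootSystem H).root).sum = - wordWeight l := by
        intro l
        induction l with
        | nil => simp [wordWeight]
        | cons α l ih =>
          rw [List.map_cons, List.map_cons, List.sum_cons, ih, root_negRoot, wordWeight_cons,
            neg_add]
      rw [this, sub_neg_eq_add, add_comm]

end Factors

end CategoryO

end

noncomputable section

namespace CategoryO

/-! ### Truncation and induction -/

section Truncation

set_option linter.unusedSectionVars false

attribute [local instance] LieRing.ofAssociativeRing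

variable {g : Type u} [LieRing g] [LieAlgebra ℂ g] [FiniteDimensional ℂ g] [IsKilling ℂ g]
  {H : LieSubalgebra ℂ g} [H.IsCartanSubalgebra] {b : (rootSystem H).Base} {S : Set H.root}
  {ν : Module.Dual ℂ H} {Λ : Set (Module.Dual ℂ H)}
  {M : Type u} [AddCommGroup M] [Module ℂ M] [Module (U (levi S)) M]
  [IsScalarTower ℂ (U (levi S)) M]
  {V : Type u} [AddCommGroup V] [Module ℂ V] [Module (U g) V] [IsScalarTower ℂ (U g) V]
  {f : M →ₗ[ℂ] V}

theorem weightSpace_le_truncSubspace {μ : Module.Dual ℂ H}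
    (hμ : μ - ν ∈ rootLattice (rootSystem H) S) : weightSpace H μ V ≤ truncSubspace S ν V :=
  le_iSup₂ (f := fun (μ : Module.Dual ℂ H)
    (_ : μ - ν ∈ AddSubgroup.closure ((rootSystem H).root '' S)) => weightSpace H μ V) μ hμ

/-- The nilradical of the parabolic subalgebra acts by zero on the truncation. -/
theorem outPos_smul_truncSubspace (hS : S ⊆ b.support)
    (hΛ : ∀ μ ∈ Λ, μ - ν ∈ rootLattice (rootSystem H) S) (hV : WeightLF H (nPos b) V)
    (hfac : CompositionFactorsIn H (nPos b) Λ V) {x : g} (hx : x ∈ rootSum (outPos b S)) {v : V}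
    (hv : v ∈ truncSubspace S ν V) : toU x • v = 0 := by
  obtain ⟨z, hz, hz'⟩ := exists_grading (b := b) hS
  obtain ⟨δ, hδ, ht⟩ := exists_isTriangular b
  have h1 : ∀ μ : Module.Dual ℂ H, μ z = ν z → ∀ v ∈ weightSpace H μ V,
      ∀ x ∈ rootSum (outPos b S), toU x • v = 0 := by
    intro μ hμ v hv x hx
    rw [← Submodule.mem_bot ℂ]
    refine rootSum_smul_mem (fun α hα x hx => ?_) x hx
    rw [Submodule.mem_bot]
    by_contra h0
    obtain ⟨k, hk, hk'⟩ := hz' α hα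
    -- Climbing from a nonzero `x v` never decreases the eigenvalue of `z`, so it would end in a
    -- highest weight vector of degree above `ν(z)`. All highest weights have degree `ν(z)`.
    obtain ⟨κ, w, ⟨j, hj, hκ⟩, hw0, hw⟩ := hV.exists_isHW_of_mem δ
      (fun κ => ∃ k : ℕ, 0 < k ∧ κ z = ν z + k) (by
        rw [nPos_eq_rootSum, rootSum_eq_span]
        refine Submodule.span_mono ?_
        rintro x ⟨β, hβ, hx⟩
        obtain ⟨k, hk, hk'⟩ := hδ β hβ
        refine ⟨Submodule.subset_span ⟨β, hβ, hx⟩, (rootSystem H).root β, k, hk, hk', ?_,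
          lie_eq_of_mem_rootSpace hx⟩
        rintro κ ⟨j, hj, hκ⟩
        by_cases hβ' : β ∈ leviRoots S
        · exact ⟨j, hj, by
            rw [LinearMap.add_apply, (mem_leviPerp_iff hS).mp hz β hβ', zero_add, hκ]⟩
        · obtain ⟨i, hi, hi'⟩ := hz' β ⟨hβ, hβ'⟩
          exact ⟨i + j, Nat.add_pos_left hi j, by
            rw [LinearMap.add_apply, hi', hκ]; push_cast; ring⟩)
      (weight_shift (lie_eq_of_mem_rootSpace hx) hv) h0
      ⟨k, hk, by rw [LinearMap.add_apply, hk', hμ, add_comm]⟩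
    have h2 := apply_perp_of_sub_mem hS (hΛ κ (ht.mem_of_isHW hfac hw hw0)) hz
    rw [hκ, add_eq_left] at h2
    exact hj.ne' (by exact_mod_cast h2)
  have h2 : truncSubspace S ν V ≤ LinearMap.ker (Algebra.lsmul ℂ ℂ V (toU x)) :=
    iSup₂_le fun μ hμ v hv => h1 μ (apply_perp_of_sub_mem hS hμ hz) v hv x hx
  exact h2 hv

/-- The inclusion of the truncation is parabolic. -/
theorem isParabolicMap_of_truncSubspace (hS : S ⊆ b.support)
    (hΛ : ∀ μ ∈ Λ, μ - ν ∈ rootLattice (rootSystem H) S) (hV : WeightLF H (nPos b) V)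
    (hfac : CompositionFactorsIn H (nPos b) Λ V)
    (hlevi : ∀ (y : levi S) (m : M), toU (y : g) • f m = f (toU y • m))
    (hf : ∀ m, f m ∈ truncSubspace S ν V) : IsParabolicMap b S ν f where
  levi_smul := hlevi
  perp_smul _ hz m := mem_degSpace.mp (truncSubspace_le_degSpace hS hz (hf m))
  out_smul _ hx m := outPos_smul_truncSubspace hS hΛ hV hfac hx (hf m)

/-- The truncation generates. -/
theorem span_truncSubspace (hΛ : ∀ μ ∈ Λ, μ - ν ∈ rootLattice (rootSystem H) S)
    (hV : WeightLF H (nPos b) V) (hfac : CompositionFactorsIn H (nPos b) Λ V) :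
    Submodule.span (U g) (truncSubspace S ν V : Set V) = ⊤ := by
  by_contra hne
  obtain ⟨δ, -, ht⟩ := exists_isTriangular b
  let G := Submodule.span (U g) (truncSubspace S ν V : Set V)
  have : Nontrivial (V ⧸ G) := Submodule.Quotient.nontrivial_iff.mpr hne
  have hG := Submodule.mkQ_surjective G
  obtain ⟨μ, v, hv0, hv⟩ := ht.exists_isHW (hV.of_surjective G.mkQ hG)
  have hμ := hΛ μ (ht.mem_of_isHW (hfac.of_surjective G.mkQ hG) hv hv0)
  -- The highest weight of the quotient lies in `ν + ℤS`, so a weight vector lifting `v` belongs to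
  -- the truncation and is zero in the quotient.
  obtain ⟨w, hw, rfl⟩ := exists_weight_lift hV.iSup_eq_top G.mkQ hG hv.1
  exact hv0 ((Submodule.Quotient.mk_eq_zero G).mpr
    (Submodule.subset_span (weightSpace_le_truncSubspace hμ hw)))

theorem IsParabolicMap.weightLF_of_injective (hf : IsParabolicMap b S ν f)
    (hinj : Function.Injective f) (hV : WeightLF H (nPos b) V)
    (hr : LinearMap.range f = truncSubspace S ν V) :
    WeightLF (leviCartan S) (leviNPos b S) M where
  iSup_eq_top := by
    have h1 : truncSubspace S ν V ≤
        (⨆ κ : Module.Dual ℂ (leviCartan S), weightSpace (leviCartan S) κ M).map f := by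
      refine iSup₂_le fun μ hμ v hv => ?_
      obtain ⟨m, rfl⟩ := hr.ge (weightSpace_le_truncSubspace hμ hv)
      exact ⟨m, Submodule.mem_iSup_of_mem _ (hf.mem_weightSpace hinj hv), rfl⟩
    refine eq_top_iff.mpr fun m _ => ?_
    obtain ⟨m', hm', h⟩ := h1 (hr.le ⟨m, rfl⟩)
    rwa [← hinj h]
  locallyFinite m := by
    obtain ⟨F, hF, hm, hn⟩ := hV.locallyFinite (f m)
    refine ⟨F.comap f, ?_, hm, fun x hx v hv => ?_⟩
    · let φ : F.comap f →ₗ[ℂ] F := f.restrict fun _ hx => hx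
      exact Module.Finite.of_injective φ fun v w h => Subtype.ext (hinj (congrArg Subtype.val h))
    · change f (toU x • v) ∈ F
      rw [← hf.levi_smul]
      exact hn _ hx _ hv

/-- Finitely many generators of `V` can be chosen in the image of `f`. Together with `U(a)` they
span a submodule of `M` that generates `V` too, and comparison in degree `ν(z)` shows that it is all
of `M`. -/
theorem IsParabolicMap.finite_of_injective (hf : IsParabolicMap b S ν f) (hS : S ⊆ b.support)
    (hinj : Function.Injective f) (hgen : Submodule.span (U g) (Set.range f) = ⊤)
    [hV : Module.Finite (U g) V] : Module.Finite (U (levi S)) M := by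
  classical
  have hfg := hV.fg_top
  rw [← hgen, Submodule.fg_span_iff_fg_span_finset_subset] at hfg
  obtain ⟨s, hs, h⟩ := hfg
  obtain ⟨z, hz, hz'⟩ := exists_grading (b := b) hS
  refine ⟨⟨s.preimage f hinj.injOn, eq_top_iff.mpr fun m _ => ?_⟩⟩
  obtain ⟨m', hm', h'⟩ := hf.mem_map_of_mem_degSpace hS hz hz'
    (Submodule.span (U (levi S)) (s.preimage f hinj.injOn : Set M)) (v := f m) (by
      refine Submodule.span_mono ?_ ((h.symm.trans hgen).ge (Submodule.mem_top (x := f m)))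
      intro v hv
      obtain ⟨m, rfl⟩ := hs hv
      exact ⟨m, Submodule.subset_span (by simpa using hv), rfl⟩)
    (hf.range_le_degSpace hz ⟨m, rfl⟩)
  rwa [← hinj h']

/-- Given a highest weight vector in `N / K`, divide `V` by the `g`-submodule generated by the image
of `K`. In degree `ν(z)` that submodule is only the image of `K`, so the vector gives a nonzero
highest weight vector in a quotient of `V`. -/
theorem IsParabolicMap.compositionFactorsIn_of_injective (hf : IsParabolicMap b S ν f)
    (hS : S ⊆ b.support) (hinj : Function.Injective f)
    (hM : WeightLF (leviCartan S) (leviNPos b S) M)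
    (hfac : CompositionFactorsIn H (nPos b) Λ V) :
    CompositionFactorsIn (leviCartan S) (leviNPos b S) (restrictWeight S '' Λ) M := by
  obtain ⟨nm, δ, ht⟩ := exists_isTriangular_levi (b := b) hS
  obtain ⟨δ', -, ht'⟩ := exists_isTriangular b
  obtain ⟨z, hz, hz'⟩ := exists_grading (b := b) hS
  refine ht.compositionFactorsIn hM fun N K κ v hv hv0 => ?_
  have hN : WeightLF (leviCartan S) (leviNPos b S) N :=
    hM.of_injective N.subtype N.injective_subtype
  obtain ⟨n, hn, rfl⟩ := exists_weight_lift hN.iSup_eq_top K.mkQ (Submodule.mkQ_surjective K) hv.1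
  obtain ⟨μ, rfl, hμ⟩ := exists_weight hS κ ν
  refine ⟨μ, ?_, rfl⟩
  let K' : Submodule (U (levi S)) M := K.map N.subtype
  let G : Submodule (U g) V := Submodule.span (U g) (f '' K')
  have hG : G.mkQ (f n) ≠ 0 := by
    intro h
    obtain ⟨m, ⟨k, hk, rfl⟩, h'⟩ := hf.mem_map_of_mem_degSpace hS hz hz' K'
      ((Submodule.Quotient.mk_eq_zero G).mp h) (hf.range_le_degSpace hz ⟨n, rfl⟩)
    refine hv0 ((Submodule.Quotient.mk_eq_zero K).mpr ?_)
    rwa [← show k = n from Subtype.ext (hinj h')]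
  refine ht'.mem_of_isHW (hfac.of_surjective G.mkQ (Submodule.mkQ_surjective G))
    (v := G.mkQ (f n)) ⟨CategoryO.map_mem_weightSpace G.mkQ (hf.map_mem_weightSpace hS hμ
      (CategoryO.map_mem_weightSpace N.subtype hn)), fun x hx => ?_⟩ hG
  obtain ⟨y, hy, h⟩ := hf.nPos_smul hS hx
  have h1 : y ∈ leviNPos b S := hy
  have h2 := hv.2 y h1
  rw [← map_smul] at h2 ⊢
  rw [h]
  exact (Submodule.Quotient.mk_eq_zero G).mpr (Submodule.subset_span
    ⟨_, ⟨toU y • n, (Submodule.Quotient.mk_eq_zero K).mp h2, rfl⟩, rfl⟩)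

/-- The comparison map from an induced module is bijective. -/
theorem bijective_of_parabolicMap
    (hΛ : ∀ μ ∈ Λ, μ - ν ∈ rootLattice (rootSystem H) S)
    {W : Type u} [AddCommGroup W] [Module ℂ W] [Module (U g) W] [IsScalarTower ℂ (U g) W]
    {f : M →ₗ[ℂ] W} {f' : M →ₗ[ℂ] V}
    (hr : LinearMap.range f = truncSubspace S ν W) (hW : WeightLF H (nPos b) W)
    (hfac : CompositionFactorsIn H (nPos b) Λ W)
    (hinj : Function.Injective f') (hgen : Submodule.span (U g) (Set.range f') = ⊤)
    (φ : W →ₗ[U g] V) (hφ : ∀ m, φ (f m) = f' m) : Function.Bijective φ := by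
  obtain ⟨δ, -, ht⟩ := exists_isTriangular b
  constructor
  -- A nonzero kernel contains a highest weight vector. Its weight is in `ν + ℤS`, so it comes from
  -- `M`, where `φ` is injective.
  · rw [← LinearMap.ker_eq_bot]
    by_contra hne
    have : Nontrivial (LinearMap.ker φ) := Submodule.nontrivial_iff_ne_bot.mpr hne
    have hi := (LinearMap.ker φ).injective_subtype
    obtain ⟨μ, v, hv0, hv⟩ := ht.exists_isHW (hW.of_injective (LinearMap.ker φ).subtype hi)
    have hμ := hΛ μ (ht.mem_of_isHW (hfac.of_injective (LinearMap.ker φ).subtype hi) hv hv0)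
    obtain ⟨m, hm⟩ := hr.ge (weightSpace_le_truncSubspace hμ
      (map_mem_weightSpace (LinearMap.ker φ).subtype hv.1))
    have h1 : f' m = 0 := by rw [← hφ, hm]; exact v.2
    have h2 : m = 0 := hinj (h1.trans (map_zero f').symm)
    rw [h2, map_zero] at hm
    exact hv0 (Subtype.ext hm.symm)
  · rw [← LinearMap.range_eq_top, eq_top_iff, ← hgen, Submodule.span_le]
    rintro _ ⟨m, rfl⟩
    exact ⟨f m, hφ m⟩

end Truncation

/-! ### The universal property of induction and the embedding of `M` -/

section Induction

set_option linter.unusedSectionVars false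

attribute [local instance] LieRing.ofAssociativeRing

variable {g : Type u} [LieRing g] [LieAlgebra ℂ g] [FiniteDimensional ℂ g] [IsKilling ℂ g]
  {H : LieSubalgebra ℂ g} [H.IsCartanSubalgebra] {b : (rootSystem H).Base} {S : Set H.root}
  {ν : Module.Dual ℂ H}
  {M : Type u} [AddCommGroup M] [Module ℂ M] [Module (U (levi S)) M]
  [IsScalarTower ℂ (U (levi S)) M]
  {V : Type u} [AddCommGroup V] [Module ℂ V] [Module (U g) V] [IsScalarTower ℂ (U g) V]

/-- The map of `M` to a `g`-module given by a map of `U(g) ⊗ M`. -/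
def indMap (π : U g ⊗[ℂ] M →ₗ[U g] V) : M →ₗ[ℂ] V :=
  π.restrictScalars ℂ ∘ₗ TensorProduct.mk ℂ (U g) M 1

theorem indMap_apply (π : U g ⊗[ℂ] M →ₗ[U g] V) (m : M) : indMap π m = π (1 ⊗ₜ m) := rfl

theorem smul_indMap (π : U g ⊗[ℂ] M →ₗ[U g] V) (y : U g) (m : M) :
    y • indMap π m = π (y ⊗ₜ m) := by
  rw [indMap_apply, ← map_smul, TensorProduct.smul_tmul', smul_eq_mul, mul_one]

theorem isParabolicMap_indMap (hS : S ⊆ b.support) {π : U g ⊗[ℂ] M →ₗ[U g] V}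
    (hπ : inductionRelations b S ν M ≤ LinearMap.ker π) : IsParabolicMap b S ν (indMap π) := by
  have key : ∀ (y : levi S) (z : leviPerp S) (x : leviNilradical b S) (m : M),
      toU ((y : g) + ((z : H) : g) + (x : g)) • indMap π m =
        indMap π (toU y • m + ν (z : H) • m) := by
    intro y z x m
    have h1 := hπ (Submodule.subset_span ⟨y, z, x, m, rfl⟩)
    rw [LinearMap.mem_ker, map_sub, sub_eq_zero] at h1
    rw [smul_indMap, h1, indMap_apply]
  refine ⟨fun y m => ?_, fun z hz m => ?_, fun x hx m => ?_⟩
  · have := key y 0 0 m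
    simpa using this
  · have := key 0 ⟨z, hz⟩ 0 m
    simpa [toU_zero] using this
  · have := key 0 0 ⟨x, (leviNilradical_eq hS).ge hx⟩ m
    simpa [toU_zero] using this

theorem span_range_indMap {π : U g ⊗[ℂ] M →ₗ[U g] V} (hπ : Function.Surjective π) :
    Submodule.span (U g) (Set.range (indMap π)) = ⊤ := by
  refine eq_top_iff.mpr fun v _ => ?_
  obtain ⟨t, rfl⟩ := hπ v
  induction t using TensorProduct.induction_on with
  | zero => rw [map_zero]; exact zero_mem _
  | tmul y m =>
    rw [← smul_indMap]
    exact Submodule.smul_mem _ _ (Submodule.subset_span ⟨m, rfl⟩)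
  | add s t hs ht => rw [map_add]; exact add_mem (hs trivial) (ht trivial)

/-- `M` is embedded into the induced module. -/
theorem indMap_injective (hS : S ⊆ b.support) {π : U g ⊗[ℂ] M →ₗ[U g] V}
    (hπ : LinearMap.ker π ≤ inductionRelations b S ν M) : Function.Injective (indMap π) := by
  obtain ⟨φ, hφ1, hφ⟩ := exists_right_retraction (parabolicSubalgebra b hS)
    (rootSum (outNeg b S)) (isCompl_parabolic hS) (toU_injective g)
  let χ : U (parabolicSubalgebra b hS) →ₐ[ℂ] U (levi S) :=
    UniversalEnvelopingAlgebra.lift ℂ (parabolicChar b hS ν)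
  -- A left inverse of `M → U(g) ⊗ M`: `φ` retracts `U(g)` onto `U(p)`, which acts on `M` through
  -- `χ`. It vanishes on the relations because `φ` is right `U(p)`-linear.
  let Ψ : U g ⊗[ℂ] M →ₗ[ℂ] M := TensorProduct.lift
    ((Algebra.lsmul ℂ ℂ M).toLinearMap ∘ₗ χ.toLinearMap ∘ₗ φ)
  have hΨ : ∀ (y : U g) (m : M), Ψ (y ⊗ₜ m) = χ (φ y) • m := fun _ _ => rfl
  -- The relations form a left `U(g)`-submodule while `Ψ` is only `ℂ`-linear; the extra factor `y`
  -- makes the induction over the span possible.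
  have key : ∀ t ∈ inductionRelations b S ν M, ∀ y : U g, Ψ (y • t) = 0 := by
    intro t ht
    induction ht using Submodule.span_induction with
    | mem t ht =>
      obtain ⟨y, z, x, m, rfl⟩ := ht
      intro w
      let p := parabolicEquiv b hS (y, z, x)
      have h1 : w * toU ((y : g) + ((z : H) : g) + (x : g)) =
          w * subToU (parabolicSubalgebra b hS) (toU p) := by
        rw [subToU_toU]
        rfl
      rw [smul_sub, TensorProduct.smul_tmul', TensorProduct.smul_tmul', smul_eq_mul, smul_eq_mul,
        mul_one, h1, map_sub, hΨ, hΨ, hφ, map_mul, mul_smul, sub_eq_zero]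
      congr 1
      have h2 : χ (toU p) = toU y + algebraMap ℂ (U (levi S)) (ν (z : H)) := by
        rw [UniversalEnvelopingAlgebra.lift_ι_apply, parabolicChar_apply]
      rw [h2, add_smul, algebraMap_smul]
    | zero => intro w; rw [smul_zero, map_zero]
    | add s t _ _ hs ht => intro w; rw [smul_add, map_add, hs, ht, add_zero]
    | smul a t _ ht => intro w; rw [← mul_smul]; exact ht _
  rw [← LinearMap.ker_eq_bot, LinearMap.ker_eq_bot']
  intro m hm
  have h1 := key (1 ⊗ₜ m) (hπ hm) 1
  rwa [one_smul, hΨ, hφ1, map_one, one_smul] at h1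

/-- The map of `U(g) ⊗ M` given by a map of `M`. -/
def indLift (f : M →ₗ[ℂ] V) : U g ⊗[ℂ] M →ₗ[U g] V :=
  TensorProduct.AlgebraTensorModule.lift
    { toFun := fun y => (Algebra.lsmul ℂ ℂ V y) ∘ₗ f
      map_add' := fun y z => by ext m; simp
      map_smul' := fun y z => by ext m; simp }

theorem indLift_tmul (f : M →ₗ[ℂ] V) (y : U g) (m : M) : indLift f (y ⊗ₜ[ℂ] m) = y • f m := rfl

theorem inductionRelations_le_ker (hS : S ⊆ b.support) {f : M →ₗ[ℂ] V}
    (hf : IsParabolicMap b S ν f) :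
    inductionRelations b S ν M ≤ LinearMap.ker (indLift (g := g) f) := by
  refine Submodule.span_le.mpr ?_
  rintro _ ⟨y, z, x, m, rfl⟩
  change indLift f _ = 0
  rw [map_sub, indLift_tmul, indLift_tmul, one_smul, toU_add, toU_add, add_smul, add_smul,
    hf.levi_smul, hf.perp_smul _ z.2, hf.out_smul _ ((leviNilradical_eq hS).le x.2), add_zero,
    map_add, LinearMap.map_smul f, sub_self]

end Induction

end CategoryO

end

noncomputable section

namespace CategoryO

/-! ### The functors -/

section Functors

set_option linter.unusedSectionVars false

attribute [local instance] LieRing.ofAssociativeRing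

open scoped ModuleCat

theorem CompositionFactorsIn.mono {L : Type u} [LieRing L] [LieAlgebra ℂ L]
    {h : LieSubalgebra ℂ L} {n : Submodule ℂ L} {X Y : Set (Module.Dual ℂ h)} (hXY : X ⊆ Y)
    {M : Type u} [AddCommGroup M] [Module (U L) M] (hM : CompositionFactorsIn h n X M) :
    CompositionFactorsIn h n Y M := fun N K hs =>
  let ⟨μ, hμ, e⟩ := hM N K hs
  ⟨μ, hXY hμ, e⟩

theorem categoryOWithFactors_iff {L : Type u} [LieRing L] [LieAlgebra ℂ L]
    {h : LieSubalgebra ℂ L} {n : Submodule ℂ L} {X : Set (Module.Dual ℂ h)}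
    {M : ModuleCat.{u} (U L)} : categoryOWithFactors h n X M ↔
      Module.Finite (U L) M ∧ WeightLF h n M ∧ CompositionFactorsIn h n X M :=
  ⟨fun ⟨⟨h1, h2, h3⟩, h4⟩ => ⟨h1, ⟨h2, h3⟩, h4⟩, fun ⟨h1, h2, h3⟩ => ⟨⟨h1, h2.1, h2.2⟩, h3⟩⟩

variable {g : Type u} [LieRing g] [LieAlgebra ℂ g] [FiniteDimensional ℂ g] [IsKilling ℂ g]
  {H : LieSubalgebra ℂ g} [H.IsCartanSubalgebra] {b : (rootSystem H).Base} {S : Set H.root}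
  {ν η : Module.Dual ℂ H}

variable (b ν) in
/-- The projection of `U(g) ⊗ M` to the induced module. -/
def indProj (M : ModuleCat.{u} (U (levi S))) : U g ⊗[ℂ] M →ₗ[U g] (parabolicInd b S ν).obj M :=
  (inductionRelations b S ν M).mkQ

theorem indProj_surjective (M : ModuleCat.{u} (U (levi S))) :
    Function.Surjective (indProj b ν M) :=
  Submodule.mkQ_surjective _

theorem ker_indProj (M : ModuleCat.{u} (U (levi S))) :
    LinearMap.ker (indProj b ν M) = inductionRelations b S ν M :=
  Submodule.ker_mkQ _

variable (b ν) in
/-- The embedding of `M` into the induced module. -/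
def indUnit (M : ModuleCat.{u} (U (levi S))) : M →ₗ[ℂ] (parabolicInd b S ν).obj M :=
  indMap (indProj b ν M)

theorem isParabolicMap_indUnit (hS : S ⊆ b.support) (M : ModuleCat.{u} (U (levi S))) :
    IsParabolicMap b S ν (indUnit b ν M) :=
  isParabolicMap_indMap hS (ker_indProj M).ge

theorem span_range_indUnit (M : ModuleCat.{u} (U (levi S))) :
    Submodule.span (U g) (Set.range (indUnit b ν M)) = ⊤ :=
  span_range_indMap (indProj_surjective M)

theorem indUnit_injective (hS : S ⊆ b.support) (M : ModuleCat.{u} (U (levi S))) :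
    Function.Injective (indUnit b ν M) :=
  indMap_injective hS (ker_indProj M).le

variable (S ν) in
/-- The inclusion of the truncation. -/
def truncIncl (N : ModuleCat.{u} (U g)) : (trunc S ν).obj N →ₗ[ℂ] N where
  toFun m := (show truncSubmodule S ν N from m).1
  map_add' _ _ := rfl
  map_smul' c m := by
    change leviToU S (algebraMap ℂ (U (levi S)) c) • (show truncSubmodule S ν N from m).1 = _
    rw [AlgHom.commutes]
    rfl

theorem truncIncl_injective (N : ModuleCat.{u} (U g)) : Function.Injective (truncIncl S ν N) :=
  fun _ _ h => Subtype.ext h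

theorem range_truncIncl (N : ModuleCat.{u} (U g)) :
    LinearMap.range (truncIncl S ν N) = truncSubspace S ν N := by
  refine le_antisymm ?_ fun v hv => ⟨(⟨v, hv⟩ : truncSubmodule S ν N), rfl⟩
  rintro _ ⟨m, rfl⟩
  exact (show truncSubmodule S ν N from m).2

theorem truncIncl_mem (N : ModuleCat.{u} (U g)) (m) : truncIncl S ν N m ∈ truncSubspace S ν N :=
  (range_truncIncl N).le ⟨m, rfl⟩

theorem truncIncl_smul (N : ModuleCat.{u} (U g)) (y : U (levi S)) (m : (trunc S ν).obj N) :
    truncIncl S ν N (y • m) = leviToU S y • truncIncl S ν N m := rfl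

theorem leviToU_toU (y : levi S) : leviToU S (toU y) = toU (y : g) := by
  simp [leviToU]

variable {Λ : Set (Module.Dual ℂ H)}

theorem isParabolicMap_truncIncl (hS : S ⊆ b.support)
    (hΛ : ∀ μ ∈ Λ, μ - ν ∈ rootLattice (rootSystem H) S) {N : ModuleCat.{u} (U g)}
    (hN : categoryOWithFactors H (nPos b) Λ N) : IsParabolicMap b S ν (truncIncl S ν N) := by
  obtain ⟨-, h1, h2⟩ := categoryOWithFactors_iff.mp hN
  exact isParabolicMap_of_truncSubspace hS hΛ h1 h2
    (fun y m => by rw [truncIncl_smul, leviToU_toU]) (truncIncl_mem N)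

theorem span_range_truncIncl (hΛ : ∀ μ ∈ Λ, μ - ν ∈ rootLattice (rootSystem H) S)
    {N : ModuleCat.{u} (U g)} (hN : categoryOWithFactors H (nPos b) Λ N) :
    Submodule.span (U g) (Set.range (truncIncl S ν N)) = ⊤ := by
  obtain ⟨-, h1, h2⟩ := categoryOWithFactors_iff.mp hN
  rw [← LinearMap.coe_range, range_truncIncl]
  exact span_truncSubspace hΛ h1 h2

/-- Truncation maps into the block for `a`. -/
theorem categoryOWithFactors_trunc (hS : S ⊆ b.support)
    (hΛ : ∀ μ ∈ Λ, μ - ν ∈ rootLattice (rootSystem H) S) {N : ModuleCat.{u} (U g)}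
    (hN : categoryOWithFactors H (nPos b) Λ N) :
    categoryOWithFactors (leviCartan S) (leviNPos b S) (restrictWeight S '' Λ)
      ((trunc S ν).obj N) := by
  have hf := isParabolicMap_truncIncl hS hΛ hN
  have hgen := span_range_truncIncl hΛ hN
  obtain ⟨h1, h2, h3⟩ := categoryOWithFactors_iff.mp hN
  have hi := truncIncl_injective (S := S) (ν := ν) N
  have h4 := hf.weightLF_of_injective hi h2 (range_truncIncl N)
  exact categoryOWithFactors_iff.mpr
    ⟨hf.finite_of_injective hS hi hgen, h4, hf.compositionFactorsIn_of_injective hS hi h4 h3⟩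

/-- Induction maps the block for `a` to the modules with factors in the corresponding block. -/
theorem categoryOWithFactors_parabolicInd (hS : S ⊆ b.support) (hν : ν ∈ blockWeights b S η)
    (hη : ∀ α, b.IsPos α → ∃ n : ℕ, 0 < n ∧ (rootSystem H).coroot' α η = n)
    (hΛ : ∀ μ ∈ blockWeights b S η, μ - ν ∈ rootLattice (rootSystem H) S)
    {M : ModuleCat.{u} (U (levi S))}
    (hM : categoryOWithFactors (leviCartan S) (leviNPos b S)
      (restrictWeight S '' blockWeights b S η) M) :
    categoryOWithFactors H (nPos b) (blockWeights b S η) ((parabolicInd b S ν).obj M) := by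
  obtain ⟨h1, h2, h3⟩ := categoryOWithFactors_iff.mp hM
  have hf := isParabolicMap_indUnit (ν := ν) hS M
  have hgen := span_range_indUnit (b := b) (ν := ν) M
  have h4 := hf.weightLF hS hgen h2
  obtain ⟨δ, -, ht⟩ := exists_isTriangular b
  exact categoryOWithFactors_iff.mpr ⟨hf.finite hgen, h4, ht.compositionFactorsIn h4
    fun N K μ v hv hv0 => hf.mem_blockWeights hS hgen hν hη hΛ h2 h3 hv hv0⟩

theorem range_indUnit (hS : S ⊆ b.support)
    (hΛ : ∀ μ ∈ Λ, μ - ν ∈ rootLattice (rootSystem H) S) {M : ModuleCat.{u} (U (levi S))}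
    (hM : categoryOWithFactors (leviCartan S) (leviNPos b S) (restrictWeight S '' Λ) M) :
    LinearMap.range (indUnit b ν M) = truncSubspace S ν ((parabolicInd b S ν).obj M) := by
  obtain ⟨-, h2, h3⟩ := categoryOWithFactors_iff.mp hM
  exact (isParabolicMap_indUnit hS M).range_eq_truncSubspace hS (span_range_indUnit M) hΛ h2 h3

/-- The map of `M` to the truncation of the induced module. -/
def unitMap (hS : S ⊆ b.support)
    (hΛ : ∀ μ ∈ Λ, μ - ν ∈ rootLattice (rootSystem H) S) {M : ModuleCat.{u} (U (levi S))}
    (hM : categoryOWithFactors (leviCartan S) (leviNPos b S) (restrictWeight S '' Λ) M) :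
    M →ₗ[U (levi S)] (trunc S ν).obj ((parabolicInd b S ν).obj M) where
  toFun m := (⟨indUnit b ν M m, (range_indUnit hS hΛ hM).le ⟨m, rfl⟩⟩ :
    truncSubmodule S ν ((parabolicInd b S ν).obj M))
  map_add' m m' := Subtype.ext ((indUnit b ν M).map_add m m')
  map_smul' y m := Subtype.ext ((isParabolicMap_indUnit (ν := ν) hS M).leviToU_smul y m).symm

theorem truncIncl_unitMap (hS : S ⊆ b.support)
    (hΛ : ∀ μ ∈ Λ, μ - ν ∈ rootLattice (rootSystem H) S) {M : ModuleCat.{u} (U (levi S))}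
    (hM : categoryOWithFactors (leviCartan S) (leviNPos b S) (restrictWeight S '' Λ) M) (m : M) :
    truncIncl S ν _ (unitMap hS hΛ hM m) = indUnit b ν M m := rfl

theorem unitMap_bijective (hS : S ⊆ b.support)
    (hΛ : ∀ μ ∈ Λ, μ - ν ∈ rootLattice (rootSystem H) S) {M : ModuleCat.{u} (U (levi S))}
    (hM : categoryOWithFactors (leviCartan S) (leviNPos b S) (restrictWeight S '' Λ) M) :
    Function.Bijective (unitMap hS hΛ hM) :=
  ⟨fun _ _ h => indUnit_injective hS M (congrArg (truncIncl S ν _) h), fun v => by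
    obtain ⟨m, hm⟩ := (range_indUnit hS hΛ hM).ge (truncIncl_mem _ v)
    exact ⟨m, truncIncl_injective _ hm⟩⟩

theorem parabolicInd_map_indUnit {M N : ModuleCat.{u} (U (levi S))} (f : M ⟶ N) (m : M) :
    ((parabolicInd b S ν).map f).hom (indUnit b ν M m) = indUnit b ν N (f.hom m) := rfl

theorem truncIncl_trunc_map {M N : ModuleCat.{u} (U g)} (f : M ⟶ N) (m : (trunc S ν).obj M) :
    truncIncl S ν N (((trunc S ν).map f).hom m) = f.hom (truncIncl S ν M m) := rfl

/-- The isomorphism of the module induced from the truncation of `N` with `N`. -/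
def counitMap (hS : S ⊆ b.support) (hΛ : ∀ μ ∈ Λ, μ - ν ∈ rootLattice (rootSystem H) S)
    {N : ModuleCat.{u} (U g)} (hN : categoryOWithFactors H (nPos b) Λ N) :
    (parabolicInd b S ν).obj ((trunc S ν).obj N) →ₗ[U g] N :=
  Submodule.liftQ _ (indLift (truncIncl S ν N))
    (inductionRelations_le_ker hS (isParabolicMap_truncIncl hS hΛ hN))

theorem counitMap_mk (hS : S ⊆ b.support) (hΛ : ∀ μ ∈ Λ, μ - ν ∈ rootLattice (rootSystem H) S)
    {N : ModuleCat.{u} (U g)} (hN : categoryOWithFactors H (nPos b) Λ N) (y : U g)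
    (m : (trunc S ν).obj N) :
    counitMap hS hΛ hN (indProj b ν _ (y ⊗ₜ m)) = y • truncIncl S ν N m := rfl

/-- The composition factors of the module induced from the truncation are already known to lie in
the block; this controls the kernel through `bijective_of_parabolicMap`. -/
theorem counitMap_bijective (hS : S ⊆ b.support) (hν : ν ∈ blockWeights b S η)
    (hη : ∀ α, b.IsPos α → ∃ n : ℕ, 0 < n ∧ (rootSystem H).coroot' α η = n)
    (hΛ : ∀ μ ∈ blockWeights b S η, μ - ν ∈ rootLattice (rootSystem H) S)
    {N : ModuleCat.{u} (U g)} (hN : categoryOWithFactors H (nPos b) (blockWeights b S η) N) :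
    Function.Bijective (counitMap hS hΛ hN) := by
  have hM := categoryOWithFactors_trunc hS hΛ hN
  obtain ⟨-, h1, h2⟩ := categoryOWithFactors_iff.mp
    (categoryOWithFactors_parabolicInd hS hν hη hΛ hM)
  refine bijective_of_parabolicMap hΛ (range_indUnit hS hΛ hM) h1 h2 (truncIncl_injective N)
    (span_range_truncIncl hΛ hN) (counitMap hS hΛ hN) fun m => ?_
  exact (counitMap_mk hS hΛ hN 1 m).trans (one_smul _ _)

/-- Induction and truncation are mutually inverse equivalences. -/
theorem exists_equivalence (hS : S ⊆ b.support) (hν : ν ∈ blockWeights b S η)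
    (hη : ∀ α, b.IsPos α → ∃ n : ℕ, 0 < n ∧ (rootSystem H).coroot' α η = n)
    (hΛ : ∀ μ ∈ blockWeights b S η, μ - ν ∈ rootLattice (rootSystem H) S)
    {A : ObjectProperty (ModuleCat.{u} (U (levi S)))} {C : ObjectProperty (ModuleCat.{u} (U g))}
    (hA : ∀ M, A M ↔ categoryOWithFactors (leviCartan S) (leviNPos b S)
      (restrictWeight S '' blockWeights b S η) M)
    (hC : ∀ N, C N ↔ categoryOWithFactors H (nPos b) (blockWeights b S η) N) :
    ∃ (hInd : ∀ M : A.FullSubcategory, C ((parabolicInd b S ν).obj M.obj))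
      (hR : ∀ M : C.FullSubcategory, A ((trunc S ν).obj M.obj))
      (e : A.FullSubcategory ≌ C.FullSubcategory),
      e.functor = C.lift (A.ι ⋙ parabolicInd b S ν) hInd ∧
      e.inverse = A.lift (C.ι ⋙ trunc S ν) hR := by
  have hInd : ∀ M : A.FullSubcategory, C ((parabolicInd b S ν).obj M.obj) := fun M =>
    (hC _).mpr (categoryOWithFactors_parabolicInd hS hν hη hΛ ((hA _).mp M.property))
  have hR : ∀ M : C.FullSubcategory, A ((trunc S ν).obj M.obj) := fun N =>
    (hA _).mpr (categoryOWithFactors_trunc hS hΛ ((hC _).mp N.property))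
  let F := C.lift (A.ι ⋙ parabolicInd b S ν) hInd
  let G := A.lift (C.ι ⋙ trunc S ν) hR
  let unit : 𝟭 A.FullSubcategory ≅ F ⋙ G := NatIso.ofComponents
    (fun M => A.isoMk (LinearEquiv.ofBijective _
      (unitMap_bijective hS hΛ ((hA _).mp M.property))).toModuleIso)
    (fun {M N} f => by
      refine ObjectProperty.hom_ext _ (ModuleCat.hom_ext (LinearMap.ext fun m => ?_))
      refine truncIncl_injective _ ?_
      change truncIncl S ν _ (unitMap hS hΛ ((hA _).mp N.property) (f.hom.hom m)) =
        truncIncl S ν _ (((trunc S ν).map ((parabolicInd b S ν).map f.hom)).hom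
          (unitMap hS hΛ ((hA _).mp M.property) m))
      rw [truncIncl_unitMap, truncIncl_trunc_map, truncIncl_unitMap, parabolicInd_map_indUnit])
  let counit : G ⋙ F ≅ 𝟭 C.FullSubcategory := NatIso.ofComponents
    (fun N => C.isoMk (LinearEquiv.ofBijective _
      (counitMap_bijective hS hν hη hΛ ((hC _).mp N.property))).toModuleIso)
    (fun {M N} f => by
      refine ObjectProperty.hom_ext _ (ModuleCat.hom_ext (Submodule.linearMap_qext _
        (TensorProduct.AlgebraTensorModule.ext fun y m => ?_)))
      exact (map_smul f.hom.hom y _).symm)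
  exact ⟨hInd, hR, CategoryTheory.Equivalence.mk F G unit counit, rfl, rfl⟩

end Functors

end CategoryO

end

/-! ### The equivalence for the dominant regular integral weight -/

theorem mainTheorem5 {g : Type u} [LieRing g] [LieAlgebra ℂ g] [FiniteDimensional ℂ g]
    [LieAlgebra.IsSemisimple ℂ g] (H : LieSubalgebra ℂ g) [H.IsCartanSubalgebra]
    (b : (LieAlgebra.IsKilling.rootSystem H).Base) (lam : Module.Dual ℂ H)
    (hint : CategoryO.IsIntegral lam) (hdom : CategoryO.IsDominant b lam)
    (hreg : CategoryO.IsRegular b lam)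
    (S : Set H.root) (hS : ∀ α ∈ S, α ∈ b.support)
    (wS wB : (LieAlgebra.IsKilling.rootSystem H).weylGroup)
    (hwS : CategoryO.IsLongestElement b S wS)
    (hwB : CategoryO.IsLongestElement b {α | α ∈ b.support} wB) :
    let ν : Module.Dual ℂ H := CategoryO.dot b (wS * wB) lam
    let zeta : Module.Dual ℂ (CategoryO.leviCartan S) := CategoryO.restrictWeight S ν
    let blockA : CategoryTheory.ObjectProperty (ModuleCat.{u} (CategoryO.U (CategoryO.levi S))) :=
      CategoryO.leviBlock b S zeta
    let C : CategoryTheory.ObjectProperty (ModuleCat.{u} (CategoryO.U g)) :=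
      CategoryO.blockWithFactors b lam {y | ∃ x ∈ CategoryO.parabolicSubgroup S, y = x * wB}
    ∃ (hInd : ∀ M : blockA.FullSubcategory, C ((CategoryO.parabolicInd b S ν).obj M.obj))
      (hR : ∀ M : C.FullSubcategory, blockA ((CategoryO.trunc S ν).obj M.obj))
      (e : blockA.FullSubcategory ≌ C.FullSubcategory),
      e.functor = C.lift (blockA.ι ⋙ CategoryO.parabolicInd b S ν) hInd ∧
      e.inverse = blockA.lift (C.ι ⋙ CategoryO.trunc S ν) hR := by
  intro ν zeta blockA C
  have hS' : S ⊆ b.support := hS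
  -- The sign makes `η` positive on all positive coroots; the weights `x w^B · λ` then take the form
  -- `-(x η) - ρ`.
  let η : Module.Dual ℂ H := -(wB • (lam + CategoryO.rho b))
  have hη : ∀ α, b.IsPos α → ∃ n : ℕ, 0 < n ∧
      (LieAlgebra.IsKilling.rootSystem H).coroot' α η = n :=
    fun α hα => CategoryO.exists_pos_coroot' hint hdom hreg hwB hα
  have hdot : ∀ x : (LieAlgebra.IsKilling.rootSystem H).weylGroup,
      CategoryO.dot b (x * wB) lam = -(x • η) - CategoryO.rho b := by
    intro x
    rw [CategoryO.dot, mul_smul, smul_neg, neg_neg]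
  have hν : ν ∈ CategoryO.blockWeights b S η := ⟨wS, hwS.1, hdot wS⟩
  have hη' : ∀ α, ∃ z : ℤ, (LieAlgebra.IsKilling.rootSystem H).coroot' α η = z := by
    intro α
    by_cases hα : b.IsPos α
    · obtain ⟨n, -, hn⟩ := hη α hα
      exact ⟨n, by rw [hn]; simp⟩
    · obtain ⟨n, -, hn⟩ := hη _ ((CategoryO.isPos_negRoot b α).mpr hα)
      rw [CategoryO.coroot'_negRoot] at hn
      exact ⟨-n, by rw [← neg_neg ((LieAlgebra.IsKilling.rootSystem H).coroot' α η), hn]; simp⟩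
  have hY : (fun y => CategoryO.dot b y lam) '' {y | ∃ x ∈ CategoryO.parabolicSubgroup S,
      y = x * wB} = CategoryO.blockWeights b S η := by
    ext μ
    constructor
    · rintro ⟨_, ⟨x, hx, rfl⟩, rfl⟩
      exact ⟨x, hx, hdot x⟩
    · rintro ⟨x, hx, rfl⟩
      exact ⟨x * wB, ⟨x, hx, rfl⟩, hdot x⟩
  refine CategoryO.exists_equivalence hS' hν hη
    (fun μ hμ => CategoryO.sub_mem_of_blockWeights hη' hμ hν) (fun M => ?_) fun N => ?_
  · change CategoryO.categoryOWithFactors _ _ _ M ↔ _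
    rw [CategoryO.restrictWeight_blockWeights hS' hν]
  · change CategoryO.categoryOWithFactors _ _ _ N ∧ CategoryO.CompositionFactorsIn _ _ _ N ↔ _
    rw [hY, CategoryO.categoryOWithFactors_iff, CategoryO.categoryOWithFactors_iff]
    -- Having factors only from `W^S w^B` implies the condition of lying in the block of `λ`.
    refine ⟨fun ⟨⟨h1, h2, _⟩, h3⟩ => ⟨h1, h2, h3⟩,
      fun ⟨h1, h2, h3⟩ => ⟨⟨h1, h2, h3.mono ?_⟩, h3⟩⟩
    rw [← hY]
    exact Set.image_subset_range _ _
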